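/- **Channel.** Alice and Bob run a message-driven protocol of length $N$ over an alphabet $\Sigma$. Alice sends the first symbol; every received symbol triggers one round of the receiver, who sends one symbol, and each party performs at most $N$ rounds (in its own count). One symbol is in transit at any time. An *edit corruption* deletes the symbol in transit and inserts an arbitrary symbol, either in the same direction (substitution) or in the opposite direction (a spoofed reply to the sender). A run is complete when the symbol in transit is addressed to a party that has performed $N$ rounds. A protocol *computes $f$ in the presence of a $\rho$-fraction of edit corruptions* if for all inputs $x,y$, in every complete run with at most $2\rho N$ edit corruptions, both parties reach round $\lfloor(1-2\rho)N\rfloor$, and each of them outputs $f(x,y)$ in that round. **Pointer jumping.** In the complete binary tree of depth $T$, Alice's input $X$ contains exactly one edge leaving each non-leaf vertex of even depth, and Bob's input $Y$ exactly one edge leaving each non-leaf vertex of odd depth. $PJP(T)$ asks for the root-to-leaf path in $X\cup Y$. **Edit-distance tree codes.** A string matching $\tau=(\tau_1,\tau_2):s\to r$ is a pair of equally long strings that become $s$ and $r$ when the stars $*$ are deleted, such that the two symbols in a position are equal or one of them is $*$. $sc(\cdot)$ counts stars, $ED(s,r)=\min_\tau (sc(\tau_1)+sc(\tau_2))$ and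 $$SD(s,r)=\min_\tau\max_i \frac{sc(\tau_1[i..])+sc(\tau_2[i..])}{\#\{\text{non-stars of }\tau_1[i..]\}},$$ where the quotient is $\infty$ if the denominator is $0$. A prefix code of depth $N$ labels each edge of the complete $\Sigma_{in}$-ary tree of depth $N$ by a symbol of $\Sigma_{out}$; $C(m)$ is the string of labels from the root to node $m$. It is an *$\alpha$-edit-distance tree code* if there are no nodes $A,B,D,E$ with $A$ equal to $B$ or an ancestor of $B$, and $D,E\ne B$ descendants of $B$ whose paths from $B$ part at $B$, such that $ED(AD,BE)\le\alpha\max(|AD|,|BE|)$, where $AD$ and $BE$ are the label strings of the paths from $A$ to $D$ and from $B$ to $E$. **Protocol $\pi'$.** Parameters: $\varepsilon>0$, $K=\lceil1/\varepsilon^2\rceil$, $L=\lceil1/\varepsilon\rceil$, $N=\lceil T/\varepsilon^2\rceil$, a prefix code $C$ of depth $N$ over the input alphabet of *pages*. A page consists of a last-page bit and at most $K$ slots of four bits each. Each party keeps a table of edges, each with a binary description, a sent length, live points and the round in which it was inserted, and works in cycles: in a cycle it sends one bit of the description of each edge in the table, $K$ edges per page (one blank page if the table is empty). A slot holds the next bit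 of the description and the flags "live points $=0$", "description sent completely", "new in the table". The description of an edge $e$ inserted in round $i$ consists of $3$ bits for $s$ followed by the binary digits of $i-n$, where $e$ is the $s$-th grandchild ($1\le s\le4$) of the edge whose first full transmission by this party began in round $n$; $n=0$ for an edge of the first two levels. In its round $i$ a party 1. receives a symbol (except Alice in round 1) and computes a page string $d$ of length at most $N$ that minimizes $SD(C(d),r)$, where $r$ is everything it has received (ties are broken in any way); 2. lets $E(d)$ be the set of edges that are fully communicated by $d$ ($\emptyset$ if $d$ is invalid) and considers the union of $E(d)$ and its input; if this has a unique maximal path from the root and the path ends in a leaf $v$, then $v$ gets a vote; 3. if a cycle has been completed, or $i=1$: removes the edges that have been sent completely or have live points $0$; if the path in step 2 is unique and there is an edge $e$ on it that belongs to the party's input and is in the first two levels or has a grandparent already fully sent by this party, takes the deepest such $e$ and either gives it $L$ more live points, if it is in the table, or inserts it with $L$ live points; then begins a new cycle, lowering the live points of each edge in the table by $1$ and increasing its sent length by $1$; 4. sends the symbol $C(s_1\cdots s_i)[i]$, where $s_1,\dots,s_i$ are its pages so far, including the next page of the cycle. The output in a round is a leaf with the most votes so far. **Theorem.** Let $\varepsilon>0$.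 (a) For all $T\ge1$, $N=\lceil T/\varepsilon^2\rceil$ and every $(1-\varepsilon)$-edit-distance tree code $C$ of depth $N$ over the page alphabet, and for every $\rho$ with $0\le\rho\le\frac1{18}-\varepsilon$, the $N$-round protocol $\pi'$ solves $PJP(T)$ in the presence of a $\rho$-fraction of edit corruptions; in particular, both parties output the correct leaf in round $\lfloor(1-2\rho)N\rfloor$. (b) The alphabet size is constant and the rate is constant: there are $q\in\mathbb N$ and $c\in\mathbb R$, depending only on $\varepsilon$, such that for every $T\ge1$ there is a code as in (a) with output alphabet of size $q$, and the communication is $2N\log_2q\le cT$. (c) There are $q\in\mathbb N$ and $c\in\mathbb R$, depending only on $\varepsilon$, such that for every noiseless binary protocol $\pi$ with communication $CC(\pi)\ge1$ there are $N$ and an $N$-round protocol over an alphabet of size $q$, with communication $2N\log_2q\le c\cdot CC(\pi)$, that computes the transcript $\pi(x,y)$ in the presence of a $\rho$-fraction of edit corruptions for every $\rho$ with $0\le\rho\le\frac1{18}-\varepsilon$. -/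

import Mathlib

open scoped ENNReal

universe u v w

/-! ### Strings, edit distance, suffix distance -/

/-- A two-row array of symbols and stars; `none` is the star. -/
abbrev StringMatching (β : Type v) := List (Option β × Option β)

namespace StringMatching

variable {β : Type v}

/-- `τ` is a string matching `s → r`: deleting the stars of its first row gives `s`, deleting those
of its second row gives `r`, and two symbols in one column agree unless one of them is a star. -/
def Matches (τ : StringMatching β) (s r : List β) : Prop :=
  τ.filterMap Prod.fst = s ∧ τ.filterMap Prod.snd = r ∧
    ∀ c ∈ τ, c.1 = none ∨ c.2 = none ∨ c.1 = c.2

/-- The number of stars in both rows. -/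
def stars (τ : StringMatching β) : ℕ :=
  τ.countP (fun c => c.1.isNone) + τ.countP (fun c => c.2.isNone)

/-- The number of non-star symbols in the first row. -/
def symbols (τ : StringMatching β) : ℕ := τ.countP (fun c => c.1.isSome)

end StringMatching

/-- Edit distance: the least number of stars in a string matching. -/
noncomputable def editDist {β : Type v} (s r : List β) : ℕ :=
  sInf {k | ∃ τ : StringMatching β, τ.Matches s r ∧ τ.stars = k}

/-- Suffix distance: minimum over the string matchings of the maximum, over the nonempty suffixes,
of (stars in the suffix) / (sent symbols in the suffix).  A suffix without sent symbols contains a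
star, and its quotient is `∞`. -/
noncomputable def suffixDist {β : Type v} (s r : List β) : ℝ≥0∞ :=
  ⨅ (τ : StringMatching β) (_ : τ.Matches s r), ⨆ (i : ℕ) (_ : i < τ.length),
    (StringMatching.stars (τ.drop i) : ℝ≥0∞) / (StringMatching.symbols (τ.drop i) : ℝ≥0∞)

/-! ### Edit-distance tree codes -/

/-- A prefix code as a labelled tree.  The nodes are the strings over `σ`, and `C m` is the symbol
on the edge that enters the nonempty node `m`.  (The value at the root is not used; the depth is a
parameter of the notions below.) -/
abbrev PrefixCode (σ : Type u) (β : Type v) := List σ → β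

namespace PrefixCode

variable {σ : Type u} {β : Type v}

/-- The codeword of a message: the labels on the path from the root to the node `m`. -/
def encode (C : PrefixCode σ β) (m : List σ) : List β :=
  (List.range m.length).map (fun k => C (m.take (k + 1)))

/-- The labels on the path from the node `a` to its descendant `d`. -/
def labels (C : PrefixCode σ β) (a d : List σ) : List β := (C.encode d).drop a.length

/-- An `α`-bad lambda within depth `n`: nodes `A, B, D, E`, where `A` is `B` or an ancestor of `B`,
the paths from `B` to `D` and to `E` are nonempty and part at `B`, and
`ED(AD, BE) ≤ α max(|AD|, |BE|)`. -/
def HasBadLambda (α : ℝ) (n : ℕ) (C : PrefixCode σ β) : Prop :=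
  ∃ A B D E : List σ, A <+: B ∧
    (∃ (x y : σ) (d e : List σ), x ≠ y ∧ D = B ++ x :: d ∧ E = B ++ y :: e) ∧
    D.length ≤ n ∧ E.length ≤ n ∧
    (editDist (C.labels A D) (C.labels B E) : ℝ) ≤
      α * (max (D.length - A.length) (E.length - B.length) : ℕ)

/-- `C` is an `α`-edit-distance tree code of depth `n`. -/
def IsEditTreeCode (α : ℝ) (n : ℕ) (C : PrefixCode σ β) : Prop := ¬ C.HasBadLambda α n

/-- `dec` is a minimum suffix-distance decoder for messages of length at most `n`; ties are broken
in any way. -/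
def IsDecoder (n : ℕ) (C : PrefixCode σ β) (dec : List β → List σ) : Prop :=
  ∀ r, (dec r).length ≤ n ∧
    ∀ m : List σ, m.length ≤ n → suffixDist (C.encode (dec r)) r ≤ suffixDist (C.encode m) r

end PrefixCode

/-! ### Interactive protocols and edit corruptions -/

inductive Party where
  | alice
  | bob
  deriving DecidableEq

/-- The other party. -/
def Party.other : Party → Party
  | .alice => .bob
  | .bob => .alice

/-- A noiseless binary protocol, in which `length` bits are communicated: the transcript so far
determines who speaks, and the speaker's bit depends on the speaker's input and the transcript. -/
structure BinaryProtocol (I : Party → Type u) where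
  length : ℕ
  speaker : List Bool → Party
  bit : (p : Party) → I p → List Bool → Bool

namespace BinaryProtocol

variable {I : Party → Type u}

/-- The first `k` bits of the transcript. -/
def run (P : BinaryProtocol I) (inp : (p : Party) → I p) : ℕ → List Bool
  | 0 => []
  | k + 1 =>
    let t := P.run inp k
    t ++ [P.bit (P.speaker t) (inp (P.speaker t)) t]

/-- The transcript. -/
def transcript (P : BinaryProtocol I) (inp : (p : Party) → I p) : List Bool :=
  P.run inp P.length

end BinaryProtocol

/-- The party that owns the edges leaving a vertex of depth `k`: Alice if `k` is even, Bob if `k`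
is odd. -/
def ownerAt (k : ℕ) : Party := if k % 2 = 0 then .alice else .bob

/-- An input of the pointer jumping problem.  A vertex of the binary tree is the list of left/right
turns that leads to it, and the input selects one edge leaving every vertex.  Only the selections
at the vertices of the party's own parity are used, so that it amounts to a consistent set of
edges leaving these vertices. -/
abbrev PJPInput : Party → Type := fun _ => List Bool → Bool

/-- The pointer jumping problem of depth `T`, as the noiseless alternating protocol that walks down
the tree; its transcript is the leaf (that is, the root-to-leaf path) defined by the inputs. -/
def pjp (T : ℕ) : BinaryProtocol PJPInput where
  length := T
  speaker v := ownerAt v.length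
  bit _ x v := x v

/-- A (noise-resilient) message-driven protocol over the channel alphabet `β` with outputs in `O`:
the next symbol to send and the output, given the input and the symbols received so far. -/
structure Scheme (I : Party → Type u) (β : Type v) (O : Type w) where
  send : (p : Party) → I p → List β → β
  out : (p : Party) → I p → List β → O

/-- The symbols available to a party in its round `i`, out of the list `r` of all the symbols it
receives.  Alice opens the protocol: in her first round she has received nothing. -/
def heard {β : Type v} : Party → List β → ℕ → List β
  | .alice, r, i => r.take (i - 1)
  | .bob, r, i => r.take i

/-- A state of the channel: the symbols received by each party, the party whose last symbol is in
transit, and the number of edit corruptions so far. -/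
structure Config (β : Type v) where
  recv : Party → List β
  sender : Party
  corruptions : ℕ

namespace Config

variable {β : Type v}

/-- The number of rounds that a party has performed (in its own count). -/
def rounds (c : Config β) : Party → ℕ
  | .alice => (c.recv .alice).length + 1
  | .bob => (c.recv .bob).length

/-- The party `p` receives `a`, performs its next round, and its new symbol is in transit;
`k` more corruptions are counted. -/
def receive (c : Config β) (p : Party) (a : β) (k : ℕ) : Config β where
  recv := Function.update c.recv p (c.recv p ++ [a])
  sender := p
  corruptions := c.corruptions + k

/-- The protocol is over: the symbol in transit is addressed to a party that has performed all its
`N` rounds. -/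
def Complete (N : ℕ) (c : Config β) : Prop := N ≤ c.rounds c.sender.other

end Config

namespace Scheme

variable {I : Party → Type u} {β : Type v} {O : Type w}

/-- The states that can be reached when every party performs at most `N` rounds.  An edit
corruption deletes the symbol in transit and inserts an arbitrary symbol, in the same direction
(a substitution) or in the opposite direction (a spoofed reply to the sender). -/
inductive Reachable (S : Scheme I β O) (N : ℕ) (inp : (p : Party) → I p) : Config β → Prop
  | start : Reachable S N inp ⟨fun _ => [], .alice, 0⟩
  | deliver (c : Config β) : Reachable S N inp c → c.rounds c.sender.other < N →
      Reachable S N inp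
        (c.receive c.sender.other (S.send c.sender (inp c.sender) (c.recv c.sender)) 0)
  | substitute (c : Config β) (a : β) : Reachable S N inp c → c.rounds c.sender.other < N →
      Reachable S N inp (c.receive c.sender.other a 1)
  | spoof (c : Config β) (a : β) : Reachable S N inp c → c.rounds c.sender < N →
      Reachable S N inp (c.receive c.sender a 1)

/-- The `N`-round scheme computes `f` in the presence of a `ρ`-fraction of edit corruptions (at
most `2ρN` of them): in every complete run both parties reach round `⌊(1 - 2ρ)N⌋`, and their
outputs in that round are correct. -/
def Resilient (S : Scheme I β O) (N : ℕ) (ρ : ℝ) (f : ((p : Party) → I p) → O) : Prop :=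
  ∀ (inp : (p : Party) → I p) (c : Config β), S.Reachable N inp c → c.Complete N →
    (c.corruptions : ℝ) ≤ 2 * ρ * N → ∀ p : Party,
      ⌊(1 - 2 * ρ) * N⌋₊ ≤ c.rounds p ∧
      S.out p (inp p) (heard p (c.recv p) ⌊(1 - 2 * ρ) * N⌋₊) = f inp

end Scheme

/-! ### The constant-alphabet protocol for pointer jumping

An edge of the tree is represented by the vertex it enters, a nonempty list of turns. -/

namespace PiPrime

/-- What is sent about one edge of the table in one cycle: the next bit of its description, and
whether its live points are 0, its description is now sent completely, and it is new in the
table. -/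
structure Slot where
  bit : Bool
  dead : Bool
  done : Bool
  new : Bool
  deriving DecidableEq, Fintype

/-- The tree code's input alphabet: a page says whether it is the last page of its cycle and holds
the slots of up to `K` edges. -/
structure Page (K : ℕ) where
  last : Bool
  slots : Fin K → Option Slot
  deriving DecidableEq, Fintype

/-- The page that holds a list of at most `K` slots. -/
def Page.ofList (K : ℕ) (last : Bool) (l : List Slot) : Page K := ⟨last, fun j => l[j.val]?⟩

/-- The slots of a page, in order. -/
def Page.toList {K : ℕ} (g : Page K) : List Slot := (List.ofFn g.slots).reduceOption

/-- The number with the given binary digits, least significant digit first. -/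
def ofBits (l : List Bool) : ℕ := l.foldr (fun b n => Nat.bit b n) 0

/-- The index in `{1,2,3,4}` of an edge among the grandchildren of its grandparent (for an edge
leaving the root, its index in `{1,2}` among the two such edges). -/
def childIndex (e : List Bool) : ℕ :=
  1 + 2 * (e.dropLast.getLastD false).toNat + (e.getLastD false).toNat

/-- The binary description of a pair `(m, s)` with `m ≥ 1` and `s < 8`: three digits for `s`, then
the binary digits of `m`, hence `⌊log₂ m⌋ + 4` bits. -/
def description (m s : ℕ) : List Bool :=
  [s.testBit 0, s.testBit 1, s.testBit 2] ++ Nat.bits m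

/-- The edge with binary description `bits` that `q` began to send in round `i`.  If the description
is `(m, s)`, then the edge is the `s`-th grandchild of the edge that `q` began to send in round
`n = i - m` and has fully sent (`log` lists these rounds and edges); `n = 0` stands for no
grandparent.  The result is `none` if there is no such edge. -/
def decodeEdge (q : Party) (T : ℕ) (log : List (ℕ × List Bool)) (i : ℕ) (bits : List Bool) :
    Option (List Bool) :=
  let s := ofBits (bits.take 3)
  let m := ofBits (bits.drop 3)
  let b₁ : Bool := decide (3 ≤ s)
  let b₂ : Bool := decide (s % 2 = 0)
  let e : Option (List Bool) :=
    if s < 1 ∨ 4 < s ∨ m < 1 ∨ i < m then none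
    else if m = i then
      match q with
      | .alice => if b₁ then none else some [b₂]
      | .bob => some [b₁, b₂]
    else (log.find? (fun a => a.1 == i - m)).map (fun a => a.2 ++ [b₁, b₂])
  e.filter (fun v => decide (v.length ≤ T))

/-- An edge in transmission, as the receiver knows it. -/
structure Incoming where
  start : ℕ
  bits : List Bool

/-- The receiver's reconstruction of the sender's table: the round of the next page, the round in
which the current cycle began, the edges that are still to be treated in this cycle, those already
treated that stay in the table, and the list of the edges that were fully sent, with the rounds in
which their transmission began. -/
structure RecvState where
  round : ℕ
  cycle : ℕ
  todo : List Incoming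
  kept : List Incoming
  log : List (ℕ × List Bool)

/-- Read one slot of a page sent by `q`; `none` if it is invalid. -/
def readSlot (q : Party) (T : ℕ) (st : RecvState) (s : Slot) : Option RecvState := do
  let (a, rest) ← match s.new, st.todo with
    | true, [] => some (Incoming.mk st.cycle [], [])
    | false, a :: rest => some (a, rest)
    | _, _ => none
  let bits := a.bits ++ [s.bit]
  if s.done then
    let e ← decodeEdge q T st.log a.start bits
    return { st with todo := rest, log := st.log ++ [(a.start, e)] }
  else if s.dead then
    return { st with todo := rest }
  else
    return { st with todo := rest, kept := st.kept ++ [⟨a.start, bits⟩] }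

/-- Read one page sent by `q`; `none` if it is invalid. -/
def readPage {K : ℕ} (q : Party) (T : ℕ) (st : RecvState) (g : Page K) : Option RecvState := do
  let st ← g.toList.foldlM (readSlot q T) st
  if g.last then
    if st.todo.isEmpty then
      return { st with round := st.round + 1, cycle := st.round + 1, todo := st.kept, kept := [] }
    else none
  else
    return { st with round := st.round + 1 }

/-- The edges that are fully communicated by the string `d` of pages sent by `q`; no edges if `d`
is invalid. -/
def edgesOf {K : ℕ} (q : Party) (T : ℕ) (d : List (Page K)) : List (List Bool) :=
  match d.foldlM (readPage q T) ⟨1, 1, [], [], []⟩ with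
  | some st => st.log.map Prod.snd
  | none => []

/-- `e` is one of the edges in the input `x` of party `p`. -/
def isOwn (p : Party) (T : ℕ) (x : List Bool → Bool) (e : List Bool) : Bool :=
  decide (e ≠ [] ∧ e.length ≤ T ∧ ownerAt (e.length - 1) = p ∧ e = e.dropLast ++ [x e.dropLast])

/-- Follow the edges of `S` downwards from the vertex `v`, for at most `k` steps, to the end of the
path; `none` if the path is not unique. -/
def walk (S : List Bool → Bool) : ℕ → List Bool → Option (List Bool)
  | 0, v => some v
  | k + 1, v =>
    match S (v ++ [false]), S (v ++ [true]) with
    | true, true => none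
    | true, false => walk S k (v ++ [false])
    | false, true => walk S k (v ++ [true])
    | false, false => some v

/-- The end of the unique path from the root in the union of the edges of `p`'s input `x` and the
edges that are communicated by the string `d` of pages of the other party. -/
def endpoint {K : ℕ} (p : Party) (T : ℕ) (x : List Bool → Bool) (d : List (Page K)) :
    Option (List Bool) :=
  let E := edgesOf p.other T d
  walk (fun e => E.contains e || isOwn p T x e) T []

/-- An edge of the EdgeTable: the edge, the round in which it was inserted (when the transmission
begins), its binary description, its current sent length and its live points. -/
structure Entry where
  edge : List Bool
  start : ℕ
  desc : List Bool
  sent : ℕ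
  live : ℕ

/-- The slot of an entry; the bit being sent is already counted in `sent`. -/
def Entry.slot (a : Entry) : Slot :=
  ⟨a.desc.getD (a.sent - 1) false, a.live == 0, a.sent == a.desc.length, a.sent == 1⟩

/-- The pages of a cycle: `⌈E / K⌉` pages for a table with `E ≥ 1` edges, and one blank page for an
empty table. -/
def pages (K : ℕ) (t : List Entry) : List (Page K) :=
  let n := max 1 ((t.length + K - 1) / K)
  (List.range n).map fun j =>
    Page.ofList K (j + 1 == n) (((t.drop (j * K)).take K).map Entry.slot)

/-- A party's state: the EdgeTable of the current cycle, the pages of this cycle that are still to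
be sent, the edges fully sent in the earlier cycles (with the rounds in which their transmission
began), and all the pages sent so far. -/
structure State (K : ℕ) where
  table : List Entry
  queue : List (Page K)
  log : List (ℕ × List Bool)
  sent : List (Page K)

/-- The edge to be added to the table: the deepest edge of the path to `v` that is in `p`'s input
and is in the first two levels of the tree or has a grandparent that `p` has fully sent. -/
def nextEdge (p : Party) (T : ℕ) (x : List Bool → Bool) (log : List (ℕ × List Bool))
    (v : List Bool) : Option (List Bool) :=
  (v.inits.filter fun e =>
    isOwn p T x e &&
      (decide (e.length ≤ 2) || log.any fun a => a.2 == e.dropLast.dropLast)).getLast?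

/-- The entry for an edge `e` that is inserted in round `i`, with `L` live points.  It is linked to
the first full transmission of its grandparent. -/
def newEntry (L i : ℕ) (log : List (ℕ × List Bool)) (e : List Bool) : Entry :=
  let n := if e.length ≤ 2 then 0
    else ((log.find? (fun a => a.2 == e.dropLast.dropLast)).map Prod.fst).getD 0
  ⟨e, i, description (i - n) (childIndex e), 0, L⟩

/-- UpdateTable in round `i`, when a cycle is completed: the edges that are fully sent or whose live
points are 0 leave the table, the edge to be added is inserted or gets `L` more live points, and the
new cycle begins, in which every edge loses a live point and sends a bit. -/
def update {K : ℕ} (p : Party) (L T i : ℕ) (x : List Bool → Bool) (d : List (Page K))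
    (st : State K) : State K :=
  let log := st.log ++
    (st.table.filter fun a => a.sent == a.desc.length).map fun a => (a.start, a.edge)
  let t := st.table.filter fun a => a.sent != a.desc.length && a.live != 0
  let t := match (endpoint p T x d).bind (nextEdge p T x log) with
    | none => t
    | some e =>
      if t.any (fun a => a.edge == e) then
        t.map fun (a : Entry) => if a.edge = e then { a with live := a.live + L } else a
      else t ++ [newEntry L i log e]
  let t := t.map fun (a : Entry) => { a with live := a.live - 1, sent := a.sent + 1 }
  { table := t, queue := pages K t, log := log, sent := st.sent }

/-- Send the next page of the cycle. -/
def sendPage {K : ℕ} (st : State K) : State K :=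
  match st.queue with
  | [] => st
  | g :: rest => { st with queue := rest, sent := st.sent ++ [g] }

variable {K : ℕ} {β : Type v}

/-- The state of party `p` with input `x` after its round `i`, if it receives the symbols `r`. -/
def stateAfter (p : Party) (L T : ℕ) (dec : List β → List (Page K)) (x : List Bool → Bool)
    (r : List β) : ℕ → State K
  | 0 => ⟨[], [], [], []⟩
  | i + 1 =>
    let st := stateAfter p L T dec x r i
    let st := if st.queue.isEmpty then update p L T (i + 1) x (dec (heard p r (i + 1))) st else st
    sendPage st

/-- The number of rounds performed by a party that has received `k` symbols. -/
def roundsOf : Party → ℕ → ℕ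
  | .alice, k => k + 1
  | .bob, k => k

/-- The number of votes for the leaf `v` of a party that has received the symbols `r`: the number of
its rounds in which the unique path ends in `v`. -/
def votes (p : Party) (T : ℕ) (dec : List β → List (Page K)) (x : List Bool → Bool)
    (r : List β) (v : List Bool) : ℕ :=
  ((List.range (roundsOf p r.length)).filter fun i =>
    decide (v.length = T) && endpoint p T x (dec (heard p r (i + 1))) == some v).length

end PiPrime

open PiPrime in
/-- The constant-alphabet protocol for the pointer jumping problem of depth `T`, with page size `K`,
`L` live points per request, the prefix code `C` and the decoders `dec` of the two parties.  In each
round a party sends the code symbol of the pages it has sent so far, including the one of this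
round; its output is a leaf with the largest number of votes. -/
noncomputable def piPrime {β : Type v} (K L T : ℕ) (C : PrefixCode (Page K) β)
    (dec : Party → List β → List (Page K)) : Scheme PJPInput β (List Bool) where
  send p x r := C (stateAfter p L T (dec p) x r (roundsOf p r.length)).sent
  out p x r := Classical.epsilon fun v : List Bool =>
    v.length = T ∧ ∀ u : List Bool, u.length = T → votes p T (dec p) x r u ≤ votes p T (dec p) x r v

/-! Resilience is a count of the rounds in which a party does not vote for the correct leaf `z`.

Decoding. Two different messages cannot both have suffix distance below `1/2 - ε` from one received
string: cut their matchings where the messages part, compose them, and a bad lambda appears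
(`IsEditTreeCode.eq_of_suffixDist_lt`). So a round decodes correctly whenever some matching of the
true message has at most `x₀` stars per symbol in each suffix, for a fixed `x₀` slightly below `1/2
- ε`. The largest excess of a suffix serves as a potential. A corruption creates two stars, and
every symbol received while the potential is positive pays off `x₀`. Hence `x₀` times the number of
bad rounds of both parties is at most twice the number of corruptions (`exists_channelInv`): about
four bad rounds per corruption.

Progress. Suppose a party decodes correctly, begins a cycle, and owns the first edge of the path to
`z` that is not yet sent. Then it grants live points to this edge; such a round is active. Rounds
that begin no cycle are few, because every page of a cycle beyond the first is paid for by `K` live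
points and a cycle hands out only `L` (`nonstarts_le`). Active rounds are few (`actives_le`): an
edge that dies unsent has used up `L` cycles per grant, and an edge that gets through has had at
most one grant per bit of its description. The description is logarithmic in the distance back to
the round of the grandparent, hence at most `1/(2ε)` plus `ε` times this distance, and the distances
telescope along the path. Both counts are `O(εN)`; these rounds are called excused.

Charging (`Charged.receive`). A round that is neither bad nor excused is a vote for `z`, unless the
first unsent edge belongs to the other party. In that case the round of the other party just before
was itself bad, excused or the opening round, and pays for both. So the rounds of a party are at
most one, plus its votes for `z`, plus the bad and excused rounds of both parties. With `2ρN`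
corruptions there are about `8ρN` bad rounds, which is less than half of `(1 - 2ρ)N` exactly when `ρ
< 1/18`; the slack `ε` absorbs the excused rounds, and `z` wins the majority (`resilient_piPrime`).

Codes of constant alphabet come from a counting form of the local lemma (`exists_avoiding`): a bad
lambda of size `l` forces at least `εl/2` coincidences of labels, while only exponentially many
lambdas of size `l` pass near a node. An arbitrary binary protocol reduces to pointer jumping of
twice its length, in which the turns of the party that is not speaking are ignored. -/

namespace StringMatching

/-! ### String matchings: composition, suffix bounds and the potential -/

variable {β : Type v}

@[simp] theorem stars_nil : stars ([] : StringMatching β) = 0 := rfl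

@[simp] theorem symbols_nil : symbols ([] : StringMatching β) = 0 := rfl

theorem stars_cons (c : Option β × Option β) (τ : StringMatching β) :
    stars (c :: τ) =
      (if c.1.isNone then 1 else 0) + (if c.2.isNone then 1 else 0) + stars τ := by
  unfold stars
  rw [List.countP_cons, List.countP_cons]
  omega

theorem symbols_cons (c : Option β × Option β) (τ : StringMatching β) :
    symbols (c :: τ) = (if c.1.isSome then 1 else 0) + symbols τ := by
  unfold symbols
  rw [List.countP_cons]
  omega

theorem stars_append (τ σ : StringMatching β) : stars (τ ++ σ) = stars τ + stars σ := by
  unfold stars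
  rw [List.countP_append, List.countP_append]
  omega

theorem symbols_append (τ σ : StringMatching β) : symbols (τ ++ σ) = symbols τ + symbols σ := by
  unfold symbols
  rw [List.countP_append]

theorem Matches.append {τ σ : StringMatching β} {s r s' r' : List β} (h : τ.Matches s r)
    (h' : σ.Matches s' r') : Matches (τ ++ σ) (s ++ s') (r ++ r') := by
  obtain ⟨h1, h2, h3⟩ := h
  obtain ⟨h1', h2', h3'⟩ := h'
  refine ⟨by rw [List.filterMap_append, h1, h1'], by rw [List.filterMap_append, h2, h2'], ?_⟩
  intro c hc
  rcases List.mem_append.1 hc with hc | hc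
  · exact h3 c hc
  · exact h3' c hc

theorem matches_nil : Matches ([] : StringMatching β) [] [] :=
  ⟨rfl, rfl, by simp⟩

theorem matches_pair (a : β) : Matches [(some a, some a)] [a] [a] :=
  ⟨rfl, rfl, by simp⟩

theorem matches_delete (a : β) : Matches [(some a, none)] [a] [] :=
  ⟨rfl, rfl, by simp⟩

theorem matches_insert (a : β) : Matches [(none, some a)] [] [a] :=
  ⟨rfl, rfl, by simp⟩

theorem Matches.symbols_eq {τ : StringMatching β} {s r : List β} (h : τ.Matches s r) :
    τ.symbols = s.length := by
  rw [← h.1, symbols]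
  clear h
  induction τ with
  | nil => rfl
  | cons c τ ih =>
    obtain ⟨a, b⟩ := c
    cases a <;> simp [ih]

theorem Matches.of_append {τ σ : StringMatching β} {s r : List β} (h : Matches (τ ++ σ) s r) :
    τ.Matches (τ.filterMap Prod.fst) (τ.filterMap Prod.snd) ∧
      σ.Matches (σ.filterMap Prod.fst) (σ.filterMap Prod.snd) :=
  ⟨⟨rfl, rfl, fun c hc => h.2.2 c (List.mem_append_left _ hc)⟩,
    ⟨rfl, rfl, fun c hc => h.2.2 c (List.mem_append_right _ hc)⟩⟩

/-- Every pair of strings has a matching. -/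
theorem exists_matches (s r : List β) : ∃ τ : StringMatching β, τ.Matches s r := by
  induction s with
  | nil =>
    induction r with
    | nil => exact ⟨[], matches_nil⟩
    | cons b r ih =>
      obtain ⟨τ, h⟩ := ih
      exact ⟨_, (matches_insert b).append h⟩
  | cons a s ih =>
    obtain ⟨τ, h⟩ := ih
    exact ⟨_, (matches_delete a).append h⟩

theorem Matches.length_le {τ : StringMatching β} {s r : List β} (h : τ.Matches s r) :
    s.length ≤ r.length + τ.stars ∧ r.length ≤ s.length + τ.stars := by
  rw [← h.1, ← h.2.1]
  clear h
  induction τ with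
  | nil => simp
  | cons c τ ih =>
    obtain ⟨a, b⟩ := c
    rw [stars_cons]
    cases a <;> cases b <;> simp <;> omega

/-- The two matchings are merged along their common second row. A column with a star there is copied
as an insertion or deletion; two columns with the same common symbol fuse into one, and a star in
either of them survives at most once. Stars on both sides may interleave in several ways, so the
induction runs over the total number of columns. -/
theorem triangle_of_length_le (n : ℕ) : ∀ (τ σ : StringMatching β),
    τ.length + σ.length ≤ n → (∀ c ∈ τ, c.1 = none ∨ c.2 = none ∨ c.1 = c.2) →
    (∀ c ∈ σ, c.1 = none ∨ c.2 = none ∨ c.1 = c.2) →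
    τ.filterMap Prod.snd = σ.filterMap Prod.snd →
    ∃ υ : StringMatching β, υ.Matches (τ.filterMap Prod.fst) (σ.filterMap Prod.fst) ∧
      υ.stars ≤ τ.stars + σ.stars := by
  induction n with
  | zero =>
    intro τ σ hl _ _ _
    have h1 : τ = [] := List.length_eq_zero_iff.1 (by omega)
    have h2 : σ = [] := List.length_eq_zero_iff.1 (by omega)
    subst h1 h2
    exact ⟨[], matches_nil, by simp⟩
  | succ n ih =>
    intro τ σ hl h1 h2 h
    rcases τ with _ | ⟨⟨a, b⟩, τ⟩
    · rcases σ with _ | ⟨⟨a', b'⟩, σ⟩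
      · exact ⟨[], matches_nil, by simp⟩
      · cases b' with
        | some b' => simp at h
        | none =>
          obtain ⟨υ, hυ, hs⟩ := ih [] σ (by simp at hl ⊢; omega) (by simp)
            (fun c hc => h2 c (List.mem_cons_of_mem _ hc)) (by simpa using h)
          cases a' with
          | none => exact ⟨υ, by simpa using hυ, by rw [stars_cons]; omega⟩
          | some a' =>
            refine ⟨_, by simpa using (matches_insert a').append hυ, ?_⟩
            simp only [stars_cons, stars_nil] at hs ⊢; simp; omega
    · cases b with
      | none =>
        obtain ⟨υ, hυ, hs⟩ := ih τ σ (by simp at hl ⊢; omega)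
          (fun c hc => h1 c (List.mem_cons_of_mem _ hc)) h2 (by simpa using h)
        cases a with
        | none => exact ⟨υ, by simpa using hυ, by rw [stars_cons]; omega⟩
        | some a =>
          refine ⟨_, by simpa using (matches_delete a).append hυ, ?_⟩
          simp only [stars_cons] at hs ⊢; simp at hs ⊢; omega
      | some b =>
        rcases σ with _ | ⟨⟨a', b'⟩, σ⟩
        · simp at h
        · cases b' with
          | none =>
            obtain ⟨υ, hυ, hs⟩ := ih ((a, some b) :: τ) σ (by simp at hl ⊢; omega) h1
              (fun c hc => h2 c (List.mem_cons_of_mem _ hc)) (by simpa using h)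
            cases a' with
            | none => exact ⟨υ, by simpa using hυ, by rw [stars_cons (_, none)]; omega⟩
            | some a' =>
              refine ⟨_, by simpa using (matches_insert a').append hυ, ?_⟩
              simp only [stars_cons] at hs ⊢; simp at hs ⊢; omega
          | some b' =>
            have hb : b = b' := by simp at h; exact h.1
            subst hb
            obtain ⟨υ, hυ, hs⟩ := ih τ σ (by simp at hl ⊢; omega)
              (fun c hc => h1 c (List.mem_cons_of_mem _ hc))
              (fun c hc => h2 c (List.mem_cons_of_mem _ hc)) (by simpa using h)
            have c1 := h1 (a, some b) (by simp)
            have c2 := h2 (a', some b) (by simp)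
            simp at c1 c2
            rcases c1 with rfl | rfl <;> rcases c2 with rfl | rfl
            · exact ⟨υ, by simpa using hυ, by rw [stars_cons, stars_cons]; omega⟩
            · refine ⟨_, by simpa using (matches_insert b).append hυ, ?_⟩
              simp only [stars_cons] at hs ⊢; simp at hs ⊢; omega
            · refine ⟨_, by simpa using (matches_delete b).append hυ, ?_⟩
              simp only [stars_cons] at hs ⊢; simp at hs ⊢; omega
            · refine ⟨_, by simpa using (matches_pair b).append hυ, ?_⟩
              simp only [stars_cons] at hs ⊢; simp at hs ⊢; omega

/-- The triangle inequality for matchings to a common string. -/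
theorem Matches.triangle {τ σ : StringMatching β} {s t r : List β} (h : τ.Matches s r)
    (h' : σ.Matches t r) : ∃ υ : StringMatching β, υ.Matches s t ∧
      υ.stars ≤ τ.stars + σ.stars := by
  rw [← h.1, ← h'.1]
  exact triangle_of_length_le _ τ σ le_rfl h.2.2 h'.2.2 (h.2.1.trans h'.2.1.symm)

theorem Matches.editDist_le {τ : StringMatching β} {s r : List β} (h : τ.Matches s r) :
    editDist s r ≤ τ.stars :=
  Nat.sInf_le ⟨τ, h, rfl⟩

theorem _root_.exists_matches_editDist (s r : List β) :
    ∃ τ : StringMatching β, τ.Matches s r ∧ τ.stars = editDist s r := by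
  obtain ⟨τ, h⟩ := exists_matches s r
  exact Nat.sInf_mem (s := {k | ∃ τ : StringMatching β, τ.Matches s r ∧ τ.stars = k})
    ⟨_, τ, h, rfl⟩

/-- A split of the first string lifts to the matching. -/
theorem exists_split_fst (τ : StringMatching β) {s₁ s₂ : List β}
    (h : τ.filterMap Prod.fst = s₁ ++ s₂) : ∃ τ₁ τ₂ : StringMatching β, τ = τ₁ ++ τ₂ ∧
      τ₁.filterMap Prod.fst = s₁ ∧ τ₂.filterMap Prod.fst = s₂ := by
  obtain ⟨a, b, h1, h2, h3⟩ := List.filterMap_eq_append_iff.1 h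
  exact ⟨a, b, h1, h2, h3⟩

theorem exists_split_snd (τ : StringMatching β) {s₁ s₂ : List β}
    (h : τ.filterMap Prod.snd = s₁ ++ s₂) : ∃ τ₁ τ₂ : StringMatching β, τ = τ₁ ++ τ₂ ∧
      τ₁.filterMap Prod.snd = s₁ ∧ τ₂.filterMap Prod.snd = s₂ := by
  obtain ⟨a, b, h1, h2, h3⟩ := List.filterMap_eq_append_iff.1 h
  exact ⟨a, b, h1, h2, h3⟩

/-- Every suffix has at most `x` stars per symbol. -/
def SuffixBound (x : ℝ) (τ : StringMatching β) : Prop :=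
  ∀ τ₁ τ₂ : StringMatching β, τ = τ₁ ++ τ₂ → (τ₂.stars : ℝ) ≤ x * τ₂.symbols

theorem SuffixBound.suffixDist_le {x : ℝ} {τ : StringMatching β} {s r : List β}
    (h : τ.SuffixBound x) (hx : 0 ≤ x) (hm : τ.Matches s r) :
    suffixDist s r ≤ ENNReal.ofReal x := by
  refine iInf₂_le_of_le τ hm (iSup₂_le fun i _ => ?_)
  have := h _ _ (List.take_append_drop i τ).symm
  apply ENNReal.div_le_of_le_mul
  rw [← ENNReal.ofReal_natCast, ← ENNReal.ofReal_natCast, ← ENNReal.ofReal_mul hx]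
  exact ENNReal.ofReal_le_ofReal this

/-- The inequality is strict so that one matching lies below the bound; attainment of the infimum is
not needed. -/
theorem exists_suffixBound {x : ℝ} {s r : List β} (hx : 0 ≤ x)
    (h : suffixDist s r < ENNReal.ofReal x) :
    ∃ τ : StringMatching β, τ.Matches s r ∧ τ.SuffixBound x := by
  rw [suffixDist, iInf_lt_iff] at h
  obtain ⟨τ, h⟩ := h
  rw [iInf_lt_iff] at h
  obtain ⟨hm, h⟩ := h
  refine ⟨τ, hm, ?_⟩
  rintro τ₁ τ₂ rfl
  by_cases h0 : τ₂ = []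
  · subst h0; simp
  have hi : τ₁.length < (τ₁ ++ τ₂).length := by
    have := List.length_pos_iff.2 h0
    rw [List.length_append]; omega
  have h' := lt_of_le_of_lt (le_iSup₂ (f := fun (i : ℕ) (_ : i < (τ₁ ++ τ₂).length) =>
    (StringMatching.stars ((τ₁ ++ τ₂).drop i) : ℝ≥0∞) /
      (StringMatching.symbols ((τ₁ ++ τ₂).drop i) : ℝ≥0∞)) τ₁.length hi) h
  simp only [List.drop_left] at h'
  -- A suffix without symbols has quotient `∞` if it contains a star, which the bound forbids.
  by_cases hs : symbols τ₂ = 0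
  · by_cases ht : stars τ₂ = 0
    · simp [hs, ht]
    · rw [hs, Nat.cast_zero, ENNReal.div_zero (by exact_mod_cast ht)] at h'
      exact absurd h' (by simp)
  · have h2 := (ENNReal.div_le_iff (by exact_mod_cast hs) (by simp)).1 h'.le
    rw [← ENNReal.ofReal_natCast, ← ENNReal.ofReal_natCast, ← ENNReal.ofReal_mul hx] at h2
    exact (ENNReal.ofReal_le_ofReal_iff (by positivity)).1 h2

/-- The largest excess of a suffix, in which a star counts `1` and a symbol counts `-x`. -/
noncomputable def potential (x : ℝ) (τ : StringMatching β) : ℝ :=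
  τ.foldl (fun t c => max 0
    (t + ((if c.1.isNone then 1 else 0) + (if c.2.isNone then 1 else 0))
      - x * (if c.1.isSome then 1 else 0))) 0

theorem potential_append (x : ℝ) (τ : StringMatching β) (c : Option β × Option β) :
    potential x (τ ++ [c]) = max 0
    (potential x τ + ((if c.1.isNone then 1 else 0) + (if c.2.isNone then 1 else 0))
      - x * (if c.1.isSome then 1 else 0)) := by
  rw [potential, List.foldl_append]
  rfl

theorem potential_nonneg (x : ℝ) (τ : StringMatching β) : 0 ≤ potential x τ := by
  induction τ using List.reverseRecOn with
  | nil => exact le_rfl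
  | append_singleton τ c _ => rw [potential_append]; exact le_max_left _ _

/-- The recursion `max 0 (t + gain)` is that of a maximal suffix sum: appending a column changes
every nonempty suffix by the same gain, and the `0` stands for the empty suffix. -/
theorem le_potential (x : ℝ) (τ : StringMatching β) : ∀ τ₁ τ₂ : StringMatching β,
    τ = τ₁ ++ τ₂ → (τ₂.stars : ℝ) - x * τ₂.symbols ≤ potential x τ := by
  induction τ using List.reverseRecOn with
  | nil =>
    intro τ₁ τ₂ h
    obtain ⟨-, rfl⟩ := List.append_eq_nil_iff.1 h.symm
    simp [potential]
  | append_singleton τ c ih =>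
    intro τ₁ τ₂ h
    rcases List.eq_nil_or_concat τ₂ with rfl | ⟨τ₃, d, rfl⟩
    · simpa using potential_nonneg x _
    · rw [List.concat_eq_append, ← List.append_assoc] at h
      obtain ⟨h1, h2⟩ := List.append_inj' h rfl
      obtain rfl : c = d := by simpa using h2
      have := ih _ _ h1
      rw [potential_append, List.concat_eq_append, stars_append, symbols_append, stars_cons,
        symbols_cons]
      refine le_trans ?_ (le_max_right _ _)
      push_cast
      simp only [stars_nil, symbols_nil, Nat.cast_zero, add_zero]
      linarith

theorem suffixBound_of_potential {x : ℝ} {τ : StringMatching β} (h : potential x τ ≤ 0) :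
    τ.SuffixBound x := fun τ₁ τ₂ ht => by
  have := le_potential x τ τ₁ τ₂ ht
  linarith

end StringMatching

/-! ### Unique decoding with edit-distance tree codes -/

namespace PrefixCode

variable {σ : Type u} {β : Type v}

@[simp] theorem length_encode (C : PrefixCode σ β) (m : List σ) :
    (C.encode m).length = m.length := by
  simp [encode]

@[simp] theorem encode_nil (C : PrefixCode σ β) : C.encode [] = [] := rfl

theorem encode_append_singleton (C : PrefixCode σ β) (m : List σ) (x : σ) :
    C.encode (m ++ [x]) = C.encode m ++ [C (m ++ [x])] := by
  unfold encode
  rw [List.length_append, List.length_singleton, List.range_succ, List.map_append]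
  congr 1
  · apply List.map_congr_left
    intro k hk
    rw [List.mem_range] at hk
    rw [List.take_append_of_le_length (by omega)]
  · rw [List.map_singleton, List.take_of_length_le (by simp)]

theorem encode_append (C : PrefixCode σ β) (a w : List σ) :
    C.encode (a ++ w) = C.encode a ++ C.labels a (a ++ w) := by
  have : C.encode a <+: C.encode (a ++ w) := by
    induction w using List.reverseRecOn with
    | nil => simp
    | append_singleton w x ih =>
      rw [← List.append_assoc, encode_append_singleton]
      exact ih.trans (List.prefix_append _ _)
  obtain ⟨t, ht⟩ := this
  rw [labels, ← ht, ← length_encode C a, List.drop_left]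

theorem encode_eq_append_labels (C : PrefixCode σ β) {a d : List σ} (h : a <+: d) :
    C.encode d = C.encode a ++ C.labels a d := by
  obtain ⟨w, rfl⟩ := h
  exact C.encode_append a w

theorem length_labels (C : PrefixCode σ β) (a d : List σ) :
    (C.labels a d).length = d.length - a.length := by
  simp [labels]

theorem labels_append_singleton (C : PrefixCode σ β) {a d : List σ} (h : a <+: d) (y : σ) :
    C.labels a (d ++ [y]) = C.labels a d ++ [C (d ++ [y])] := by
  rw [labels, encode_append_singleton, List.drop_append_of_le_length, labels]
  simpa using h.length_le

theorem labels_eq_of_suffix (C : PrefixCode σ β) {d : List σ} {s t : List β}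
    (h : C.encode d = s ++ t) : C.labels (d.take s.length) d = t := by
  have hl : s.length ≤ d.length := by
    have := congrArg List.length h
    simp at this; omega
  rw [labels, List.length_take, min_eq_left hl, h, List.drop_left]

open StringMatching

/-- A suffix of one matching and a longer one (on the receiving side) of another, seen as a matching
between sent strings. -/
theorem exists_ancestor_matching (C : PrefixCode σ β) {B D E : List σ} {r : List β} {x : ℝ}
    {τ τ' : StringMatching β} (hτ : τ.Matches (C.encode D) r) (hb : τ.SuffixBound x)
    (hτ' : τ'.Matches (C.encode E) r) (hb' : τ'.SuffixBound x) (hE : B <+: E)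
    {τ₁ τ₂ τ₁' τ₂' : StringMatching β} {m : ℕ}
    (h : τ = τ₁ ++ τ₂) (h1 : τ₁.filterMap Prod.fst = (C.encode D).take m)
    (h' : τ' = τ₁' ++ τ₂') (h1' : τ₁'.filterMap Prod.fst = C.encode B)
    (hle : (τ₂.filterMap Prod.snd).length ≤ (τ₂'.filterMap Prod.snd).length) (hm : m ≤ D.length) :
    ∃ j ≤ m, ∃ a b : ℕ, editDist (C.labels (D.take j) D) (C.labels B E) ≤ a + b ∧
      (a : ℝ) ≤ x * (D.length - j : ℕ) ∧ (b : ℝ) ≤ x * (E.length - B.length : ℕ) ∧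
      E.length - B.length ≤ (D.length - j) + a + b := by
  subst h h'
  have hr : τ₁.filterMap Prod.snd ++ τ₂.filterMap Prod.snd =
      τ₁'.filterMap Prod.snd ++ τ₂'.filterMap Prod.snd := by
    rw [← List.filterMap_append, ← List.filterMap_append, hτ.2.1, hτ'.2.1]
  -- Both matchings end in the same `r`, so the two received suffixes are comparable; `u` is what
  -- the shorter one lacks.
  obtain ⟨u, hu⟩ : ∃ u, τ₁.filterMap Prod.snd = τ₁'.filterMap Prod.snd ++ u := by
    have : (τ₁'.filterMap Prod.snd).length ≤ (τ₁.filterMap Prod.snd).length := by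
      have := congrArg List.length hr
      simp only [List.length_append] at this
      omega
    rcases List.append_eq_append_iff.1 hr with ⟨u, hu, -⟩ | ⟨u, hu, -⟩
    · rw [hu] at this ⊢
      rw [List.length_append] at this
      have : u = [] := List.length_eq_zero_iff.1 (by omega)
      exact ⟨[], by simp [this]⟩
    · exact ⟨u, hu⟩
  -- The suffix `τ₂` is lengthened by the columns `τ₄` that receive `u`. This pushes its sent part
  -- back from depth `m` to a depth `j ≤ m`, which is why a lambda allows the ancestor `A` above
  -- `B`.
  obtain ⟨τ₃, τ₄, rfl, h3, h4⟩ := exists_split_snd τ₁ hu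
  have hf : τ₃.filterMap Prod.fst ++ (τ₄ ++ τ₂).filterMap Prod.fst = C.encode D := by
    rw [← hτ.1, List.append_assoc τ₃, List.filterMap_append, List.filterMap_append,
      List.filterMap_append]
  have hs : (τ₄ ++ τ₂).filterMap Prod.snd = τ₂'.filterMap Prod.snd := by
    rw [List.filterMap_append, h4]
    rw [hu, List.append_assoc] at hr
    exact List.append_cancel_left hr
  have hj : (τ₃.filterMap Prod.fst).length ≤ m := by
    have := congrArg List.length h1
    rw [List.filterMap_append, List.length_append, List.length_take] at this
    omega
  have hfE : τ₂'.filterMap Prod.fst = C.labels B E := by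
    have := hτ'.1
    rw [List.filterMap_append, h1', C.encode_eq_append_labels hE] at this
    exact List.append_cancel_left this
  have hfD := C.labels_eq_of_suffix hf.symm
  have m1 := (Matches.of_append (τ := τ₃) (σ := τ₄ ++ τ₂) (by
    rw [← List.append_assoc]; exact hτ)).2
  have m2 := (Matches.of_append hτ').2
  rw [← hfD, hs] at m1
  rw [hfE] at m2
  obtain ⟨υ, hυ, hυs⟩ := m1.triangle m2
  have l1 : symbols (τ₄ ++ τ₂) = D.length - (τ₃.filterMap Prod.fst).length := by
    rw [m1.symbols_eq, length_labels, List.length_take,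
      min_eq_left (by omega)]
  have l2 : symbols τ₂' = E.length - B.length := by
    rw [m2.symbols_eq, length_labels]
  refine ⟨_, hj, stars (τ₄ ++ τ₂), stars τ₂', hυ.editDist_le.trans hυs, ?_, ?_, ?_⟩
  · rw [← l1]; exact hb _ _ (by rw [← List.append_assoc])
  · rw [← l2]; exact hb' _ _ rfl
  · have a1 := m1.length_le.2
    have a2 := m2.length_le.1
    rw [length_labels] at a1 a2
    rw [List.length_take, min_eq_left (by omega)] at a1
    omega

/-- Composing the two suffixes gives at most `(1/2 - ε)(|AD| + |BE|) ≤ (1 - ε) max(|AD|, |BE|)`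
stars, a bad lambda. The situation is symmetric, so the message whose suffix after `B` received less
may play the role of `D`. -/
theorem IsEditTreeCode.not_diverging {C : PrefixCode σ β} {ε : ℝ} {n : ℕ} (hε : 0 < ε)
    (hε' : ε < 1 / 2) (hC : C.IsEditTreeCode (1 - ε) n) {B d e : List σ} {x y : σ} {r : List β}
    {τ τ' : StringMatching β} (hxy : x ≠ y)
    (hτ : τ.Matches (C.encode (B ++ x :: d)) r) (hb : τ.SuffixBound (1 / 2 - ε))
    (hτ' : τ'.Matches (C.encode (B ++ y :: e)) r) (hb' : τ'.SuffixBound (1 / 2 - ε))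
    (hD : (B ++ x :: d).length ≤ n) (hE : (B ++ y :: e).length ≤ n) : False := by
  have key : ∀ (x y : σ) (d e : List σ) (τ τ' : StringMatching β), x ≠ y →
      τ.Matches (C.encode (B ++ x :: d)) r → τ.SuffixBound (1 / 2 - ε) →
      τ'.Matches (C.encode (B ++ y :: e)) r → τ'.SuffixBound (1 / 2 - ε) →
      (B ++ x :: d).length ≤ n → (B ++ y :: e).length ≤ n →
      ∀ τ₁ τ₂ τ₁' τ₂' : StringMatching β, τ = τ₁ ++ τ₂ → τ₁.filterMap Prod.fst = C.encode B →
      τ' = τ₁' ++ τ₂' → τ₁'.filterMap Prod.fst = C.encode B →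
      ¬ (τ₂.filterMap Prod.snd).length ≤ (τ₂'.filterMap Prod.snd).length := by
    intro x y d e τ τ' hxy hτ hb hτ' hb' hD hE τ₁ τ₂ τ₁' τ₂' h h1 h' h1' hle
    have hBD : (C.encode (B ++ x :: d)).take B.length = C.encode B := by
      rw [encode_append, ← length_encode C B, List.take_left]
    obtain ⟨j, hj, a, b, hab, ha, hb, -⟩ := exists_ancestor_matching C hτ hb hτ' hb'
      (List.prefix_append _ _) h (h1.trans hBD.symm) h' h1' hle (by simp)
    refine hC ⟨(B ++ x :: d).take j, B, _, _, ?_, ⟨x, y, d, e, hxy, rfl, rfl⟩, hD, hE, ?_⟩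
    · rw [List.take_append_of_le_length hj]; exact List.take_prefix _ _
    · have hjl : ((B ++ x :: d).take j).length = j := by
        rw [List.length_take]; simp at hj ⊢; omega
      rw [hjl]
      set J := (B ++ x :: d).length - j
      set K := (B ++ y :: e).length - B.length
      have h1 : ((editDist (C.labels ((B ++ x :: d).take j) (B ++ x :: d))
        (C.labels B (B ++ y :: e)) : ℕ) : ℝ) ≤ a + b := by exact_mod_cast hab
      have h2 : (J : ℝ) ≤ (max J K : ℕ) := by exact_mod_cast le_max_left J K
      have h3 : (K : ℝ) ≤ (max J K : ℕ) := by exact_mod_cast le_max_right J K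
      have h4 : (0 : ℝ) ≤ (max J K : ℕ) := Nat.cast_nonneg _
      nlinarith
  obtain ⟨τ₁, τ₂, h, h1, -⟩ := exists_split_fst τ (hτ.1.trans (C.encode_append B _))
  obtain ⟨τ₁', τ₂', h', h1', -⟩ := exists_split_fst τ' (hτ'.1.trans (C.encode_append B _))
  rcases le_total (τ₂.filterMap Prod.snd).length (τ₂'.filterMap Prod.snd).length with hle | hle
  · exact key x y d e τ τ' hxy hτ hb hτ' hb' hD hE _ _ _ _ h h1 h' h1' hle
  · exact key y x e d τ' τ hxy.symm hτ' hb' hτ hb hE hD _ _ _ _ h' h1' h h1 hle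

/-- The extra star of an artificial branch of length one has to be absorbed. Integrality helps: `a <
j/2` and `b < k/2` improve to `2a + 1 ≤ j` and `2b + 1 ≤ k`. For `k > j` this suffices when `εk ≤
1`; otherwise the real bounds leave room. The hypothesis `k ≤ j + a + b` excludes `j = 0`. -/
theorem degenerate_lambda_bound {ε : ℝ} (hε : 0 < ε) (hε' : ε < 1 / 2) {a b j k : ℕ} (hk : 1 ≤ k)
    (ha : (a : ℝ) ≤ (1 / 2 - ε) * j) (hb : (b : ℝ) ≤ (1 / 2 - ε) * k) (hkj : k ≤ j + a + b) :
    (a : ℝ) + b + 1 ≤ (1 - ε) * (max (j + 1) k : ℕ) := by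
  have hk' : (1 : ℝ) ≤ k := by exact_mod_cast hk
  have hb2 : 2 * b + 1 ≤ k := by
    have : (2 * b : ℝ) < k := by nlinarith
    have : 2 * b < k := by exact_mod_cast this
    omega
  rcases Nat.eq_zero_or_pos j with rfl | hj
  · have : (a : ℝ) ≤ 0 := by simpa using ha
    have : a = 0 := by exact_mod_cast le_antisymm this (Nat.cast_nonneg a)
    omega
  have hj' : (1 : ℝ) ≤ j := by exact_mod_cast hj
  have ha2 : 2 * a + 1 ≤ j := by
    have : (2 * a : ℝ) < j := by nlinarith
    have : 2 * a < j := by exact_mod_cast this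
    omega
  rcases le_or_gt k j with hjk | hjk
  · rw [max_eq_left (by omega)]
    have : (k : ℝ) ≤ j := by exact_mod_cast hjk
    push_cast
    nlinarith
  · rw [max_eq_right (by omega)]
    rcases le_or_gt (ε * k) 1 with h1 | h1
    · have : a + b + 1 + 1 ≤ k := by omega
      have : (a : ℝ) + b + 1 + 1 ≤ k := by exact_mod_cast this
      nlinarith
    · have : (j : ℝ) + 1 ≤ k := by exact_mod_cast hjk
      nlinarith

/-- If one message is a prefix of the other, no branching occurs at `B`. A symbol `y ≠ x` is
appended to `B` to create one, at the price of a single deletion. -/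
theorem IsEditTreeCode.not_extending {C : PrefixCode σ β} [Nontrivial σ] {ε : ℝ} {n : ℕ}
    (hε : 0 < ε) (hε' : ε < 1 / 2) (hC : C.IsEditTreeCode (1 - ε) n) {B e : List σ} {x : σ}
    {r : List β} {τ τ' : StringMatching β}
    (hτ : τ.Matches (C.encode B) r) (hb : τ.SuffixBound (1 / 2 - ε))
    (hτ' : τ'.Matches (C.encode (B ++ x :: e)) r) (hb' : τ'.SuffixBound (1 / 2 - ε))
    (hE : (B ++ x :: e).length ≤ n) : False := by
  obtain ⟨y, hy⟩ := exists_ne x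
  obtain ⟨τ₁', τ₂', h', h1', -⟩ := exists_split_fst τ' (hτ'.1.trans (C.encode_append B _))
  obtain ⟨j, hj, a, b, hab, ha, hb, hk⟩ := exists_ancestor_matching C hτ hb hτ' hb'
      (List.prefix_append _ _) (τ₁ := τ) (τ₂ := []) (m := B.length) (by simp)
      (by rw [hτ.1, List.take_of_length_le (by simp)]) h' h1' (by simp) le_rfl
  have hpre : B.take j <+: B := List.take_prefix _ _
  have hjl : (B.take j).length = j := by
    rw [List.length_take]; omega
  refine hC ⟨B.take j, B, B ++ [y], B ++ x :: e, hpre, ⟨y, x, [], e, hy, rfl, rfl⟩,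
    by simp at hE ⊢; omega, hE, ?_⟩
  rw [hjl]
  have hlen : (B ++ [y]).length - j = (B.length - j) + 1 := by simp; omega
  rw [hlen]
  have hmax := degenerate_lambda_bound hε hε' (by simp) ha hb hk
  refine le_trans ?_ hmax
  obtain ⟨υ, hυ, hυs⟩ := exists_matches_editDist (C.labels (B.take j) B)
    (C.labels B (B ++ x :: e))
  have := (hυ.append (matches_delete (C (B ++ [y])))).editDist_le
  rw [List.append_nil, ← labels_append_singleton C hpre, stars_append, hυs, stars_cons] at this
  simp at this
  have : editDist (C.labels (B.take j) (B ++ [y])) (C.labels B (B ++ x :: e)) ≤ a + b + 1 := by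
    omega
  exact_mod_cast this

/-- Two different messages cannot both be close to the received string. -/
theorem IsEditTreeCode.eq_of_suffixDist_lt {C : PrefixCode σ β} [Nontrivial σ] {ε : ℝ} {n : ℕ}
    (hε : 0 < ε) (hε' : ε < 1 / 2) (hC : C.IsEditTreeCode (1 - ε) n) {D E : List σ} {r : List β}
    (hD : D.length ≤ n) (hE : E.length ≤ n)
    (h : suffixDist (C.encode D) r < ENNReal.ofReal (1 / 2 - ε))
    (h' : suffixDist (C.encode E) r < ENNReal.ofReal (1 / 2 - ε)) : D = E := by
  -- What remains is a comparison of two words: they are equal, one properly extends the other, or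
  -- they part at a node.
  obtain ⟨τ, hτ, hb⟩ := exists_suffixBound (by linarith) h
  obtain ⟨τ', hτ', hb'⟩ := exists_suffixBound (by linarith) h'
  have split : ∀ D E : List σ, D = E ∨ (∃ B x e, D = B ∧ E = B ++ x :: e) ∨
      (∃ B x e, E = B ∧ D = B ++ x :: e) ∨
      ∃ B x y d e, x ≠ y ∧ D = B ++ x :: d ∧ E = B ++ y :: e := by
    intro D
    induction D with
    | nil =>
      rintro (_ | ⟨y, E⟩)
      · exact Or.inl rfl
      · exact Or.inr (Or.inl ⟨[], y, E, rfl, rfl⟩)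
    | cons x D ih =>
      rintro (_ | ⟨y, E⟩)
      · exact Or.inr (Or.inr (Or.inl ⟨[], x, D, rfl, rfl⟩))
      · by_cases hxy : x = y
        · subst hxy
          rcases ih E with h | ⟨B, z, e, h1, h2⟩ | ⟨B, z, e, h1, h2⟩ |
            ⟨B, z, w, d, e, h0, h1, h2⟩
          · exact Or.inl (by rw [h])
          · exact Or.inr (Or.inl ⟨x :: B, z, e, by rw [h1], by rw [h2]; rfl⟩)
          · exact Or.inr (Or.inr (Or.inl ⟨x :: B, z, e, by rw [h1], by rw [h2]; rfl⟩))
          · exact Or.inr (Or.inr (Or.inr ⟨x :: B, z, w, d, e, h0, by rw [h1]; rfl,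
              by rw [h2]; rfl⟩))
        · exact Or.inr (Or.inr (Or.inr ⟨[], x, y, D, E, hxy, rfl, rfl⟩))
  rcases split D E with h | ⟨B, x, e, rfl, rfl⟩ | ⟨B, x, e, rfl, rfl⟩ |
    ⟨B, x, y, d, e, hxy, rfl, rfl⟩
  · exact h
  · exact (hC.not_extending hε hε' hτ hb hτ' hb' hE).elim
  · exact (hC.not_extending hε hε' hτ' hb' hτ hb hD).elim
  · exact (hC.not_diverging hε hε' hxy hτ hb hτ' hb' hD hE).elim

/-- If the potential of a matching is zero, then the message is decoded correctly. -/
theorem IsDecoder.decode_eq {C : PrefixCode σ β} [Nontrivial σ] {ε x : ℝ} {n : ℕ}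
    {dec : List β → List σ} (hdec : C.IsDecoder n dec)
    (hε : 0 < ε) (hε' : ε < 1 / 2) (hC : C.IsEditTreeCode (1 - ε) n) (hx : 0 ≤ x)
    (hxε : x < 1 / 2 - ε) {m : List σ} {r : List β} (hm : m.length ≤ n) {τ : StringMatching β}
    (hτ : τ.Matches (C.encode m) r) (hpot : τ.potential x ≤ 0) : dec r = m := by
  have h1 : suffixDist (C.encode m) r < ENNReal.ofReal (1 / 2 - ε) :=
    ((suffixBound_of_potential hpot).suffixDist_le hx hτ).trans_lt
      ((ENNReal.ofReal_lt_ofReal_iff (by linarith)).2 hxε)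
  exact hC.eq_of_suffixDist_lt hε hε' (hdec r).1 hm (((hdec r).2 m hm).trans_lt h1) h1

end PrefixCode

/-! ### The receiver reads descriptions, slots and pages correctly -/

namespace PiPrime

theorem ofBits_bits (m : ℕ) : ofBits (Nat.bits m) = m := by
  induction m using Nat.binaryRec' with
  | zero => simp [ofBits]
  | bit b n h ih =>
    rw [Nat.bits_append_bit n b h]
    simpa [ofBits] using congrArg (Nat.bit b) ih

theorem length_description (m s : ℕ) : (description m s).length = m.size + 3 := by
  simp [description, Nat.size_eq_bits_len]

theorem ofBits_take_description (m s : ℕ) (hs : s < 8) :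
    ofBits ((description m s).take 3) = s := by
  have : (description m s).take 3 = [s.testBit 0, s.testBit 1, s.testBit 2] := by
    simp [description]
  rw [this]
  interval_cases s <;> decide

theorem ofBits_drop_description (m s : ℕ) : ofBits ((description m s).drop 3) = m := by
  have : (description m s).drop 3 = Nat.bits m := by
    simp [description]
  rw [this, ofBits_bits]

theorem eq_dropLast_dropLast_append {e : List Bool} (h : 2 ≤ e.length) :
    e = e.dropLast.dropLast ++ [e.dropLast.getLastD false, e.getLastD false] := by
  rcases List.eq_nil_or_concat e with rfl | ⟨e, b, rfl⟩
  · simp at h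
  · rcases List.eq_nil_or_concat e with rfl | ⟨e, a, rfl⟩
    · simp at h
    · simp

theorem isOwn_iff {p : Party} {T : ℕ} {x : List Bool → Bool} {e : List Bool} :
    isOwn p T x e = true ↔
      e ≠ [] ∧ e.length ≤ T ∧ ownerAt (e.length - 1) = p ∧ e = e.dropLast ++ [x e.dropLast] := by
  simp [isOwn]

/-- The description of an edge, linked to the round `n`, is decoded correctly. -/
theorem decodeEdge_description {q : Party} {T : ℕ} {x : List Bool → Bool} {e : List Bool}
    (he : isOwn q T x e = true) {log : List (ℕ × List Bool)} {i n : ℕ} (hn : n < i)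
    (h : e.length ≤ 2 ∧ n = 0 ∨ 2 < e.length ∧ 1 ≤ n ∧
      log.find? (fun a => a.1 == n) = some (n, e.dropLast.dropLast)) :
    decodeEdge q T log i (description (i - n) (childIndex e)) = some e := by
  obtain ⟨h0, hT, hq, -⟩ := isOwn_iff.1 he
  have hb1 : decide (3 ≤ childIndex e) = e.dropLast.getLastD false := by
    unfold childIndex
    cases e.dropLast.getLastD false <;> cases e.getLastD false <;> decide
  have hb2 : decide (childIndex e % 2 = 0) = e.getLastD false := by
    unfold childIndex
    cases e.dropLast.getLastD false <;> cases e.getLastD false <;> decide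
  have hc : 1 ≤ childIndex e ∧ childIndex e ≤ 4 := by
    unfold childIndex
    cases e.dropLast.getLastD false <;> cases e.getLastD false <;> decide
  unfold decodeEdge
  rw [ofBits_take_description _ _ (by omega), ofBits_drop_description]
  simp only [hb1, hb2]
  rw [if_neg (by omega)]
  -- Rounds are counted from 1, so the link `n = 0`, that is `m = i`, cannot be confused with a
  -- grandparent.
  rcases h with ⟨h2, rfl⟩ | ⟨h2, hn1, hf⟩
  · rw [if_pos (by omega)]
    rcases e with _ | ⟨a, _ | ⟨b, _ | ⟨c, e⟩⟩⟩
    · exact absurd rfl h0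
    · cases q
      · simpa using hT
      · simp [ownerAt] at hq
    · cases q
      · simp [ownerAt] at hq
      · simpa using hT
    · simp at h2
  · rw [if_neg (by omega)]
    have : i - (i - n) = n := by omega
    rw [this, hf, Option.map_some, ← eq_dropLast_dropLast_append (by omega)]
    simpa using hT

/-- The edge stays in the table after the present cycle. -/
def Entry.alive (a : Entry) : Bool := a.sent != a.desc.length && a.live != 0

/-- The edge is sent completely. -/
def Entry.done (a : Entry) : Bool := a.sent == a.desc.length

/-- The entry for the log. -/
def Entry.record (a : Entry) : ℕ × List Bool := (a.start, a.edge)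

/-- What the other party knows about the edge after the present cycle. -/
def Entry.incoming (a : Entry) : Incoming := ⟨a.start, a.desc.take a.sent⟩

/-- The edge loses a live point and sends a bit. -/
def Entry.advance (a : Entry) : Entry := { a with live := a.live - 1, sent := a.sent + 1 }

/-- The edge `e` gets `L` more live points. -/
def Entry.grant (L : ℕ) (e : List Bool) (a : Entry) : Entry :=
  if a.edge = e then { a with live := a.live + L } else a

theorem Entry.grant_eq (L : ℕ) (e : List Bool) (a : Entry) : a.grant L e =
    { a with live := a.live + if a.edge = e then L else 0 } := by
  unfold Entry.grant
  split <;> simp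

theorem readSlot_slot {q : Party} {T r c : ℕ} {a : Entry} {todo rest kept : List Incoming}
    {log : List (ℕ × List Bool)} (h1 : 1 ≤ a.sent) (h2 : a.sent ≤ a.desc.length)
    (hdec : decodeEdge q T log a.start a.desc = some a.edge)
    (h : (a.sent ≠ 1 ∧ todo = ⟨a.start, a.desc.take (a.sent - 1)⟩ :: rest) ∨
      (a.sent = 1 ∧ a.start = c ∧ todo = [] ∧ rest = [])) :
    readSlot q T ⟨r, c, todo, kept, log⟩ a.slot =
      some ⟨r, c, rest, kept ++ ([a].filter Entry.alive).map Entry.incoming,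
        log ++ ([a].filter Entry.done).map Entry.record⟩ := by
  have hbits : a.desc.take (a.sent - 1) ++ [a.desc.getD (a.sent - 1) false] =
      a.desc.take a.sent := by
    obtain ⟨k, hk⟩ : ∃ k, a.sent = k + 1 := ⟨a.sent - 1, by omega⟩
    rw [hk, Nat.add_sub_cancel, List.getD_eq_getElem _ _ (by omega), List.take_concat_get']
  have key : (if a.slot.done then do
      let e ← decodeEdge q T log a.start (a.desc.take a.sent)
      return (⟨r, c, rest, kept, log ++ [(a.start, e)]⟩ : RecvState)
    else if a.slot.dead then return ⟨r, c, rest, kept, log⟩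
    else return ⟨r, c, rest, kept ++ [⟨a.start, a.desc.take a.sent⟩], log⟩) =
      some (⟨r, c, rest, kept ++ ([a].filter Entry.alive).map Entry.incoming,
        log ++ ([a].filter Entry.done).map Entry.record⟩ : RecvState) := by
    by_cases hd : a.sent = a.desc.length
    · simp [Entry.slot, Entry.alive, Entry.done, hd, hdec, Entry.record]
    · by_cases hl : a.live = 0
      · simp [Entry.slot, Entry.alive, Entry.done, hd, hl]
      · have : a.alive = true := by simp [Entry.alive, hd, hl]
        simp [Entry.slot, Entry.done, hd, hl, this, Entry.incoming]
  rw [← key]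
  rcases h with ⟨hs, rfl⟩ | ⟨hs, rfl, rfl, rfl⟩
  · have hn : a.slot.new = false := by simp [Entry.slot, hs]
    have hb : a.slot.bit = a.desc.getD (a.sent - 1) false := rfl
    simp only [readSlot, hn, hb]
    simp only [Option.bind_eq_bind, Option.bind_some, hbits]
  · have hn : a.slot.new = true := by simp [Entry.slot, hs]
    have hb : a.slot.bit = a.desc.getD (a.sent - 1) false := rfl
    have h0 : a.desc.take (a.sent - 1) = [] := by simp [hs]
    rw [h0, List.nil_append] at hbits
    simp only [readSlot, hn, hb]
    simp only [Option.bind_eq_bind, Option.bind_some, List.nil_append, hbits]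

/-- Old entries come first, in the order of the receiver's list `todo`, with one bit less on the
receiver's side; new entries find this list empty. Decoding is required for every extension of the
log, because edges completed earlier in the same cycle are already appended to it. -/
theorem foldlM_readSlot {q : Party} {T r c : ℕ} (new : List Entry) (old : List Entry) :
    ∀ (kept : List Incoming) (log : List (ℕ × List Bool)),
    (∀ a ∈ old ++ new, 1 ≤ a.sent ∧ a.sent ≤ a.desc.length ∧
      ∀ l, decodeEdge q T (log ++ l) a.start a.desc = some a.edge) →
    (∀ a ∈ old, a.sent ≠ 1) → (∀ a ∈ new, a.sent = 1 ∧ a.start = c) →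
    ((old ++ new).map Entry.slot).foldlM (readSlot q T)
      ⟨r, c, old.map fun a => ⟨a.start, a.desc.take (a.sent - 1)⟩, kept, log⟩ =
      some ⟨r, c, [], kept ++ ((old ++ new).filter Entry.alive).map Entry.incoming,
        log ++ ((old ++ new).filter Entry.done).map Entry.record⟩ := by
  induction old with
  | nil =>
    induction new with
    | nil => intro kept log _ _ _; simp
    | cons a new ih =>
      intro kept log h1 h2 h3
      obtain ⟨ha1, ha2, ha3⟩ := h1 a (by simp)
      obtain ⟨hb1, hb2⟩ := h3 a (by simp)
      have := ih (kept ++ ([a].filter Entry.alive).map Entry.incoming)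
        (log ++ ([a].filter Entry.done).map Entry.record)
        (fun b hb => ⟨(h1 b (List.mem_cons_of_mem _ hb)).1, (h1 b (List.mem_cons_of_mem _ hb)).2.1,
          fun l => by rw [List.append_assoc]; exact (h1 b (List.mem_cons_of_mem _ hb)).2.2 _⟩)
        (by simp) (fun b hb => h3 b (List.mem_cons_of_mem _ hb))
      simp only [List.nil_append, List.map_nil, List.map_cons, List.foldlM_cons] at this ⊢
      rw [readSlot_slot ha1 ha2 (by simpa using ha3 []) (Or.inr ⟨hb1, hb2, rfl, rfl⟩)]
      simp only [Option.bind_eq_bind, Option.bind_some]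
      rw [this, ← List.singleton_append (x := a) (l := new), List.filter_append,
        List.filter_append, List.map_append, List.map_append]
      simp only [List.append_assoc]
  | cons a old ih =>
    intro kept log h1 h2 h3
    obtain ⟨ha1, ha2, ha3⟩ := h1 a (by simp)
    have := ih (kept ++ ([a].filter Entry.alive).map Entry.incoming)
      (log ++ ([a].filter Entry.done).map Entry.record)
      (fun b hb => ⟨(h1 b (List.mem_cons_of_mem _ hb)).1, (h1 b (List.mem_cons_of_mem _ hb)).2.1,
        fun l => by rw [List.append_assoc]; exact (h1 b (List.mem_cons_of_mem _ hb)).2.2 _⟩)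
      (fun b hb => h2 b (List.mem_cons_of_mem _ hb)) h3
    simp only [List.cons_append, List.map_cons, List.foldlM_cons] at this ⊢
    rw [readSlot_slot ha1 ha2 (by simpa using ha3 []) (Or.inl ⟨h2 a (by simp), rfl⟩)]
    simp only [Option.bind_eq_bind, Option.bind_some]
    have e : ∀ f : Entry → Bool,
        (a :: (old ++ new)).filter f = [a].filter f ++ (old ++ new).filter f := fun f => by
      rw [← List.filter_append]; rfl
    rw [this, e, e, List.map_append, List.map_append, List.append_assoc, List.append_assoc]

/-- Slots are read without regard to the round counter, so the pages of a cycle can be treated as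
one list of slots. -/
theorem readSlot_round (q : Party) (T : ℕ) (st : RecvState) (r : ℕ) (s : Slot) :
    readSlot q T { st with round := r } s =
      (readSlot q T st s).map fun st => { st with round := r } := by
  obtain ⟨r0, c, todo, kept, log⟩ := st
  obtain ⟨b, dead, done, new⟩ := s
  cases new <;> cases todo <;> cases done <;> cases dead <;> simp [readSlot]

theorem foldlM_readSlot_round (q : Party) (T : ℕ) (r : ℕ) (S : List Slot) : ∀ (st : RecvState),
    S.foldlM (readSlot q T) { st with round := r } =
      (S.foldlM (readSlot q T) st).map fun st => { st with round := r } := by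
  induction S with
  | nil => intro st; rfl
  | cons s S ih =>
    intro st
    rw [List.foldlM_cons, List.foldlM_cons, readSlot_round]
    cases readSlot q T st s with
    | none => rfl
    | some st' => exact ih st'

theorem toList_ofList (K : ℕ) (b : Bool) (l : List Slot) (h : l.length ≤ K) :
    (Page.ofList K b l).toList = l := by
  unfold Page.toList Page.ofList
  induction K generalizing l with
  | zero =>
    have : l = [] := List.length_eq_zero_iff.1 (by omega)
    subst this; rfl
  | succ K ih =>
    rw [List.ofFn_succ]
    cases l with
    | nil => simp [List.reduceOption_cons_of_none]
    | cons a l => simpa [List.reduceOption_cons_of_some] using ih l (by simpa using h)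

theorem foldlM_readPage {K : ℕ} {q : Party} {T : ℕ} (m : ℕ) : ∀ (S : List Slot)
    (st st' : RecvState), S.length ≤ (m + 1) * K → S.foldlM (readSlot q T) st = some st' →
    st'.todo = [] →
    ((List.range (m + 1)).map fun j => Page.ofList K (j + 1 == m + 1)
      ((S.drop (j * K)).take K)).foldlM (readPage q T) st =
      some ⟨st.round + (m + 1), st.round + (m + 1), st'.kept, [], st'.log⟩ := by
  induction m with
  | zero =>
    intro S st st' hS h ht
    have hr : st'.round = st.round := by
      have := foldlM_readSlot_round q T st.round S st
      rw [show ({ st with round := st.round } : RecvState) = st from rfl, h] at this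
      simpa using congrArg RecvState.round (Option.some.inj this)
    have h1 : (Page.ofList K true (S.take K)).toList = S := by
      rw [toList_ofList _ _ _ (by simp), List.take_of_length_le (by omega)]
    simp only [zero_add, List.range_one, List.map_singleton, List.foldlM_cons, List.foldlM_nil,
      BEq.rfl, zero_mul, List.drop_zero]
    rw [readPage, h1, h]
    simp [Page.ofList, ht, hr]
  | succ m ih =>
    intro S st st' hS h ht
    rw [List.range_succ_eq_map, List.map_cons, List.map_map, List.foldlM_cons]
    have h1 : (Page.ofList K (0 + 1 == m + 1 + 1) ((S.drop (0 * K)).take K)).toList =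
        S.take K := by
      rw [toList_ofList _ _ _ (by simp)]; simp
    rw [← List.take_append_drop K S, List.foldlM_append] at h
    obtain ⟨st1, hst1, hst2⟩ := Option.bind_eq_some_iff.1 h
    have hr : st1.round = st.round := by
      have := foldlM_readSlot_round q T st.round (S.take K) st
      rw [show ({ st with round := st.round } : RecvState) = st from rfl, hst1] at this
      simpa using congrArg RecvState.round (Option.some.inj this)
    have h2 : readPage q T st (Page.ofList K (0 + 1 == m + 1 + 1) ((S.drop (0 * K)).take K)) =
        some { st1 with round := st1.round + 1 } := by
      rw [readPage, h1, hst1]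
      simp [Page.ofList]
    rw [h2]
    simp only [Option.bind_eq_bind, Option.bind_some]
    have h3 := foldlM_readSlot_round q T (st1.round + 1) (S.drop K) st1
    rw [hst2] at h3
    have := ih (S.drop K) _ _ (by rw [List.length_drop]; rw [add_mul] at hS; omega) h3 ht
    simp only [hr] at this ⊢
    rw [← add_assoc, show st.round + (m + 1) + 1 = st.round + 1 + (m + 1) by omega, ← this]
    congr 1
    apply List.map_congr_left
    intro j _
    simp only [Function.comp_apply, List.drop_drop, Nat.succ_eq_add_one]
    rw [add_mul j 1 K, one_mul, add_comm K]
    congr 1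
    rw [Bool.eq_iff_iff]
    simp

theorem length_le_mul_ceil (n : ℕ) {K : ℕ} (hK : 0 < K) : n ≤ (n + K - 1) / K * K := by
  have := Nat.div_add_mod (n + K - 1) K
  have := Nat.mod_lt (n + K - 1) hK
  have := mul_comm K ((n + K - 1) / K)
  omega

/-- The receiver reads the pages of a cycle. -/
theorem foldlM_pages {K : ℕ} (hK : 0 < K) {q : Party} {T : ℕ} (t : List Entry)
    {st st' : RecvState} (h : (t.map Entry.slot).foldlM (readSlot q T) st = some st')
    (ht : st'.todo = []) :
    (pages K t).foldlM (readPage q T) st = some ⟨st.round + (pages K t).length,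
      st.round + (pages K t).length, st'.kept, [], st'.log⟩ := by
  obtain ⟨m, hm⟩ : ∃ m, max 1 ((t.length + K - 1) / K) = m + 1 :=
    ⟨max 1 ((t.length + K - 1) / K) - 1, by omega⟩
  have hlen : (t.map Entry.slot).length ≤ (m + 1) * K := by
    rw [List.length_map, ← hm]
    exact (length_le_mul_ceil _ hK).trans (Nat.mul_le_mul_right _ (le_max_right _ _))
  have := foldlM_readPage (K := K) (q := q) (T := T) m _ st st' hlen h ht
  unfold pages
  simp only [hm, List.length_map, List.length_range]
  rw [← this]
  simp only [List.map_drop, List.map_take]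

end PiPrime

/-! ### Invariants of a party's table and log -/

namespace PiPrime

/-- The round to which the description of an edge is linked. -/
def link (log : List (ℕ × List Bool)) (e : List Bool) : ℕ :=
  if e.length ≤ 2 then 0
  else ((log.find? (fun a => a.2 == e.dropLast.dropLast)).map Prod.fst).getD 0

theorem newEntry_eq (L i : ℕ) (log : List (ℕ × List Bool)) (e : List Bool) :
    newEntry L i log e = ⟨e, i, description (i - link log e) (childIndex e), 0, L⟩ := rfl

/-- The edge may be sent by a party that has sent the edges in the log. -/
def Linkable (log : List (ℕ × List Bool)) (e : List Bool) : Prop :=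
  e.length ≤ 2 ∨ e.dropLast.dropLast ∈ log.map Prod.snd

theorem Linkable.append {log : List (ℕ × List Bool)} {e : List Bool} (h : Linkable log e)
    (l : List (ℕ × List Bool)) : Linkable (log ++ l) e :=
  h.imp_right fun h => by rw [List.map_append]; exact List.mem_append_left _ h

theorem Linkable.find? {log : List (ℕ × List Bool)} {e : List Bool} (h : Linkable log e)
    (h2 : 2 < e.length) : ∃ b, log.find? (fun a => a.2 == e.dropLast.dropLast) = some b ∧
      b ∈ log ∧ b.2 = e.dropLast.dropLast ∧ link log e = b.1 := by
  obtain ⟨b, hb, hbe⟩ := List.mem_map.1 (h.resolve_left (by omega))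
  have : (log.find? (fun a => a.2 == e.dropLast.dropLast)).isSome := by
    rw [List.find?_isSome]
    exact ⟨b, hb, by simpa using hbe⟩
  obtain ⟨c, hc⟩ := Option.isSome_iff_exists.1 this
  refine ⟨c, hc, List.mem_of_find?_eq_some hc, by simpa using List.find?_some hc, ?_⟩
  rw [link, if_neg (by omega), hc]
  rfl

/-- The link goes to the first transmission in the log, so a later transmission of the same
grandparent leaves descriptions already in the table unchanged. -/
theorem Linkable.link_append {log : List (ℕ × List Bool)} {e : List Bool} (h : Linkable log e)
    (l : List (ℕ × List Bool)) : link (log ++ l) e = link log e := by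
  by_cases h2 : e.length ≤ 2
  · rw [link, link, if_pos h2, if_pos h2]
  · obtain ⟨b, hb, -⟩ := h.find? (by omega)
    rw [link, link, if_neg h2, if_neg h2, List.find?_append, hb]
    rfl

theorem find?_start {log : List (ℕ × List Bool)} {b : ℕ × List Bool} (hb : b ∈ log)
    (hinj : ∀ c ∈ log, c.1 = b.1 → c = b) (l : List (ℕ × List Bool)) :
    (log ++ l).find? (fun a => a.1 == b.1) = some b := by
  have : (log.find? (fun a => a.1 == b.1)).isSome := by
    rw [List.find?_isSome]
    exact ⟨b, hb, by simp⟩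
  obtain ⟨c, hc⟩ := Option.isSome_iff_exists.1 this
  rw [List.find?_append, hc, hinj c (List.mem_of_find?_eq_some hc) (by
    simpa using List.find?_some hc)]
  rfl

theorem description_ne_nil (m s : ℕ) : 3 ≤ (description m s).length := by
  rw [length_description]; omega

/-- The edge that is added to the table. -/
def chosen {K : ℕ} (p : Party) (T : ℕ) (x : List Bool → Bool) (d : List (Page K))
    (log : List (ℕ × List Bool)) : Option (List Bool) :=
  (endpoint p T x d).bind (nextEdge p T x log)

/-- The table of the next cycle. -/
def nextTable (L i : ℕ) (log : List (ℕ × List Bool)) (t : List Entry) :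
    Option (List Bool) → List Entry
  | none => t.map Entry.advance
  | some e =>
    if t.any (fun a => a.edge == e) then (t.map (Entry.grant L e)).map Entry.advance
    else (t ++ [newEntry L i log e]).map Entry.advance

variable {K : ℕ}

/-- The edges that are fully sent after the present cycle. -/
def State.finalLog (st : State K) : List (ℕ × List Bool) :=
  st.log ++ (st.table.filter Entry.done).map Entry.record

theorem update_eq (p : Party) (L T i : ℕ) (x : List Bool → Bool) (d : List (Page K))
    (st : State K) : update p L T i x d st =
      ⟨nextTable L i st.finalLog (st.table.filter Entry.alive) (chosen p T x d st.finalLog),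
        pages K (nextTable L i st.finalLog (st.table.filter Entry.alive)
          (chosen p T x d st.finalLog)), st.finalLog, st.sent⟩ := by
  have h : ∀ o : Option (List Bool), (match o with
      | none => st.table.filter Entry.alive
      | some e =>
        if (st.table.filter Entry.alive).any (fun a => a.edge == e) then
          (st.table.filter Entry.alive).map (Entry.grant L e)
        else st.table.filter Entry.alive ++ [newEntry L i st.finalLog e]).map Entry.advance =
        nextTable L i st.finalLog (st.table.filter Entry.alive) o := by
    rintro (_ | e)
    · rfl
    · simp only [nextTable]
      split <;> rfl
  rw [← h]
  rfl

theorem nextEdge_spec {p : Party} {T : ℕ} {x : List Bool → Bool} {log : List (ℕ × List Bool)}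
    {v e : List Bool} (h : nextEdge p T x log v = some e) :
    e <+: v ∧ isOwn p T x e = true ∧ Linkable log e := by
  have := List.mem_of_getLast? h
  rw [List.mem_filter, List.mem_inits] at this
  obtain ⟨h1, h2⟩ := this
  rw [Bool.and_eq_true] at h2
  refine ⟨h1, h2.1, ?_⟩
  have h3 := h2.2
  rw [Bool.or_eq_true, decide_eq_true_eq, List.any_eq_true] at h3
  refine h3.imp_right ?_
  rintro ⟨b, hb, hbe⟩
  exact List.mem_map.2 ⟨b, hb, by simpa using hbe⟩

theorem chosen_spec {p : Party} {T : ℕ} {x : List Bool → Bool} {d : List (Page K)}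
    {log : List (ℕ × List Bool)} {e : List Bool} (h : chosen p T x d log = some e) :
    isOwn p T x e = true ∧ Linkable log e := by
  obtain ⟨v, -, hv⟩ := Option.bind_eq_some_iff.1 h
  exact (nextEdge_spec hv).2

/-- The invariants of the state of a party after its round `i`. -/
structure State.Wf (p : Party) (T : ℕ) (x : List Bool → Bool) (i : ℕ) (st : State K) : Prop where
  own : ∀ b ∈ st.log ++ st.table.map Entry.record, isOwn p T x b.2 = true
  linkable : ∀ b ∈ st.log ++ st.table.map Entry.record, Linkable st.log b.2
  desc : ∀ a ∈ st.table,
    a.desc = description (a.start - link st.log a.edge) (childIndex a.edge) ∧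
      link st.log a.edge < a.start
  sent_le : ∀ a ∈ st.table, 1 ≤ a.sent ∧ a.sent ≤ a.desc.length
  start_le : ∀ b ∈ st.log ++ st.table.map Entry.record, 1 ≤ b.1 ∧ b.1 ≤ i
  inj : ∀ b ∈ st.log ++ st.table.map Entry.record,
    ∀ c ∈ st.log ++ st.table.map Entry.record, c.1 = b.1 → c = b
  nodup : (st.table.map Entry.edge).Nodup
  read : (st.sent ++ st.queue).foldlM (readPage p T) ⟨1, 1, [], [], []⟩ =
    some ⟨(st.sent ++ st.queue).length + 1, (st.sent ++ st.queue).length + 1,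
      (st.table.filter Entry.alive).map Entry.incoming, [], st.finalLog⟩

theorem mem_filter_alive {t : List Entry} {a : Entry} :
    a ∈ t.filter Entry.alive ↔ a ∈ t ∧ a.sent ≠ a.desc.length ∧ a.live ≠ 0 := by
  rw [List.mem_filter, Entry.alive]
  simp

theorem mem_filter_done {t : List Entry} {a : Entry} :
    a ∈ t.filter Entry.done ↔ a ∈ t ∧ a.sent = a.desc.length := by
  rw [List.mem_filter, Entry.done]
  simp

/-- An entry that stays in the table in the next cycle, if `o` is chosen. -/
def Entry.next (L : ℕ) (o : Option (List Bool)) (a : Entry) : Entry :=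
  { a with live := a.live + (if o = some a.edge then L else 0) - 1, sent := a.sent + 1 }

/-- The table of the next cycle consists of the entries that stay and of at most one new entry. -/
theorem nextTable_eq (L i : ℕ) (log : List (ℕ × List Bool)) (t : List Entry)
    (o : Option (List Bool)) : ∃ new : List Entry,
      nextTable L i log t o = t.map (Entry.next L o) ++ new ∧
      ((new = [] ∧ ∀ e, o = some e → ∃ a ∈ t, a.edge = e) ∨
        ∃ e, o = some e ∧ (∀ a ∈ t, a.edge ≠ e) ∧ new = [(newEntry L i log e).advance]) := by
  rcases o with _ | e
  · exact ⟨[], by rw [List.append_nil]; rfl, Or.inl ⟨rfl, by simp⟩⟩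
  · by_cases h : t.any (fun a => a.edge == e)
    · refine ⟨[], ?_, Or.inl ⟨rfl, ?_⟩⟩
      · rw [nextTable, if_pos h, List.map_map, List.append_nil]
        apply List.map_congr_left
        intro a _
        rw [Function.comp_apply, Entry.grant_eq]
        simp only [Entry.advance, Entry.next, Option.some.injEq, eq_comm]
      · intro e' he
        cases he
        simpa using h
    · have h' : ∀ a ∈ t, a.edge ≠ e := by simpa using h
      refine ⟨[(newEntry L i log e).advance], ?_, Or.inr ⟨e, rfl, h', rfl⟩⟩
      rw [nextTable, if_neg h, List.map_append]
      congr 1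
      apply List.map_congr_left
      intro a ha
      have : ¬ (some e = some a.edge) := fun he => h' a ha (Option.some.inj he).symm
      simp [Entry.advance, Entry.next, this]

theorem pages_ne_nil (K : ℕ) (t : List Entry) : pages K t ≠ [] := by
  intro h
  have := congrArg List.length h
  simp [pages] at this

theorem State.finalLog_subset (st : State K) {b : ℕ × List Bool} (h : b ∈ st.finalLog) :
    b ∈ st.log ++ st.table.map Entry.record := by
  rcases List.mem_append.1 h with h | h
  · exact List.mem_append_left _ h
  · obtain ⟨a, ha, rfl⟩ := List.mem_map.1 h
    exact List.mem_append_right _ (List.mem_map.2 ⟨a, (mem_filter_done.1 ha).1, rfl⟩)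

/-- The decoded string `d` is arbitrary: even after wrong decodings a party sends only edges of its
own input, in a form that the other side can read. -/
theorem State.Wf.update (hK : 0 < K) {p : Party} {L T : ℕ} {x : List Bool → Bool} {i : ℕ}
    {st : State K} (h : st.Wf p T x i) (hq : st.queue = []) (hs : st.sent.length = i)
    (d : List (Page K)) : (update p L T (i + 1) x d st).Wf p T x (i + 1) := by
  rw [update_eq]
  generalize ho : chosen p T x d st.finalLog = o
  obtain ⟨new, ht, hnew⟩ := nextTable_eq L (i + 1) st.finalLog (st.table.filter Entry.alive) o
  rw [ht]
  set t := (st.table.filter Entry.alive).map (Entry.next L o) with htdef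
  have hmem : ∀ a ∈ t, ∃ b ∈ st.table, b.sent ≠ b.desc.length ∧ b.live ≠ 0 ∧
      a = b.next L o := by
    intro a ha
    obtain ⟨b, hb, rfl⟩ := List.mem_map.1 ha
    obtain ⟨h1, h2, h3⟩ := mem_filter_alive.1 hb
    exact ⟨b, h1, h2, h3, rfl⟩
  have hnewmem : ∀ a ∈ new, ∃ e, isOwn p T x e = true ∧ Linkable st.finalLog e ∧
      (∀ a ∈ st.table.filter Entry.alive, a.edge ≠ e) ∧
      a = (newEntry L (i + 1) st.finalLog e).advance ∧ new = [a] := by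
    intro a ha
    rcases hnew with ⟨rfl, -⟩ | ⟨e, rfl, he, rfl⟩
    · simp at ha
    · obtain rfl := List.mem_singleton.1 ha
      obtain ⟨h1, h2⟩ := chosen_spec ho
      exact ⟨e, h1, h2, he, rfl, rfl⟩
  have hrec : ∀ b ∈ st.finalLog ++ (t ++ new).map Entry.record,
      b ∈ st.log ++ st.table.map Entry.record ∨ ∃ a ∈ new, b = a.record := by
    intro b hb
    rw [List.map_append, List.mem_append, List.mem_append] at hb
    rcases hb with hb | hb | hb
    · exact Or.inl (st.finalLog_subset hb)
    · obtain ⟨a, ha, rfl⟩ := List.mem_map.1 hb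
      obtain ⟨c, hc, -, -, rfl⟩ := hmem a ha
      exact Or.inl (List.mem_append_right _ (List.mem_map.2 ⟨c, hc, rfl⟩))
    · obtain ⟨a, ha, rfl⟩ := List.mem_map.1 hb
      exact Or.inr ⟨a, ha, rfl⟩
  have hown : ∀ b ∈ st.finalLog ++ (t ++ new).map Entry.record, isOwn p T x b.2 = true := by
    intro b hb
    rcases hrec b hb with hb | ⟨a, ha, rfl⟩
    · exact h.own b hb
    · obtain ⟨e, he, -, -, rfl, -⟩ := hnewmem a ha
      exact he
  have hlink : ∀ b ∈ st.finalLog ++ (t ++ new).map Entry.record, Linkable st.finalLog b.2 := by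
    intro b hb
    rcases hrec b hb with hb | ⟨a, ha, rfl⟩
    · exact (h.linkable b hb).append _
    · obtain ⟨e, -, he, -, rfl, -⟩ := hnewmem a ha
      exact he
  have hinjlog : ∀ b ∈ st.finalLog, ∀ c ∈ st.finalLog, c.1 = b.1 → c = b := fun b hb c hc =>
    h.inj b (st.finalLog_subset hb) c (st.finalLog_subset hc)
  have hlinklt : ∀ e, Linkable st.finalLog e → link st.finalLog e < i + 1 := by
    intro e he
    by_cases h2 : e.length ≤ 2
    · rw [link, if_pos h2]; omega
    · obtain ⟨b, -, hb, -, hb'⟩ := he.find? (by omega)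
      have := (h.start_le b (st.finalLog_subset hb)).2
      omega
  have hdesc : ∀ a ∈ t ++ new,
      a.desc = description (a.start - link st.finalLog a.edge) (childIndex a.edge) ∧
      link st.finalLog a.edge < a.start := by
    intro a ha
    rcases List.mem_append.1 ha with ha | ha
    · obtain ⟨b, hb, -, -, rfl⟩ := hmem a ha
      have := (h.linkable b.record (List.mem_append_right _ (List.mem_map.2 ⟨b, hb, rfl⟩)))
      have e : link st.finalLog b.edge = link st.log b.edge := this.link_append _
      simpa only [Entry.next, e] using h.desc b hb
    · obtain ⟨e, -, he, -, rfl, -⟩ := hnewmem a ha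
      exact ⟨rfl, hlinklt e he⟩
  have hsent : ∀ a ∈ t ++ new, 1 ≤ a.sent ∧ a.sent ≤ a.desc.length := by
    intro a ha
    rcases List.mem_append.1 ha with ha | ha
    · obtain ⟨b, hb, hb', -, rfl⟩ := hmem a ha
      have := (h.sent_le b hb).2
      simp only [Entry.next]
      omega
    · obtain ⟨e, -, -, -, rfl, -⟩ := hnewmem a ha
      refine ⟨le_rfl, ?_⟩
      have := description_ne_nil (i + 1 - link st.finalLog e) (childIndex e)
      change 1 ≤ _
      exact le_trans (by norm_num) this
  have hstart : ∀ b ∈ st.finalLog ++ (t ++ new).map Entry.record, 1 ≤ b.1 ∧ b.1 ≤ i + 1 := by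
    intro b hb
    rcases hrec b hb with hb | ⟨a, ha, rfl⟩
    · have := h.start_le b hb
      omega
    · obtain ⟨e, -, -, -, rfl, -⟩ := hnewmem a ha
      exact ⟨Nat.succ_pos i, le_rfl⟩
  refine ⟨hown, hlink, hdesc, hsent, hstart, ?_, ?_, ?_⟩
  -- Starting rounds identify transmissions: a round inserts at most one entry, and all older ones
  -- started by round `i`.
  · intro b hb c hc hcb
    rcases hrec b hb with hb | ⟨a, ha, rfl⟩ <;> rcases hrec c hc with hc | ⟨a', ha', rfl⟩
    · exact h.inj b hb c hc hcb
    · obtain ⟨e, -, -, -, rfl, -⟩ := hnewmem a' ha'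
      have := (h.start_le b hb).2
      change i + 1 = b.1 at hcb
      omega
    · obtain ⟨e, -, -, -, rfl, -⟩ := hnewmem a ha
      have := (h.start_le c hc).2
      change c.1 = i + 1 at hcb
      omega
    · obtain ⟨-, -, -, -, -, h1⟩ := hnewmem a ha
      rw [h1, List.mem_singleton] at ha'
      rw [ha']
  · have e1 : t.map Entry.edge = (st.table.filter Entry.alive).map Entry.edge := by
      rw [htdef, List.map_map]
      rfl
    simp only [List.map_append, e1]
    have e2 : ((st.table.filter Entry.alive).map Entry.edge).Nodup :=
      h.nodup.sublist (List.filter_sublist.map _)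
    rcases hnew with ⟨rfl, -⟩ | ⟨e, -, he, rfl⟩
    · simpa using e2
    · rw [List.nodup_append]
      refine ⟨e2, by simp, ?_⟩
      rintro a ha b hb rfl
      obtain ⟨c, hc, rfl⟩ := List.mem_map.1 ha
      rw [List.map_singleton, List.mem_singleton] at hb
      exact he c hc hb
  · have hread := h.read
    rw [hq, List.append_nil, hs] at hread
    have hfold := foldlM_readSlot (q := p) (T := T) (r := i + 1) (c := i + 1) new t []
      st.finalLog (fun a ha => ⟨(hsent a ha).1, (hsent a ha).2, fun l => by
        have hmem' : a.record ∈ st.finalLog ++ (t ++ new).map Entry.record :=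
          List.mem_append_right _ (List.mem_map.2 ⟨a, ha, rfl⟩)
        rw [(hdesc a ha).1]
        refine decodeEdge_description (hown _ hmem') (hdesc a ha).2 ?_
        by_cases h2 : a.edge.length ≤ 2
        · exact Or.inl ⟨h2, by rw [link, if_pos h2]⟩
        · obtain ⟨b, -, hb, hb', hb''⟩ := (hlink _ hmem').find? (by simpa [Entry.record] using h2)
          change link st.finalLog a.edge = b.1 at hb''
          change b.2 = a.edge.dropLast.dropLast at hb'
          refine Or.inr ⟨not_le.1 h2, ?_, ?_⟩
          · rw [hb'']; exact (h.start_le b (st.finalLog_subset hb)).1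
          · change _ = some (_, a.edge.dropLast.dropLast)
            rw [hb'', ← hb']
            exact find?_start hb (fun c hc => hinjlog b hb c hc) l⟩)
      (fun a ha => by
        obtain ⟨b, hb, -, -, rfl⟩ := hmem a ha
        have := (h.sent_le b hb).1
        simp only [Entry.next]
        omega)
      (fun a ha => by
        obtain ⟨e, -, -, -, rfl, -⟩ := hnewmem a ha
        exact ⟨rfl, rfl⟩)
    have e1 : (t.map fun a => (⟨a.start, a.desc.take (a.sent - 1)⟩ : Incoming)) =
        (st.table.filter Entry.alive).map Entry.incoming := by
      rw [htdef, List.map_map]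
      rfl
    rw [e1] at hfold
    have := foldlM_pages hK (t ++ new) hfold rfl
    rw [List.foldlM_append, hread]
    simp only [Option.bind_eq_bind, Option.bind_some]
    rw [this, List.length_append, hs]
    simp only [List.nil_append, State.finalLog]
    rw [add_right_comm]

theorem State.Wf.sendPage {p : Party} {T : ℕ} {x : List Bool → Bool} {i : ℕ}
    {st : State K} (h : st.Wf p T x i) : (sendPage st).Wf p T x i := by
  obtain ⟨table, queue, log, sent⟩ := st
  cases queue with
  | nil => exact h
  | cons g rest =>
    refine ⟨h.own, h.linkable, h.desc, h.sent_le, h.start_le, h.inj, h.nodup, ?_⟩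
    have := h.read
    simp only [PiPrime.sendPage, State.finalLog, List.append_assoc, List.singleton_append] at this ⊢
    exact this

theorem State.Wf.mono {p : Party} {T : ℕ} {x : List Bool → Bool} {i j : ℕ} (hij : i ≤ j)
    {st : State K} (h : st.Wf p T x i) : st.Wf p T x j :=
  ⟨h.own, h.linkable, h.desc, h.sent_le, fun b hb => ⟨(h.start_le b hb).1,
    (h.start_le b hb).2.trans hij⟩, h.inj, h.nodup, h.read⟩

theorem sent_sendPage {st : State K} (h : st.queue ≠ []) :
    ∃ g, st.queue = g :: (sendPage st).queue ∧ (sendPage st).sent = st.sent ++ [g] := by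
  obtain ⟨table, queue, log, sent⟩ := st
  cases queue with
  | nil => exact absurd rfl h
  | cons g rest => exact ⟨g, rfl, rfl⟩

variable {β : Type v}

/-- The state at the start of the sending step. -/
def stateBefore (p : Party) (L T : ℕ) (dec : List β → List (Page K)) (x : List Bool → Bool)
    (r : List β) (i : ℕ) : State K :=
  if (stateAfter p L T dec x r i).queue.isEmpty then
    update p L T (i + 1) x (dec (heard p r (i + 1))) (stateAfter p L T dec x r i)
  else stateAfter p L T dec x r i

theorem stateAfter_succ (p : Party) (L T : ℕ) (dec : List β → List (Page K))
    (x : List Bool → Bool) (r : List β) (i : ℕ) :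
    stateAfter p L T dec x r (i + 1) = sendPage (stateBefore p L T dec x r i) := rfl

theorem queue_stateBefore_ne_nil (p : Party) (L T : ℕ) (dec : List β → List (Page K))
    (x : List Bool → Bool) (r : List β) (i : ℕ) : (stateBefore p L T dec x r i).queue ≠ [] := by
  unfold stateBefore
  split
  · rw [update_eq]; exact pages_ne_nil _ _
  · next h => simpa using h

theorem sent_stateBefore (p : Party) (L T : ℕ) (dec : List β → List (Page K))
    (x : List Bool → Bool) (r : List β) (i : ℕ) :
    (stateBefore p L T dec x r i).sent = (stateAfter p L T dec x r i).sent := by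
  unfold stateBefore
  split
  · rw [update_eq]
  · rfl

theorem exists_sent_succ (p : Party) (L T : ℕ) (dec : List β → List (Page K))
    (x : List Bool → Bool) (r : List β) (i : ℕ) : ∃ g,
    (stateAfter p L T dec x r (i + 1)).sent = (stateAfter p L T dec x r i).sent ++ [g] := by
  obtain ⟨g, -, hg⟩ := sent_sendPage (queue_stateBefore_ne_nil p L T dec x r i)
  exact ⟨g, by rw [stateAfter_succ, hg, sent_stateBefore]⟩

theorem length_sent (p : Party) (L T : ℕ) (dec : List β → List (Page K))
    (x : List Bool → Bool) (r : List β) (i : ℕ) : (stateAfter p L T dec x r i).sent.length = i := by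
  induction i with
  | zero => rfl
  | succ i ih =>
    obtain ⟨g, hg⟩ := exists_sent_succ p L T dec x r i
    rw [hg, List.length_append, ih]
    rfl

theorem wf_stateAfter (hK : 0 < K) (p : Party) (L T : ℕ) (dec : List β → List (Page K))
    (x : List Bool → Bool) (r : List β) (i : ℕ) : (stateAfter p L T dec x r i).Wf p T x i := by
  induction i with
  | zero => constructor <;> simp [stateAfter, State.finalLog]
  | succ i ih =>
    rw [stateAfter_succ]
    apply State.Wf.sendPage
    unfold stateBefore
    split
    · next h => exact ih.update hK (by simpa using h) (length_sent p L T dec x r i) _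
    · exact ih.mono (Nat.le_succ i)

/-- The edges communicated by a part of the pages of a valid string. -/
theorem edgesOf_subset_append {p : Party} {T : ℕ} {d d' : List (Page K)} {st : RecvState}
    (h : (d ++ d').foldlM (readPage p T) ⟨1, 1, [], [], []⟩ = some st) :
    edgesOf p T d ⊆ st.log.map Prod.snd := by
  have slot : ∀ (s : Slot) (a b : RecvState), readSlot p T a s = some b →
      a.log ⊆ b.log := by
    rintro ⟨bit, dead, done, new⟩ ⟨r, c, todo, kept, log⟩ b hab
    cases new <;> cases todo <;> cases done <;> cases dead <;> simp [readSlot] at hab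
    all_goals first
      | (subst hab; simp)
      | (revert hab
         generalize decodeEdge _ _ _ _ _ = o
         intro hab
         cases o <;> cases hab
         simp)
  have slots : ∀ (S : List Slot) (a b : RecvState), S.foldlM (readSlot p T) a = some b →
      a.log ⊆ b.log := by
    intro S
    induction S with
    | nil => rintro a b hab; cases hab; exact List.Subset.refl _
    | cons s S ih =>
      intro a b hab
      rw [List.foldlM_cons] at hab
      obtain ⟨c, hc, hcb⟩ := Option.bind_eq_some_iff.1 hab
      exact List.Subset.trans (slot s a c hc) (ih c b hcb)
  have page : ∀ (g : Page K) (a b : RecvState), readPage p T a g = some b → a.log ⊆ b.log := by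
    intro g a b hab
    obtain ⟨c, hc, hcb⟩ := Option.bind_eq_some_iff.1 hab
    refine List.Subset.trans (slots _ a c hc) ?_
    split at hcb
    · split at hcb
      · cases hcb; exact List.Subset.refl _
      · cases hcb
    · cases hcb; exact List.Subset.refl _
  have pages : ∀ (S : List (Page K)) (a b : RecvState), S.foldlM (readPage p T) a = some b →
      a.log ⊆ b.log := by
    intro S
    induction S with
    | nil => rintro a b hab; cases hab; exact List.Subset.refl _
    | cons s S ih =>
      intro a b hab
      rw [List.foldlM_cons] at hab
      obtain ⟨c, hc, hcb⟩ := Option.bind_eq_some_iff.1 hab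
      exact List.Subset.trans (page s a c hc) (ih c b hcb)
  rw [List.foldlM_append] at h
  obtain ⟨c, hc, hcb⟩ := Option.bind_eq_some_iff.1 h
  rw [edgesOf, hc]
  exact List.map_subset _ (pages _ _ _ hcb)

theorem edgesOf_eq_of_foldlM {p : Party} {T : ℕ} {d : List (Page K)} {st : RecvState}
    (h : d.foldlM (readPage p T) ⟨1, 1, [], [], []⟩ = some st) :
    edgesOf p T d = st.log.map Prod.snd := by
  rw [edgesOf, h]

/-- Prefixes of valid strings are valid. -/
theorem edgesOf_subset {p : Party} {T : ℕ} {d d' : List (Page K)} {st : RecvState}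
    (h : (d ++ d').foldlM (readPage p T) ⟨1, 1, [], [], []⟩ = some st) :
    edgesOf p T d ⊆ edgesOf p T (d ++ d') := by
  rw [edgesOf_eq_of_foldlM h]
  exact edgesOf_subset_append h

section

variable (p : Party) (L T : ℕ) (dec : List β → List (Page K)) (x : List Bool → Bool)
  (r : List β)

theorem edgesOf_sent_subset_succ (hK : 0 < K) (i : ℕ) :
    edgesOf p T (stateAfter p L T dec x r i).sent ⊆
      edgesOf p T (stateAfter p L T dec x r (i + 1)).sent := by
  obtain ⟨g, hg⟩ := exists_sent_succ p L T dec x r i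
  have h := (wf_stateAfter hK p L T dec x r (i + 1)).read
  rw [List.foldlM_append] at h
  obtain ⟨c, hc, -⟩ := Option.bind_eq_some_iff.1 h
  rw [hg] at hc ⊢
  exact edgesOf_subset hc

theorem isOwn_of_mem_edgesOf_sent (hK : 0 < K) {i : ℕ} {e : List Bool}
    (he : e ∈ edgesOf p T (stateAfter p L T dec x r i).sent) : isOwn p T x e = true := by
  have h := wf_stateAfter hK p L T dec x r i
  obtain ⟨b, hb, rfl⟩ := List.mem_map.1 (edgesOf_subset_append h.read he)
  exact h.own b (State.finalLog_subset _ hb)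

theorem edgesOf_sent_of_queue (hK : 0 < K) {i : ℕ}
    (hq : (stateAfter p L T dec x r i).queue = []) :
    edgesOf p T (stateAfter p L T dec x r i).sent =
      (stateAfter p L T dec x r i).finalLog.map Prod.snd := by
  have h := (wf_stateAfter hK p L T dec x r i).read
  rw [hq, List.append_nil] at h
  rw [edgesOf_eq_of_foldlM h]

end

end PiPrime

theorem ownerAt_eq_iff {a b : ℕ} : ownerAt a = ownerAt b ↔ a % 2 = b % 2 := by
  unfold ownerAt
  have := Nat.mod_two_eq_zero_or_one a
  have := Nat.mod_two_eq_zero_or_one b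
  split <;> split <;> simp <;> omega

/-! ### Lengths of descriptions; rounds in which no cycle begins -/

namespace PiPrime

theorem sq_add_four_le (k : ℕ) (hk : 6 ≤ k) : (k + 4) ^ 2 ≤ 2 * 2 ^ k := by
  induction k, hk using Nat.le_induction with
  | base => norm_num
  | succ k hk ih => rw [pow_succ 2 k]; nlinarith

/-- A logarithm lies below a line of slope `ε`. Numbers of at most 6 digits give at most 9 bits, and
`9 ≤ 1/(2ε)`. For larger `m` the square of the length is at most `2m`, and `√(2m) ≤ 1/(2ε) + εm` by
the inequality of the means. A bound linear in `m` is wanted because the distances `m` telescope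
along a path. -/
theorem length_description_le {ε : ℝ} (hε : 0 < ε) (hε' : ε ≤ 1 / 18) (m s : ℕ) (hm : 1 ≤ m) :
    ((description m s).length : ℝ) ≤ 1 / (2 * ε) + ε * m := by
  rw [length_description]
  have h9 : 9 ≤ 1 / (2 * ε) := by
    rw [le_div_iff₀ (by positivity)]; linarith
  have hm0 : (0 : ℝ) ≤ ε * m := by positivity
  by_cases h : m.size ≤ 6
  · have : (m.size : ℝ) ≤ 6 := by exact_mod_cast h
    push_cast
    linarith
  · obtain ⟨k, hk⟩ : ∃ k, m.size = k + 1 := ⟨m.size - 1, by omega⟩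
    have h1 : 2 ^ k ≤ m := Nat.lt_size.1 (by omega)
    have h2 := sq_add_four_le k (by omega)
    have h3 : ((k : ℝ) + 4) ^ 2 ≤ 2 * m := by
      have : (k + 4) ^ 2 ≤ 2 * m := by omega
      exact_mod_cast this
    rw [hk]
    push_cast
    have : (k : ℝ) + 4 ≤ 1 / (2 * ε) + ε * m := by
      apply le_of_sq_le_sq _ (by positivity)
      have e : 1 / (2 * ε) * (ε * m) = m / 2 := by field_simp
      nlinarith [sq_nonneg (1 / (2 * ε) - ε * m)]
    linarith

variable {K : ℕ} {β : Type v}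

section counts

variable (p : Party) (L T : ℕ) (dec : List β → List (Page K)) (x : List Bool → Bool)
  (r : List β)

/-- The number of rounds, among the first `i`, in which no cycle begins. -/
def nonstarts : ℕ → ℕ
  | 0 => 0
  | i + 1 => nonstarts i + if (stateAfter p L T dec x r i).queue.isEmpty then 0 else 1

/-- In round `i + 1` a cycle begins and an edge of the path to `z` is chosen that is not yet
sent. -/
def Active (z : List Bool) (i : ℕ) : Prop :=
  (stateAfter p L T dec x r i).queue = [] ∧
    ∃ e, chosen p T x (dec (heard p r (i + 1))) (stateAfter p L T dec x r i).finalLog = some e ∧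
      e <+: z ∧ e ∉ (stateAfter p L T dec x r i).finalLog.map Prod.snd

open Classical in
/-- The number of active rounds among the first `i`. -/
noncomputable def actives (z : List Bool) : ℕ → ℕ
  | 0 => 0
  | i + 1 => actives z i + if Active p L T dec x r z i then 1 else 0

end counts

theorem length_pages_le (hK : 0 < K) (t : List Entry) :
    K * ((pages K t).length - 1) ≤ t.length := by
  have h1 := Nat.mul_div_le (t.length + K - 1) K
  simp only [pages, List.length_map, List.length_range]
  rcases le_total ((t.length + K - 1) / K) 1 with h | h
  · rw [max_eq_left h]; simp
  · rw [max_eq_right h, Nat.mul_sub, mul_one]; omega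

/-- A cycle brings in at most `L` live points, and each edge of its table spends one. Entries at 0
have been removed and a new entry has `L > 0`, so the truncated subtraction really takes a point
away. -/
theorem sum_live_nextTable_le {L : ℕ} (hL : 0 < L) (i : ℕ) (log : List (ℕ × List Bool))
    (t : List Entry) (ht : ∀ a ∈ t, a.live ≠ 0) (hn : (t.map Entry.edge).Nodup)
    (o : Option (List Bool)) :
    ((nextTable L i log t o).map Entry.live).sum + (nextTable L i log t o).length ≤
      (t.map Entry.live).sum + L := by
  have key : ∀ s : List Entry, (∀ a ∈ s, a.live ≠ 0) → (s.map Entry.edge).Nodup →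
      ((s.map (Entry.next L o)).map Entry.live).sum + s.length ≤ (s.map Entry.live).sum +
        (if ∃ a ∈ s, o = some a.edge then L else 0) := by
    intro s
    induction s with
    | nil => intro _ _; simp
    | cons a s ih =>
      intro hs hn
      have h1 := hs a (by simp)
      rw [List.map_cons, List.nodup_cons] at hn
      have := ih (fun b hb => hs b (List.mem_cons_of_mem _ hb)) hn.2
      simp only [List.map_cons, List.sum_cons, List.length_cons]
      by_cases ho : o = some a.edge
      · have h2 : ¬ ∃ b ∈ s, o = some b.edge := by
          rintro ⟨b, hb, hb'⟩
          rw [ho] at hb'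
          exact hn.1 (List.mem_map.2 ⟨b, hb, (Option.some.inj hb').symm⟩)
        rw [if_neg h2] at this
        rw [if_pos ⟨a, by simp, ho⟩]
        simp only [Entry.next, if_pos ho] at this ⊢
        omega
      · have h2 : (∃ b ∈ a :: s, o = some b.edge) ↔ ∃ b ∈ s, o = some b.edge := by
          simp [ho]
        simp only [h2]
        simp only [Entry.next, if_neg ho] at this ⊢
        omega
  obtain ⟨new, h, hnew⟩ := nextTable_eq L i log t o
  have := key t ht hn
  rw [h]
  simp only [List.map_append, List.sum_append, List.length_append, List.length_map]
  rcases hnew with ⟨rfl, -⟩ | ⟨e, rfl, he, rfl⟩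
  · split at this <;> simp [-List.map_map] <;> omega
  · rw [if_neg] at this
    · simp [Entry.advance, newEntry_eq, -List.map_map]
      omega
    · rintro ⟨a, ha, hae⟩
      exact he a ha (Option.some.inj hae).symm

/-- Every page of a cycle beyond the first is paid for in advance with `K` of the live points spent
at the start of the cycle. Pages still in the queue are therefore counted together with the rounds
already used. -/
theorem nonstarts_invariant (hK : 0 < K) {L : ℕ} (hL : 0 < L) (p : Party) (T : ℕ)
    (dec : List β → List (Page K)) (x : List Bool → Bool) (r : List β) (i : ℕ) :
    K * (nonstarts p L T dec x r i + (stateAfter p L T dec x r i).queue.length) +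
      ((stateAfter p L T dec x r i).table.map Entry.live).sum ≤ L * i := by
  induction i with
  | zero => simp [nonstarts, stateAfter]
  | succ i ih =>
    have hs := wf_stateAfter hK p L T dec x r i
    obtain ⟨g, hg, -⟩ := sent_sendPage (queue_stateBefore_ne_nil p L T dec x r i)
    have hl := congrArg List.length hg
    have htab : ∀ st : State K, (sendPage st).table = st.table := by
      rintro ⟨t, _ | _, l, s⟩ <;> rfl
    rw [nonstarts, stateAfter_succ, htab]
    rw [List.length_cons] at hl
    by_cases hq : (stateAfter p L T dec x r i).queue.isEmpty
    · rw [if_pos hq]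
      have hq' : (stateAfter p L T dec x r i).queue = [] := by simpa using hq
      rw [hq', List.length_nil] at ih
      rw [stateBefore, if_pos hq] at hl ⊢
      rw [update_eq] at hl ⊢
      generalize chosen p T x (dec (heard p r (i + 1))) (stateAfter p L T dec x r i).finalLog = o
        at hl ⊢
      have h1 := sum_live_nextTable_le hL (i + 1) (stateAfter p L T dec x r i).finalLog
        ((stateAfter p L T dec x r i).table.filter Entry.alive)
        (fun a ha => (mem_filter_alive.1 ha).2.2) (hs.nodup.sublist (List.filter_sublist.map _)) o
      have h2 : (((stateAfter p L T dec x r i).table.filter Entry.alive).map Entry.live).sum ≤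
          ((stateAfter p L T dec x r i).table.map Entry.live).sum :=
        (List.filter_sublist.map _).sum_le_sum (by simp)
      have h3 := length_pages_le hK (nextTable L (i + 1) (stateAfter p L T dec x r i).finalLog
        ((stateAfter p L T dec x r i).table.filter Entry.alive) o)
      simp only at hl ⊢
      rw [hl, Nat.add_sub_cancel] at h3
      simp only [Nat.mul_add, mul_one, add_zero] at ih ⊢
      omega
    · rw [if_neg hq]
      rw [stateBefore, if_neg hq] at hl ⊢
      rw [hl] at ih
      rw [mul_add L, mul_one]
      have : nonstarts p L T dec x r i + 1 + (sendPage (stateAfter p L T dec x r i)).queue.length =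
        nonstarts p L T dec x r i + ((sendPage (stateAfter p L T dec x r i)).queue.length + 1) := by
          omega
      rw [this]
      omega

theorem nonstarts_le (hK : 0 < K) {L : ℕ} (hL : 0 < L) (p : Party) (T : ℕ)
    (dec : List β → List (Page K)) (x : List Bool → Bool) (r : List β) (i : ℕ) :
    K * nonstarts p L T dec x r i ≤ L * i := by
  have := nonstarts_invariant hK hL p T dec x r i
  rw [Nat.mul_add] at this
  omega

end PiPrime

/-! ### Active rounds are few -/

namespace PiPrime

variable {K : ℕ} {β : Type v}

/-- Bookkeeping of the active rounds: `k` is the depth of the next edge of the path to `z` that the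
party has to send, `n` the round to which this edge is linked; `G₁` active rounds have been wasted
on edges that left the table, in `C₁` cycles, `G₂` on edges that were sent, and `g` on the present
entry, which has been sent for `s` cycles. -/
structure Progress (p : Party) (L T : ℕ) (ε : ℝ) (z : List Bool) (st : State K) (i A k n G₁ C₁ G₂ g
    s : ℕ) :
    Prop where
  one_le : 1 ≤ k
  le_add_two : k ≤ T + 2
  owner : ownerAt (k - 1) = p
  link_eq : k ≤ T → link st.finalLog (z.take k) = n
  le_round : n ≤ i
  lower : ∀ j, 1 ≤ j → j < k → ownerAt (j - 1) = p → z.take j ∈ st.finalLog.map Prod.snd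
  upper : ∀ j, k ≤ j → j ≤ T → ownerAt (j - 1) = p → z.take j ∉ st.finalLog.map Prod.snd
  le_sum : A ≤ G₁ + G₂ + g
  wasted : L * G₁ ≤ C₁
  cycles : C₁ + s ≤ i
  useful : (G₂ : ℝ) ≤ ((k - 1) / 2 : ℕ) * (1 / (2 * ε)) + ε * n
  entry : (g = 0 ∧ s = 0 ∧ (k ≤ T → ∀ a ∈ st.table, a.edge ≠ z.take k)) ∨
    (k ≤ T ∧ ∃ a ∈ st.table, a.edge = z.take k ∧ s = a.sent ∧ g * L ≤ a.live + a.sent ∧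
      g ≤ a.sent)

theorem dropLast_dropLast_take {z : List Bool} {k : ℕ} (hk : k ≤ z.length) :
    (z.take k).dropLast.dropLast = z.take (k - 2) := by
  rw [List.dropLast_eq_take, List.dropLast_eq_take, List.take_take, List.take_take,
    List.length_take, List.length_take]
  congr 1
  omega

theorem linkable_take_iff {z : List Bool} {k : ℕ} (hk : k ≤ z.length) {log : List (ℕ × List Bool)} :
    Linkable log (z.take k) ↔ k ≤ 2 ∨ z.take (k - 2) ∈ log.map Prod.snd := by
  rw [Linkable, dropLast_dropLast_take hk, List.length_take, min_eq_left hk]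

theorem ownerAt_cases {p : Party} {k j : ℕ} (hk : ownerAt (k - 1) = p) (hj : ownerAt (j - 1) = p)
    (hk1 : 1 ≤ k) (h : k ≤ j) : j = k ∨ k + 2 ≤ j := by
  have := ownerAt_eq_iff.1 (hk.trans hj.symm)
  omega

variable {p : Party} {L T : ℕ} {ε : ℝ} {x : List Bool → Bool} {z : List Bool} {st : State K}
  {i A k n G₁ C₁ G₂ g s : ℕ}

theorem Progress.congr_state (h : Progress p L T ε z st i A k n G₁ C₁ G₂ g s) {st' : State K}
    (h1 : st'.table = st.table) (h2 : st'.log = st.log) {i' : ℕ} (hi : i ≤ i') :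
    Progress p L T ε z st' i' A k n G₁ C₁ G₂ g s := by
  have h3 : st'.finalLog = st.finalLog := by rw [State.finalLog, State.finalLog, h1, h2]
  obtain ⟨a1, a2, a3, a4, a5, a6, a7, a8, a9, a10, a11, a12⟩ := h
  exact ⟨a1, a2, a3, h3 ▸ a4, a5.trans hi, h3 ▸ a6, h3 ▸ a7, a8, a9, a10.trans hi, a11, h1 ▸ a12⟩

theorem Progress.linkable (h : Progress p L T ε z st i A k n G₁ C₁ G₂ g s) (hz : z.length = T)
    (hk : k ≤ T) : Linkable st.finalLog (z.take k) := by
  rw [linkable_take_iff (by omega)]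
  by_cases h2 : k ≤ 2
  · exact Or.inl h2
  · refine Or.inr (h.lower _ (by omega) (by omega) ?_)
    rw [← h.owner, ownerAt_eq_iff]
    omega

/-- The only edge of the path that can be chosen and is not yet sent. -/
theorem Progress.eq_of_linkable (h : Progress p L T ε z st i A k n G₁ C₁ G₂ g s) (hz : z.length = T)
    {j : ℕ} (hj : 1 ≤ j) (hjT : j ≤ T) (hown : ownerAt (j - 1) = p)
    (hl : Linkable st.finalLog (z.take j)) (hn : z.take j ∉ st.finalLog.map Prod.snd) : j = k := by
  have hkj : k ≤ j := by
    by_contra hc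
    exact hn (h.lower j hj (by omega) hown)
  rcases ownerAt_cases h.owner hown h.one_le hkj with h' | h'
  · exact h'
  · rw [linkable_take_iff (by omega)] at hl
    have := h.one_le
    exact absurd (hl.resolve_left (by omega))
      (h.upper (j - 2) (by omega) (by omega) (by rw [← hown, ownerAt_eq_iff]; omega))

/-- The next cycle, before it is checked whether the edge has been sent. -/
theorem Progress.next (hL : 0 < L) (h : Progress p L T ε z st i A k n G₁ C₁ G₂ g s)
    (hw : st.Wf p T x i) (o : Option (List Bool)) (hk : k ≤ T) :
    ∃ G₁' C₁' g' s', A + (if o = some (z.take k) then 1 else 0) ≤ G₁' + G₂ + g' ∧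
      L * G₁' ≤ C₁' ∧ C₁' + s' ≤ i + 1 ∧
      ((g' = 0 ∧ s' = 0 ∧ ∀ a ∈ nextTable L (i + 1) st.finalLog (st.table.filter Entry.alive) o,
          a.edge ≠ z.take k) ∨
        ∃ a ∈ nextTable L (i + 1) st.finalLog (st.table.filter Entry.alive) o,
          a.edge = z.take k ∧ s' = a.sent ∧ g' * L ≤ a.live + a.sent ∧ g' ≤ a.sent) := by
  obtain ⟨new, ht, hnew⟩ := nextTable_eq L (i + 1) st.finalLog (st.table.filter Entry.alive) o
  rw [ht]
  have hsum := h.le_sum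
  have hwa := h.wasted
  have hcy := h.cycles
  -- the case that no entry for the edge remains in the table
  have key : ∀ G C, A ≤ G + G₂ → L * G ≤ C → C ≤ i →
      (∀ a ∈ st.table.filter Entry.alive, a.edge ≠ z.take k) →
      ∃ G₁' C₁' g' s', A + (if o = some (z.take k) then 1 else 0) ≤ G₁' + G₂ + g' ∧
      L * G₁' ≤ C₁' ∧ C₁' + s' ≤ i + 1 ∧
      ((g' = 0 ∧ s' = 0 ∧ ∀ a ∈ (st.table.filter Entry.alive).map (Entry.next L o) ++ new,
          a.edge ≠ z.take k) ∨
        ∃ a ∈ (st.table.filter Entry.alive).map (Entry.next L o) ++ new,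
          a.edge = z.take k ∧ s' = a.sent ∧ g' * L ≤ a.live + a.sent ∧ g' ≤ a.sent) := by
    intro G C hA hG hC hno
    by_cases ho : o = some (z.take k)
    · rcases hnew with ⟨-, h0⟩ | ⟨e, he, -, rfl⟩
      · obtain ⟨a, ha, hae⟩ := h0 _ ho
        exact absurd hae (hno a ha)
      · obtain rfl : e = z.take k := Option.some.inj (he.symm.trans ho)
        refine ⟨G, C, 1, 1, by rw [if_pos ho]; omega, hG, by omega, Or.inr ⟨_,
          List.mem_append_right _ (List.mem_singleton_self _), rfl, rfl, ?_, le_rfl⟩⟩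
        simp [Entry.advance, newEntry_eq]
        omega
    · refine ⟨G, C, 0, 0, by rw [if_neg ho]; omega, hG, by omega, Or.inl ⟨rfl, rfl, ?_⟩⟩
      intro a ha
      rcases List.mem_append.1 ha with ha | ha
      · obtain ⟨b, hb, rfl⟩ := List.mem_map.1 ha
        exact hno b hb
      · rcases hnew with ⟨rfl, -⟩ | ⟨e, he, -, rfl⟩
        · simp at ha
        · obtain rfl := List.mem_singleton.1 ha
          rintro rfl
          exact ho he
  rcases h.entry with ⟨hg, hs, hno⟩ | ⟨-, a, ha, hae, hs, hgL, hga⟩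
  · exact key G₁ C₁ (by omega) hwa (by omega)
      fun a ha => hno hk a (mem_filter_alive.1 ha).1
  · have hnd : a.sent ≠ a.desc.length := by
      intro hd
      refine h.upper k le_rfl hk h.owner ?_
      rw [State.finalLog, List.map_append]
      exact List.mem_append_right _ (List.mem_map.2 ⟨a.record,
        List.mem_map.2 ⟨a, mem_filter_done.2 ⟨ha, hd⟩, rfl⟩, hae⟩)
    -- With no live points left, the invariant `g * L ≤ live + sent` says that the entry has used at
    -- least `L` cycles per grant: its grants pass to `G₁` and its cycles to `C₁`.
    by_cases hl : a.live = 0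
    · refine key (G₁ + g) (C₁ + s) (by omega) ?_ hcy ?_
      · rw [mul_add, mul_comm L g]; omega
      · intro b hb hbe
        obtain ⟨hb1, -, hb2⟩ := mem_filter_alive.1 hb
        have := List.inj_on_of_nodup_map hw.nodup hb1 ha (hbe.trans hae.symm)
        exact hb2 (this ▸ hl)
    · have hmem : a.next L o ∈ (st.table.filter Entry.alive).map (Entry.next L o) ++ new :=
        List.mem_append_left _ (List.mem_map.2 ⟨a, mem_filter_alive.2 ⟨ha, hnd, hl⟩, rfl⟩)
      by_cases ho : o = some (z.take k)
      · refine ⟨G₁, C₁, g + 1, a.sent + 1, by rw [if_pos ho]; omega, hwa, by omega,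
          Or.inr ⟨_, hmem, hae, rfl, ?_, by simp only [Entry.next]; omega⟩⟩
        simp only [Entry.next, hae, if_pos ho, add_mul]
        omega
      · refine ⟨G₁, C₁, g, a.sent + 1, by rw [if_neg ho]; omega, hwa, by omega,
          Or.inr ⟨_, hmem, hae, rfl, ?_, by simp only [Entry.next]; omega⟩⟩
        simp only [Entry.next, hae, if_neg ho]
        omega

/-- At any time only one unsent edge of the path can be chosen, the one of depth `k`, since all
deeper ones lack a sent grandparent. So every active round is a grant to this edge. If the cycle
completes it, its grants pass to `G₂` and `k` advances by 2; otherwise they stay with the entry or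
are wasted. -/
theorem Progress.update (hε : 0 < ε) (hε' : ε ≤ 1 / 18) (hK : 0 < K) (hL : 0 < L)
    (h : Progress p L T ε z st i A k n G₁ C₁ G₂ g s)
    (hz : z.length = T) (hw : st.Wf p T x i) (hq : st.queue = []) (hs : st.sent.length = i)
    (d : List (Page K)) {A' : ℕ}
    (hA : A' ≤ A + 1) (hA' : A' ≤ A ∨
      ∃ e, chosen p T x d st.finalLog = some e ∧ e <+: z ∧ e ∉ st.finalLog.map Prod.snd) :
    ∃ k n G₁ C₁ G₂ g s, Progress p L T ε z (update p L T (i + 1) x d st) (i + 1) A'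
      k n G₁ C₁ G₂ g s := by
  have hw' := hw.update (L := L) hK hq hs d
  rw [update_eq] at hw' ⊢
  have hfin : ∀ (t : List Entry) (q : List (Page K)) (l : List (List Bool)),
      (State.mk t q st.finalLog st.sent).finalLog =
        st.finalLog ++ (t.filter Entry.done).map Entry.record := fun _ _ _ => rfl
  set st' : State K := ⟨nextTable L (i + 1) st.finalLog (st.table.filter Entry.alive)
    (chosen p T x d st.finalLog), pages K (nextTable L (i + 1) st.finalLog
      (st.table.filter Entry.alive) (chosen p T x d st.finalLog)), st.finalLog, st.sent⟩ with hst'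
  have hlog' : st'.finalLog = st.finalLog ++ (st'.table.filter Entry.done).map Entry.record := rfl
  have hsub : st.finalLog.map Prod.snd ⊆ st'.finalLog.map Prod.snd := by
    rw [hlog', List.map_append]
    exact List.subset_append_left _ _
  have hk1 := h.one_le
  have hk2 := h.le_add_two
  have hact : ∀ e, chosen p T x d st.finalLog = some e → e <+: z →
      e ∉ st.finalLog.map Prod.snd → e.length = k ∧ e.length ≤ T ∧ e = z.take k := by
    intro e he hez hne
    obtain ⟨ho, hl⟩ := chosen_spec he
    obtain ⟨h0, hT, hown, -⟩ := isOwn_iff.1 ho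
    have e1 : e = z.take e.length := List.prefix_iff_eq_take.1 hez
    have := h.eq_of_linkable hz (List.length_pos_iff.2 h0) hT hown (e1 ▸ hl) (e1 ▸ hne)
    exact ⟨this, hT, this ▸ e1⟩
  rcases lt_or_ge T k with hkT | hkT
  · -- all edges have been sent
    have hnot : A' ≤ A := by
      refine hA'.resolve_right ?_
      rintro ⟨e, h1, he, hne⟩
      obtain ⟨h2, h3, -⟩ := hact e h1 he hne
      omega
    exact ⟨k, n, G₁, C₁, G₂, g, s, hk1, hk2, h.owner, fun h => by omega, h.le_round.trans (by
        omega),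
      fun j h1 h2 h3 => hsub (h.lower j h1 h2 h3), fun j h1 h2 => by omega,
      hnot.trans h.le_sum, h.wasted, h.cycles.trans (by omega), h.useful, by
        rcases h.entry with ⟨h1, h2, -⟩ | ⟨h1, -⟩
        · exact Or.inl ⟨h1, h2, fun h => by omega⟩
        · omega⟩
  have hcount : A' ≤ A + if chosen p T x d st.finalLog = some (z.take k) then 1 else 0 := by
    split
    · exact hA
    · next hne =>
      refine hA'.resolve_right ?_
      rintro ⟨e, h1, he, hne'⟩
      exact hne (h1.trans (congrArg some (hact e h1 he hne').2.2))
  obtain ⟨G₁', C₁', g', s', hsum, hwa, hcy, hent⟩ := h.next hL hw (chosen p T x d st.finalLog) hkT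
  -- no deeper edge of the path is in the table
  have hdeep : ∀ j, k + 2 ≤ j → j ≤ T → ownerAt (j - 1) = p → ∀ a ∈ st'.table,
      a.edge ≠ z.take j := by
    intro j hj hjT hown a ha hae
    have := hw'.linkable a.record (List.mem_append_right _ (List.mem_map.2 ⟨a, ha, rfl⟩))
    change Linkable st.finalLog a.edge at this
    rw [hae, linkable_take_iff (by omega)] at this
    exact h.upper (j - 2) (by omega) (by omega) (by rw [← hown, ownerAt_eq_iff]; omega)
      (this.resolve_left (by omega))
  have hupper : ∀ j, k ≤ j → j ≤ T → ownerAt (j - 1) = p →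
      (∀ a ∈ st'.table, a.edge = z.take j → a.sent ≠ a.desc.length) →
      z.take j ∉ st'.finalLog.map Prod.snd := by
    intro j hj hjT hown hnd hmem
    rw [hlog', List.map_append] at hmem
    rcases List.mem_append.1 hmem with hmem | hmem
    · exact h.upper j hj hjT hown hmem
    · obtain ⟨b, hb, hbe⟩ := List.mem_map.1 hmem
      obtain ⟨a, ha, rfl⟩ := List.mem_map.1 hb
      obtain ⟨h1, h2⟩ := mem_filter_done.1 ha
      exact hnd a h1 hbe h2
  have hlk := h.linkable hz hkT
  by_cases hdone : ∃ a ∈ st'.table, a.edge = z.take k ∧ a.sent = a.desc.length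
  · obtain ⟨a, ha, hae, had⟩ := hdone
    have hrec : a.record ∈ (st'.table.filter Entry.done).map Entry.record :=
      List.mem_map.2 ⟨a, mem_filter_done.2 ⟨ha, had⟩, rfl⟩
    have hst : a.start ≤ i + 1 :=
      (hw'.start_le a.record (List.mem_append_right _ (List.mem_map.2 ⟨a, ha, rfl⟩))).2
    have hdesc := hw'.desc a ha
    change a.desc = description (a.start - link st.finalLog a.edge) _ ∧
      link st.finalLog a.edge < a.start at hdesc
    rw [hae, h.link_eq hkT] at hdesc
    have hga : g' ≤ a.sent := by
      rcases hent with ⟨h0, -⟩ | ⟨b, hb, hbe, -, -, hgb⟩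
      · omega
      · rw [← List.inj_on_of_nodup_map hw'.nodup hb ha (hbe.trans hae.symm)]
        exact hgb
    refine ⟨k + 2, a.start, G₁', C₁', G₂ + g', 0, 0, by omega, by omega,
      by rw [← h.owner, ownerAt_eq_iff]; omega, ?_, hst, ?_, ?_, by omega, hwa, by omega, ?_,
      Or.inl ⟨rfl, rfl, fun hkT' => hdeep _ le_rfl hkT' (by rw [← h.owner, ownerAt_eq_iff]; omega)⟩⟩
    · intro hkT'
      have hlk' : Linkable st'.finalLog (z.take (k + 2)) := by
        rw [linkable_take_iff (by omega), Nat.add_sub_cancel, hlog', List.map_append]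
        exact Or.inr (List.mem_append_right _ (List.mem_map.2 ⟨_, hrec, hae⟩))
      -- The edge of depth `k` was not in the old log, so its first transmission is the one just
      -- completed, and the next link is `a.start`.
      obtain ⟨b, -, hb, hbe, hb'⟩ := hlk'.find? (by rw [List.length_take]; omega)
      rw [dropLast_dropLast_take (by omega), Nat.add_sub_cancel] at hbe
      rw [hlog'] at hb
      rcases List.mem_append.1 hb with hb | hb
      · exact absurd (List.mem_map.2 ⟨b, hb, hbe⟩) (h.upper k le_rfl hkT h.owner)
      · obtain ⟨c, hc, rfl⟩ := List.mem_map.1 hb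
        rw [hb', List.inj_on_of_nodup_map hw'.nodup (mem_filter_done.1 hc).1 ha
          (Eq.trans hbe hae.symm)]
        rfl
    · intro j h1 h2 hown
      rcases lt_or_ge j k with hj | hj
      · exact hsub (h.lower j h1 hj hown)
      · rcases ownerAt_cases h.owner hown hk1 hj with rfl | hj
        · rw [hlog', List.map_append]
          exact List.mem_append_right _ (List.mem_map.2 ⟨_, hrec, hae⟩)
        · omega
    · exact fun j h1 h2 h3 => hupper j (by omega) h2 h3
        fun b hb hbe => absurd hbe (hdeep j h1 h2 h3 b hb)
    -- An entry receives at most one grant per bit, so `g'` is at most the length of the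
    -- description. The term `ε (a.start - n)` turns `ε n` into `ε a.start`: this is the
    -- telescoping.
    · have h1 := length_description_le hε hε' (a.start - n) (childIndex (z.take k)) (by omega)
      rw [← hdesc.1, ← had, Nat.cast_sub hdesc.2.le] at h1
      have h2 : (g' : ℝ) ≤ a.sent := by exact_mod_cast hga
      have h3 : (k + 2 - 1) / 2 = (k - 1) / 2 + 1 := by omega
      have := h.useful
      rw [h3]
      push_cast
      linarith
  · have hnd : ∀ a ∈ st'.table, a.edge = z.take k → a.sent ≠ a.desc.length :=
      fun a ha hae had => hdone ⟨a, ha, hae, had⟩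
    refine ⟨k, n, G₁', C₁', G₂, g', s', hk1, hk2, h.owner, ?_, h.le_round.trans (by omega),
      fun j h1 h2 h3 => hsub (h.lower j h1 h2 h3), ?_, by omega, hwa, hcy, h.useful, ?_⟩
    · intro _
      rw [hlog', hlk.link_append]
      exact h.link_eq hkT
    · intro j h1 h2 h3
      rcases ownerAt_cases h.owner h3 hk1 h1 with rfl | hj
      · exact hupper j le_rfl h2 h3 hnd
      · exact hupper j h1 h2 h3 fun b hb hbe => absurd hbe (hdeep j hj h2 h3 b hb)
    · rcases hent with ⟨h1, h2, h3⟩ | hent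
      · exact Or.inl ⟨h1, h2, fun _ => h3⟩
      · exact Or.inr ⟨hkT, hent⟩

open Classical in
theorem exists_progress (hε : 0 < ε) (hε' : ε ≤ 1 / 18) (hK : 0 < K) (hL : 0 < L)
    (hz : z.length = T) (dec : List β → List (Page K)) (r : List β) (i : ℕ) :
    ∃ k n G₁ C₁ G₂ g s, Progress p L T ε z (stateAfter p L T dec x r i) i
      (actives p L T dec x r z i) k n G₁ C₁ G₂ g s := by
  have hsend : ∀ st : State K, (sendPage st).table = st.table ∧ (sendPage st).log = st.log := by
    rintro ⟨t, _ | _, l, s⟩ <;> exact ⟨rfl, rfl⟩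
  induction i with
  | zero =>
    have h0 : ∀ k ≤ 2, ownerAt (k - 1) = p → 1 ≤ k → (∀ j, 1 ≤ j → j < k → ownerAt (j - 1) ≠ p) →
        Progress p L T ε z (stateAfter p L T dec x r 0) 0 (actives p L T dec x r z 0)
          k 0 0 0 0 0 0 := fun k hk hown hk1 hlow =>
      ⟨hk1, by omega, hown, fun h => by rw [link, if_pos (by rw [List.length_take]; omega)], le_rfl,
        fun j h1 h2 h3 => absurd h3 (hlow j h1 h2), by simp [State.finalLog, stateAfter],
        by simp [actives], by simp, by simp, by simp; positivity,
        Or.inl ⟨rfl, rfl, by simp [stateAfter]⟩⟩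
    cases p with
    | alice => exact ⟨1, 0, 0, 0, 0, 0, 0, h0 1 (by omega) rfl le_rfl (by omega)⟩
    | bob =>
      refine ⟨2, 0, 0, 0, 0, 0, 0, h0 2 (by omega) rfl (by omega) fun j h1 h2 => ?_⟩
      obtain rfl : j = 1 := by omega
      decide
  | succ i ih =>
    obtain ⟨k, n, G₁, C₁, G₂, g, s, h⟩ := ih
    rw [stateAfter_succ, actives]
    by_cases hq : (stateAfter p L T dec x r i).queue = []
    · obtain ⟨k, n, G₁, C₁, G₂, g, s, h'⟩ := h.update hε hε' hK hL hz (wf_stateAfter hK _ _ _ _ _ _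
        _)
        hq (length_sent _ _ _ _ _ _ _) (dec (heard p r (i + 1)))
        (A' := actives p L T dec x r z i + if Active p L T dec x r z i then 1 else 0)
        (by split <;> omega) (by
          by_cases ha : Active p L T dec x r z i
          · exact Or.inr ha.2
          · rw [if_neg ha]; exact Or.inl le_rfl)
      rw [stateBefore, if_pos (by rw [hq]; rfl)]
      exact ⟨k, n, G₁, C₁, G₂, g, s, h'.congr_state (hsend _).1 (hsend _).2 le_rfl⟩
    · rw [stateBefore, if_neg (by simpa using hq), if_neg (fun ha => hq ha.1), add_zero]
      exact ⟨k, n, G₁, C₁, G₂, g, s, h.congr_state (hsend _).1 (hsend _).2 (Nat.le_succ i)⟩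

/-- The three terms are the grants to edges that died (at most one per `L` cycles), a constant for
each description, and the telescoped distances between links. -/
theorem actives_le (hε : 0 < ε) (hε' : ε ≤ 1 / 18) (hK : 0 < K) (hL : 0 < L)
    (hT : 1 ≤ T) (hz : z.length = T) (dec : List β → List (Page K)) (r : List β) (i : ℕ) :
    (actives p L T dec x r z i : ℝ) ≤ i / L + T * (1 / (2 * ε)) + ε * i := by
  obtain ⟨k, n, G₁, C₁, G₂, g, s, h⟩ := exists_progress (p := p) (x := x) hε hε' hK hL hz dec r i
  have hw := wf_stateAfter hK p L T dec x r i
  have h1 : (actives p L T dec x r z i : ℝ) ≤ G₁ + G₂ + g := by exact_mod_cast h.le_sum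
  have h2 : (G₁ : ℝ) ≤ i / L := by
    rw [le_div_iff₀ (by exact_mod_cast hL), mul_comm]
    have := h.wasted
    have := h.cycles
    exact_mod_cast (by omega : L * G₁ ≤ i)
  have h3 := h.useful
  have hpos : 0 < 1 / (2 * ε) := by positivity
  have hk1 := h.one_le
  have hk2 := h.le_add_two
  have key : ∀ D : ℕ, D ≤ T → (G₂ + g : ℝ) ≤ D * (1 / (2 * ε)) + ε * i →
      (actives p L T dec x r z i : ℝ) ≤ i / L + T * (1 / (2 * ε)) + ε * i := by
    intro D hD hG
    have : (D : ℝ) ≤ T := by exact_mod_cast hD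
    nlinarith
  rcases h.entry with ⟨rfl, -, -⟩ | ⟨hkT, a, ha, hae, -, -, hg⟩
  · refine key ((k - 1) / 2) (by omega) ?_
    have : (n : ℝ) ≤ i := by exact_mod_cast h.le_round
    rw [Nat.cast_zero]
    nlinarith
  -- The entry still in transmission is counted as one more complete description.
  · refine key ((k - 1) / 2 + 1) (by omega) ?_
    have hd := hw.desc a ha
    have hlink : link (stateAfter p L T dec x r i).log a.edge = n := by
      rw [← h.link_eq hkT, ← hae]
      exact ((hw.linkable a.record
        (List.mem_append_right _ (List.mem_map.2 ⟨a, ha, rfl⟩))).link_append _).symm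
    rw [hlink] at hd
    have h4 := length_description_le hε hε' (a.start - n) (childIndex a.edge) (by omega)
    rw [← hd.1, Nat.cast_sub hd.2.le] at h4
    have h5 : (g : ℝ) ≤ a.desc.length := by exact_mod_cast hg.trans (hw.sent_le a ha).2
    have h6 : (a.start : ℝ) ≤ i := by
      exact_mod_cast (hw.start_le a.record
        (List.mem_append_right _ (List.mem_map.2 ⟨a, ha, rfl⟩))).2
    push_cast
    nlinarith

end PiPrime

/-! ### The correct path, and what a party does after a correct decoding -/

theorem Party.other_ne (p : Party) : p.other ≠ p := by cases p <;> decide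

theorem Party.eq_other_of_ne {p q : Party} (h : q ≠ p) : q = p.other := by
  revert h; cases p <;> cases q <;> decide

@[simp] theorem Party.other_other (p : Party) : p.other.other = p := by cases p <;> rfl

namespace PiPrime

variable {K : ℕ} {β : Type v}

/-- `z` is the root-to-leaf path defined by the inputs. -/
structure IsPath (T : ℕ) (inp : (p : Party) → PJPInput p) (z : List Bool) : Prop where
  length_eq : z.length = T
  take_succ : ∀ k < T, z.take (k + 1) = z.take k ++ [inp (ownerAt k) (z.take k)]

theorem isPath_transcript (T : ℕ) (inp : (p : Party) → PJPInput p) :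
    IsPath T inp ((pjp T).transcript inp) := by
  have hsucc : ∀ k, (pjp T).run inp (k + 1) = (pjp T).run inp k ++
      [inp (ownerAt ((pjp T).run inp k).length) ((pjp T).run inp k)] := fun _ => rfl
  have hlen : ∀ k, ((pjp T).run inp k).length = k := by
    intro k
    induction k with
    | zero => rfl
    | succ k ih => rw [hsucc, List.length_append, ih]; rfl
  have htake : ∀ m k, ((pjp T).run inp (k + m)).take k = (pjp T).run inp k := by
    intro m k
    induction m with
    | zero => exact List.take_of_length_le (by rw [hlen]; rfl)
    | succ m ih =>
      rw [← add_assoc, hsucc, List.take_append_of_le_length (by rw [hlen]; omega), ih]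
  have htake' : ∀ k ≤ T, ((pjp T).transcript inp).take k = (pjp T).run inp k := by
    intro k hk
    have := htake (T - k) k
    rwa [Nat.add_sub_cancel' hk] at this
  refine ⟨hlen T, fun k hk => ?_⟩
  rw [htake' _ hk, htake' _ hk.le, hsucc, hlen]

variable {T : ℕ} {inp : (p : Party) → PJPInput p} {z : List Bool}

theorem IsPath.length_take (hz : IsPath T inp z) {k : ℕ} (hk : k ≤ T) : (z.take k).length = k := by
  rw [List.length_take, hz.length_eq, min_eq_left hk]

theorem IsPath.isOwn (hz : IsPath T inp z) {k : ℕ} (hk : k < T) :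
    isOwn (ownerAt k) T (inp (ownerAt k)) (z.take (k + 1)) = true := by
  rw [isOwn_iff, hz.length_take hk]
  have h := hz.take_succ k hk
  refine ⟨fun h0 => ?_, hk, rfl, ?_⟩
  · have := hz.length_take hk
    rw [h0] at this
    simp at this
  · rw [h, List.dropLast_concat]

theorem IsPath.eq_of_isOwn (hz : IsPath T inp z) {k : ℕ} (hk : k < T) {b : Bool} {p : Party}
    (h : PiPrime.isOwn p T (inp p) (z.take k ++ [b]) = true) : z.take k ++ [b] = z.take (k + 1) :=
        by
  obtain ⟨-, -, h1, h2⟩ := isOwn_iff.1 h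
  rw [List.length_append, hz.length_take hk.le, List.length_singleton, Nat.add_sub_cancel] at h1
  subst h1
  rw [List.dropLast_concat] at h2
  rw [hz.take_succ k hk, ← h2]

/-- Only one edge leaving a vertex belongs to an input, so a walk along true edges cannot branch or
leave `z`; it stops at the leaf or at the first edge of `z` that is missing. -/
theorem IsPath.walk (hz : IsPath T inp z) {S : List Bool → Bool}
    (hS : ∀ e, S e = true → ∃ p, PiPrime.isOwn p T (inp p) e = true) (m : ℕ) : ∀ k, k + m = T →
    ∃ k', k' ≤ T ∧ PiPrime.walk S m (z.take k) = some (z.take k') ∧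
      (k' = T ∨ S (z.take (k' + 1)) = false) := by
  induction m with
  | zero => intro k hk; exact ⟨k, by omega, rfl, Or.inl (by omega)⟩
  | succ m ih =>
    intro k hk
    have hkT : k < T := by omega
    have hb : ∀ b, S (z.take k ++ [b]) = true → z.take k ++ [b] = z.take (k + 1) := by
      intro b hb
      obtain ⟨p, hp⟩ := hS _ hb
      exact hz.eq_of_isOwn hkT hp
    obtain ⟨k', h1, h2, h3⟩ := ih (k + 1) (by omega)
    rw [PiPrime.walk]
    cases hf : S (z.take k ++ [false]) <;> cases ht : S (z.take k ++ [true])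
    · refine ⟨k, hkT.le, rfl, Or.inr ?_⟩
      rw [hz.take_succ k hkT]
      cases inp (ownerAt k) (z.take k) <;> assumption
    · exact ⟨k', h1, by simpa only [hb _ ht] using h2, h3⟩
    · exact ⟨k', h1, by simpa only [hb _ hf] using h2, h3⟩
    · have := (hb _ hf).trans (hb _ ht).symm
      simp at this

theorem IsPath.endpoint (hz : IsPath T inp z) {p : Party} {d : List (Page K)}
    (hd : ∀ e ∈ edgesOf p.other T d, PiPrime.isOwn p.other T (inp p.other) e = true) {m : ℕ}
    (hm : m ≤ T) (h : ∀ j < m, ownerAt j = p.other → z.take (j + 1) ∈ edgesOf p.other T d) :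
    ∃ k, m ≤ k ∧ k ≤ T ∧ PiPrime.endpoint p T (inp p) d = some (z.take k) := by
  obtain ⟨k, hk, hw, hk'⟩ := hz.walk
    (S := fun e => (edgesOf p.other T d).contains e || PiPrime.isOwn p T (inp p) e)
    (fun e he => by
      rw [Bool.or_eq_true, List.contains_iff_mem] at he
      exact he.elim (fun he => ⟨_, hd e he⟩) fun he => ⟨_, he⟩) T 0 (by omega)
  refine ⟨k, ?_, hk, hw⟩
  rcases hk' with rfl | hk'
  · exact hm
  · by_contra hc
    rw [Bool.or_eq_false_iff] at hk'
    by_cases ho : ownerAt k = p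
    · have := hz.isOwn (k := k) (by omega)
      rw [ho, hk'.2] at this
      cases this
    · have := h k (by omega) (Party.eq_other_of_ne ho)
      rw [← List.contains_iff_mem, hk'.1] at this
      cases this

/-- A party that knows the path up to its first edge that is not yet sent chooses this edge. -/
theorem IsPath.chosen (hz : IsPath T inp z) {p : Party} {i : ℕ} {st : State K}
    (hw : st.Wf p T (inp p) i) {d : List (Page K)}
    (hd : ∀ e ∈ edgesOf p.other T d, PiPrime.isOwn p.other T (inp p.other) e = true) {k : ℕ}
    (hk : k < T) (hown : ownerAt k = p)
    (h : ∀ j < k, ownerAt j = p.other → z.take (j + 1) ∈ edgesOf p.other T d)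
    (h' : ∀ j < k, ownerAt j = p → z.take (j + 1) ∈ st.finalLog.map Prod.snd)
    (hnot : z.take (k + 1) ∉ st.finalLog.map Prod.snd) :
    PiPrime.chosen p T (inp p) d st.finalLog = some (z.take (k + 1)) := by
  -- An edge is logged only after its grandparent, so if the edge of depth `k + 1` is unsent, no
  -- deeper one of `p` on the path has been sent. Hence no later candidate survives the filter in
  -- `nextEdge`.
  have hdeep : ∀ j, k ≤ j → j < T → ownerAt j = p →
      z.take (j + 1) ∉ st.finalLog.map Prod.snd := by
    intro j
    induction j using Nat.strong_induction_on with
    | _ j ih =>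
      intro hkj hjT hj hmem
      rcases hkj.eq_or_lt with rfl | hlt
      · exact hnot hmem
      · have hpar := ownerAt_eq_iff.1 (hown.trans hj.symm)
        obtain ⟨b, hb, hbe⟩ := List.mem_map.1 hmem
        have hl := hw.linkable b (st.finalLog_subset hb)
        rw [hbe, linkable_take_iff (by rw [hz.length_eq]; omega)] at hl
        have := hl.resolve_left (by omega)
        rw [show j + 1 - 2 = (j - 2) + 1 by omega] at this
        refine ih (j - 2) (by omega) (by omega) (by omega) (by rw [← hj, ownerAt_eq_iff]; omega) ?_
        rw [State.finalLog, List.map_append]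
        exact List.mem_append_left _ this
  obtain ⟨m, hm, hmT, he⟩ := hz.endpoint hd (m := k + 1) hk fun j hj ho =>
    (Nat.lt_succ_iff_lt_or_eq.1 hj).elim (fun hj => h j hj ho)
      fun hj => absurd (hj ▸ ho) (by rw [hown]; exact p.other_ne.symm)
  rw [PiPrime.chosen, he, Option.bind_some, nextEdge]
  obtain ⟨t, ht⟩ : ∃ t, z.take m = z.take k ++ (inp (ownerAt k) (z.take k) :: t) := by
    refine ⟨(z.take m).drop (k + 1), ?_⟩
    rw [List.append_cons, ← hz.take_succ k hk]
    conv_lhs => rw [← List.take_append_drop (k + 1) (z.take m)]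
    rw [List.take_take, min_eq_left hm]
  have hpref : ∀ e, e <+: z.take m → e = z.take e.length := fun e he =>
    List.prefix_iff_eq_take.1 (he.trans (List.take_prefix _ _))
  have hinits : (z.take m).inits = (z.take k).inits ++
      z.take (k + 1) :: t.inits.tail.map fun u => z.take (k + 1) ++ u := by
    rw [ht, List.inits_append]
    congr 1
    rw [hz.take_succ k hk, List.inits_cons, List.tail_cons, List.map_map]
    cases t <;> simp
  have hfilt : ((t.inits.tail.map fun u => z.take (k + 1) ++ u).filter fun e =>
      PiPrime.isOwn p T (inp p) e && (decide (e.length ≤ 2) ||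
        st.finalLog.any fun a => a.2 == e.dropLast.dropLast)) = [] := by
    rw [List.filter_eq_nil_iff]
    intro e he hcond
    rw [Bool.and_eq_true] at hcond
    have hmem : e ∈ (z.take m).inits := by
      rw [hinits]; exact List.mem_append_right _ (List.mem_cons_of_mem _ he)
    have he' := hpref e ((List.mem_inits _ _).1 hmem)
    obtain ⟨h0, hT', ho, -⟩ := isOwn_iff.1 hcond.1
    have hlen : k + 1 < e.length := by
      obtain ⟨u, hu, rfl⟩ := List.mem_map.1 he
      have : u ≠ [] := by
        rintro rfl
        cases t <;> simp at hu
      have := List.length_pos_iff.2 this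
      rw [List.length_append, hz.length_take hk]
      omega
    have hpar := ownerAt_eq_iff.1 (hown.trans ho.symm)
    have hl : Linkable st.finalLog e := by
      have h3 := hcond.2
      rw [Bool.or_eq_true, decide_eq_true_eq, List.any_eq_true] at h3
      refine h3.imp_right ?_
      rintro ⟨b, hb, hbe⟩
      exact List.mem_map.2 ⟨b, hb, by simpa using hbe⟩
    rw [he', linkable_take_iff (by rw [hz.length_eq]; exact hT')] at hl
    have := hl.resolve_left (by omega)
    rw [show e.length - 2 = (e.length - 3) + 1 by omega] at this
    exact hdeep _ (by omega) (by omega) (by rw [← hown, ownerAt_eq_iff]; omega) this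
  have htrue : (PiPrime.isOwn p T (inp p) (z.take (k + 1)) && (decide ((z.take (k + 1)).length ≤ 2)
      ||
      st.finalLog.any fun a => a.2 == (z.take (k + 1)).dropLast.dropLast)) = true := by
    have := hz.isOwn hk
    rw [hown] at this
    rw [this, Bool.true_and, hz.length_take hk, Bool.or_eq_true, decide_eq_true_eq]
    by_cases h2 : k + 1 ≤ 2
    · exact Or.inl h2
    · right
      obtain ⟨b, hb, hbe⟩ := List.mem_map.1
        (h' (k - 2) (by omega) (by rw [← hown, ownerAt_eq_iff]; omega))
      rw [List.any_eq_true]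
      refine ⟨b, hb, ?_⟩
      rw [dropLast_dropLast_take (by rw [hz.length_eq]; omega), hbe, beq_iff_eq]
      congr 1
      omega
  rw [hinits, List.filter_append, List.filter_cons, if_pos htrue, hfilt, List.getLast?_concat]

section congruence

variable {p : Party} {L : ℕ} {dec : List β → List (Page K)} {x : List Bool → Bool}
  {r r' : List β} {i : ℕ}

/-- Later symbols do not affect earlier rounds; this lets one more received symbol extend all the
counts. -/
theorem stateAfter_congr (h : ∀ j < i, heard p r (j + 1) = heard p r' (j + 1)) :
    stateAfter p L T dec x r i = stateAfter p L T dec x r' i := by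
  induction i with
  | zero => rfl
  | succ i ih =>
    rw [stateAfter_succ, stateAfter_succ, stateBefore, stateBefore,
      ih fun j hj => h j (by omega), h i (Nat.lt_succ_self i)]

theorem nonstarts_congr (h : ∀ j < i, heard p r (j + 1) = heard p r' (j + 1)) :
    nonstarts p L T dec x r i = nonstarts p L T dec x r' i := by
  induction i with
  | zero => rfl
  | succ i ih =>
    have h' : ∀ j < i, heard p r (j + 1) = heard p r' (j + 1) := fun j hj => h j (by omega)
    rw [nonstarts, nonstarts, ih h', stateAfter_congr h']

theorem actives_congr (h : ∀ j < i, heard p r (j + 1) = heard p r' (j + 1)) :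
    actives p L T dec x r z i = actives p L T dec x r' z i := by
  induction i with
  | zero => rfl
  | succ i ih =>
    have h' : ∀ j < i, heard p r (j + 1) = heard p r' (j + 1) := fun j hj => h j (by omega)
    rw [actives, actives, ih h']
    have : Active p L T dec x r z i ↔ Active p L T dec x r' z i := by
      rw [Active, Active, stateAfter_congr h', h i (Nat.lt_succ_self i)]
    by_cases ha : Active p L T dec x r' z i
    · rw [if_pos ha, if_pos (this.2 ha)]
    · rw [if_neg ha, if_neg (mt this.1 ha)]

theorem heard_append (r : List β) (a : β) {j : ℕ} (hj : j < roundsOf p r.length) :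
    heard p (r ++ [a]) (j + 1) = heard p r (j + 1) := by
  cases p <;> simp only [heard, roundsOf] at * <;>
    exact List.take_append_of_le_length (by omega)

theorem heard_full (r : List β) (a : β) :
    heard p (r ++ [a]) (roundsOf p r.length + 1) = r ++ [a] := by
  cases p <;> exact List.take_of_length_le (by simp [roundsOf])

theorem roundsOf_succ (p : Party) (n : ℕ) : roundsOf p (n + 1) = roundsOf p n + 1 := by
  cases p <;> rfl

theorem votes_append (r : List β) (a : β) (v : List Bool) (hv : v.length = T) :
    votes p T dec x (r ++ [a]) v = votes p T dec x r v +
      if PiPrime.endpoint p T x (dec (r ++ [a])) = some v then 1 else 0 := by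
  unfold votes
  rw [List.length_append, List.length_singleton, roundsOf_succ, List.range_succ,
    List.filter_append, List.length_append]
  congr 1
  · congr 1
    apply List.filter_congr
    intro j hj
    rw [heard_append r a (List.mem_range.1 hj)]
  · rw [List.filter_singleton, heard_full]
    by_cases h : PiPrime.endpoint p T x (dec (r ++ [a])) = some v
    · simp [h, hv]
    · have hb : (PiPrime.endpoint p T x (dec (r ++ [a])) == some v) = false := by
        rw [Bool.eq_false_iff, ne_eq, beq_iff_eq]
        exact h
      simp [h, hb]

end congruence

end PiPrime

theorem Config.rounds_eq {β : Type v} (c : Config β) (p : Party) :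
    c.rounds p = PiPrime.roundsOf p (c.recv p).length := by
  cases p <;> rfl

theorem Config.receive_recv_self {β : Type v} (c : Config β) (p : Party) (a : β) (k : ℕ) :
    (c.receive p a k).recv p = c.recv p ++ [a] := by
  simp [Config.receive]

theorem Config.receive_recv_other {β : Type v} (c : Config β) (p : Party) (a : β) (k : ℕ) :
    (c.receive p a k).recv p.other = c.recv p.other := by
  simp [Config.receive, Function.update_of_ne p.other_ne]

theorem Config.rounds_receive_self {β : Type v} (c : Config β) (p : Party) (a : β) (k : ℕ) :
    (c.receive p a k).rounds p = c.rounds p + 1 := by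
  rw [Config.rounds_eq, Config.rounds_eq, Config.receive_recv_self, List.length_append,
    List.length_singleton, PiPrime.roundsOf_succ]

theorem Config.rounds_receive_other {β : Type v} (c : Config β) (p : Party) (a : β) (k : ℕ) :
    (c.receive p a k).rounds p.other = c.rounds p.other := by
  rw [Config.rounds_eq, Config.rounds_eq, Config.receive_recv_other]

theorem Party.eq_or_eq_other (p q : Party) : q = p ∨ q = p.other := by
  cases p <;> cases q <;> decide

/-! ### Charging the rounds that are not correct votes -/

namespace PiPrime

variable {K : ℕ} {β : Type v} (L T : ℕ) (dec : Party → List β → List (Page K))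
  (inp : (p : Party) → PJPInput p) (z : List Bool) (c : Config β)

/-- The state of a party in a state of the channel. -/
def partyState (p : Party) : State K :=
  stateAfter p L T (dec p) (inp p) (c.recv p) (c.rounds p)

/-- The edge of depth `k + 1` of the path has not yet been sent. -/
def Unsent (k : ℕ) : Prop :=
  z.take (k + 1) ∉ edgesOf (ownerAt k) T (partyState L T dec inp c (ownerAt k)).sent

/-- The edge of depth `k + 1` is the first one of the path that has not yet been sent. -/
def Pending (k : ℕ) : Prop :=
  k < T ∧ Unsent L T dec inp z c k ∧ ∀ j < k, ¬ Unsent L T dec inp z c j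

/-- The rounds of `p` in which a cycle does not begin or `p` makes progress. -/
noncomputable def excused (p : Party) : ℕ :=
  nonstarts p L T (dec p) (inp p) (c.recv p) (c.rounds p) +
    actives p L T (dec p) (inp p) (c.recv p) z (c.rounds p)

variable {L T dec inp z c}

theorem exists_pending {k : ℕ} (hk : k < T) (h : Unsent L T dec inp z c k) :
    ∃ j ≤ k, Pending L T dec inp z c j := by
  classical
  have hex : ∃ j, Unsent L T dec inp z c j := ⟨k, h⟩
  have hle : Nat.find hex ≤ k := Nat.find_le h
  exact ⟨Nat.find hex, hle, lt_of_le_of_lt hle hk, Nat.find_spec hex,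
    fun j hj => Nat.find_min hex hj⟩

section step

variable (p : Party) (a : β) (e : ℕ)

theorem heard_receive {j : ℕ} (hj : j < c.rounds p) :
    heard p ((c.receive p a e).recv p) (j + 1) = heard p (c.recv p) (j + 1) := by
  rw [Config.receive_recv_self]
  exact heard_append _ _ (by rwa [← Config.rounds_eq])

theorem heard_receive_last :
    heard p ((c.receive p a e).recv p) (c.rounds p + 1) = c.recv p ++ [a] := by
  rw [Config.receive_recv_self, Config.rounds_eq, heard_full]

theorem stateAfter_receive :
    stateAfter p L T (dec p) (inp p) ((c.receive p a e).recv p) (c.rounds p) =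
      partyState L T dec inp c p :=
  stateAfter_congr fun _ hj => heard_receive p a e hj

theorem partyState_receive_other :
    partyState L T dec inp (c.receive p a e) p.other = partyState L T dec inp c p.other := by
  rw [partyState, partyState, Config.receive_recv_other, Config.rounds_receive_other]

theorem excused_receive_other :
    excused L T dec inp z (c.receive p a e) p.other = excused L T dec inp z c p.other := by
  rw [excused, excused, Config.receive_recv_other, Config.rounds_receive_other]

open Classical in
theorem excused_receive_self :
    excused L T dec inp z (c.receive p a e) p = excused L T dec inp z c p +
      ((if (partyState L T dec inp c p).queue.isEmpty then 0 else 1) +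
      if Active p L T (dec p) (inp p) ((c.receive p a e).recv p) z (c.rounds p) then 1 else 0) := by
  have h : ∀ j < c.rounds p, _ := fun j hj => heard_receive (c := c) p a e hj
  rw [excused, excused, Config.rounds_receive_self, nonstarts, actives, stateAfter_receive,
    nonstarts_congr h, actives_congr h]
  omega

theorem exists_sent_receive : ∃ g, (partyState L T dec inp (c.receive p a e) p).sent =
    (partyState L T dec inp c p).sent ++ [g] := by
  have := exists_sent_succ p L T (dec p) (inp p) ((c.receive p a e).recv p) (c.rounds p)
  rwa [stateAfter_receive, ← Config.rounds_receive_self c p a e] at this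

theorem edgesOf_subset_receive (hK : 0 < K) : edgesOf p T (partyState L T dec inp c p).sent ⊆
    edgesOf p T (partyState L T dec inp (c.receive p a e) p).sent := by
  have := edgesOf_sent_subset_succ p L T (dec p) (inp p) ((c.receive p a e).recv p) hK (c.rounds p)
  rwa [stateAfter_receive, ← Config.rounds_receive_self c p a e] at this

theorem unsent_of_receive (hK : 0 < K) {k : ℕ} (h : Unsent L T dec inp z (c.receive p a e) k) :
    Unsent L T dec inp z c k := by
  rcases p.eq_or_eq_other (ownerAt k) with ho | ho
  · rw [Unsent, ho] at h ⊢
    exact fun hm => h (edgesOf_subset_receive p a e hK hm)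
  · rw [Unsent, ho] at h ⊢
    rwa [partyState_receive_other] at h

theorem unsent_receive_other {k : ℕ} (ho : ownerAt k = p.other)
    (h : Unsent L T dec inp z c k) : Unsent L T dec inp z (c.receive p a e) k := by
  rw [Unsent, ho] at h ⊢
  rwa [partyState_receive_other]

theorem isOwn_of_mem_edgesOf_partyState (hK : 0 < K) (q : Party) {b : List Bool}
    (hb : b ∈ edgesOf q T (partyState L T dec inp c q).sent) : isOwn q T (inp q) b = true :=
  isOwn_of_mem_edgesOf_sent q L T (dec q) (inp q) (c.recv q) hK hb

variable {p a e}

/-- In a round with a correct decoding in which a cycle begins and the first edge that is not yet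
sent belongs to the party, the party makes progress. -/
theorem active_of_pending (hK : 0 < K) (hz : IsPath T inp z)
    (hdec : dec p (c.recv p ++ [a]) = (partyState L T dec inp c p.other).sent)
    (hq : (partyState L T dec inp c p).queue = []) {k : ℕ} (hk : Pending L T dec inp z c k)
    (ho : ownerAt k = p) :
    Active p L T (dec p) (inp p) ((c.receive p a e).recv p) z (c.rounds p) := by
  obtain ⟨hkT, hun, hmin⟩ := hk
  have hedges := edgesOf_sent_of_queue p L T (dec p) (inp p) (c.recv p) hK hq
  change edgesOf p T (partyState L T dec inp c p).sent =
    (partyState L T dec inp c p).finalLog.map Prod.snd at hedges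
  rw [Unsent, ho, hedges] at hun
  refine ⟨by rwa [stateAfter_receive], z.take (k + 1), ?_, List.take_prefix _ _, ?_⟩
  · rw [heard_receive_last, stateAfter_receive, hdec]
    refine hz.chosen (wf_stateAfter hK p L T (dec p) (inp p) (c.recv p) (c.rounds p))
      (fun b hb => isOwn_of_mem_edgesOf_partyState hK p.other hb) hkT ho ?_ ?_ hun
    · intro j hj hjo
      have := hmin j hj
      rwa [Unsent, not_not, hjo] at this
    · intro j hj hjo
      have := hmin j hj
      rw [Unsent, not_not, hjo, hedges] at this
      exact this
  · rwa [stateAfter_receive]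

/-- After a correct decoding, either the round is a vote for the correct leaf or an edge of the
other party is not yet sent. -/
theorem vote_or_unsent (hK : 0 < K) (hz : IsPath T inp z)
    (hdec : dec p (c.recv p ++ [a]) = (partyState L T dec inp c p.other).sent) :
    endpoint p T (inp p) (dec p (c.recv p ++ [a])) = some z ∨
      ∃ k < T, ownerAt k = p.other ∧ Unsent L T dec inp z c k := by
  by_cases h : ∃ k < T, ownerAt k = p.other ∧ Unsent L T dec inp z c k
  · exact Or.inr h
  · left
    rw [hdec]
    obtain ⟨k, hk, hkT, he⟩ := hz.endpoint (d := (partyState L T dec inp c p.other).sent)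
      (fun b hb => isOwn_of_mem_edgesOf_partyState hK p.other hb) (m := T) le_rfl (fun j hj ho => by
        by_contra hc
        refine h ⟨j, hj, ho, ?_⟩
        rwa [Unsent, ho])
    rw [he, List.take_of_length_le (by rw [hz.length_eq]; exact hk)]

end step

variable (L T dec inp z c) in
/-- All rounds of `p` are votes for the correct leaf, or they are charged to a bad, an excused or
the initial round. -/
def Charged (Bd : Party → ℕ) (p : Party) (n : ℕ) : Prop :=
  c.rounds p + n ≤ 1 + votes p T (dec p) (inp p) (c.recv p) z + (Bd p + Bd p.other) +
    (excused L T dec inp z c p + excused L T dec inp z c p.other)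

/-- The next round of `p`, which is bad or decodes correctly, is charged. -/
theorem Charged.receive (hK : 0 < K) (hz : IsPath T inp z) {Bd Bd' : Party → ℕ} {p : Party} {a : β}
    (e : ℕ) (h : ∀ q, Charged L T dec inp z c Bd q 0)
    (hpend : ∀ k, Pending L T dec inp z c k → ownerAt k = c.sender →
      Charged L T dec inp z c Bd c.sender.other 1)
    (hother : Bd' p.other = Bd p.other)
    (hgood : Bd' p = Bd p + 1 ∨ (Bd' p = Bd p ∧ c.sender = p.other ∧
      dec p (c.recv p ++ [a]) = (partyState L T dec inp c p.other).sent)) :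
    (∀ q, Charged L T dec inp z (c.receive p a e) Bd' q 0) ∧
      ∀ k, Pending L T dec inp z (c.receive p a e) k → ownerAt k = p →
        Charged L T dec inp z (c.receive p a e) Bd' p.other 1 := by
  have hex := excused_receive_self (L := L) (T := T) (dec := dec) (inp := inp) (z := z) (c := c)
    p a e
  have hvote := votes_append (p := p) (dec := dec p) (x := inp p) (c.recv p) a z hz.length_eq
  have hp := h p
  have hq := h p.other
  rw [Charged] at hp hq
  rw [Party.other_other] at hq
  have goal_other : ∀ n, Charged L T dec inp z (c.receive p a e) Bd' p.other n ↔
      c.rounds p.other + n ≤ 1 + votes p.other T (dec p.other) (inp p.other) (c.recv p.other) z +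
        (Bd p.other + Bd' p) + (excused L T dec inp z c p.other +
          excused L T dec inp z (c.receive p a e) p) := by
    intro n
    rw [Charged, Party.other_other, Config.rounds_receive_other, Config.receive_recv_other,
      excused_receive_other, hother]
  have goal_self : Charged L T dec inp z (c.receive p a e) Bd' p 0 ↔
      c.rounds p + 1 ≤ 1 + votes p T (dec p) (inp p) (c.recv p ++ [a]) z +
        (Bd' p + Bd p.other) + (excused L T dec inp z (c.receive p a e) p +
          excused L T dec inp z c p.other) := by
    rw [Charged, Config.rounds_receive_self, Config.receive_recv_self,
      excused_receive_other, hother, add_zero]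
  have hall : (∀ q, Charged L T dec inp z (c.receive p a e) Bd' q 0) ↔
      Charged L T dec inp z (c.receive p a e) Bd' p 0 ∧
        Charged L T dec inp z (c.receive p a e) Bd' p.other 0 :=
    ⟨fun h => ⟨h _, h _⟩, fun h q => by
      rcases p.eq_or_eq_other q with rfl | rfl
      · exact h.1
      · exact h.2⟩
  rw [hall, goal_self, goal_other]
  simp only [goal_other]
  -- a bad round, or one in which no cycle begins, or an active round
  by_cases hle : excused L T dec inp z c p + Bd p + 1 ≤
      excused L T dec inp z (c.receive p a e) p + Bd' p
  · exact ⟨⟨by omega, by omega⟩, fun _ _ _ => by omega⟩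
  rcases hgood with hb | ⟨hb, hs, hdec⟩
  · omega
  have hqu : (partyState L T dec inp c p).queue = [] := by
    by_contra hqu
    rw [if_neg (by simpa using hqu)] at hex
    omega
  have hact : ¬ Active p L T (dec p) (inp p) ((c.receive p a e).recv p) z (c.rounds p) := by
    intro hact
    rw [if_pos hact] at hex
    omega
  have hno : ∀ k, Pending L T dec inp z c k → ownerAt k = p.other := fun k hk =>
    (p.eq_or_eq_other (ownerAt k)).resolve_left
      fun ho => hact (active_of_pending hK hz hdec hqu hk ho)
  refine ⟨⟨?_, by omega⟩, fun k hk ho => ?_⟩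
  -- If the round is no vote, the first unsent edge belongs to the other party, which was the
  -- sender; the reserve left by its last round pays.
  · rcases vote_or_unsent hK hz hdec with hv | ⟨k, hk, -, hun⟩
    · rw [hvote, if_pos hv]
      omega
    · obtain ⟨j, -, hj⟩ := exists_pending hk hun
      have := hpend j hj (by rw [hno j hj, hs])
      rw [hs, Party.other_other, Charged] at this
      omega
  -- The first unsent edge belonged to the other party before the round and cannot be sent by `p`,
  -- so afterwards it is not an edge of `p`.
  · exfalso
    obtain ⟨j, hjk, hj⟩ := exists_pending hk.1 (unsent_of_receive p a e hK hk.2.1)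
    have hjo := hno j hj
    have hlt : j < k := lt_of_le_of_ne hjk (by
      rintro rfl
      exact p.other_ne (hjo.symm.trans ho))
    exact hk.2.2 j hlt (unsent_receive_other p a e hjo hj.2.1)

end PiPrime

theorem Party.update_update_apply {α : Sort u} (p : Party) (f : Party → α) (a b : α) :
    Function.update (Function.update f p a) p.other b p = a ∧
      Function.update (Function.update f p a) p.other b p.other = b :=
  ⟨by rw [Function.update_of_ne p.other_ne.symm, Function.update_self], Function.update_self ..⟩

/-! ### Rounds of the two parties in a corrupted run -/

namespace Scheme

variable {I : Party → Type u} {β : Type v} {O : Type w} {S : Scheme I β O} {N : ℕ}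
  {inp : (p : Party) → I p}

/-- Deliveries and substitutions keep the parties alternating; only a spoofed reply shifts the
difference of the round counts, by one. -/
theorem Reachable.rounds_diff {c : Config β} (h : S.Reachable N inp c) :
    c.rounds .alice ≤ c.rounds .bob + c.corruptions + (if c.sender = .alice then 1 else 0) ∧
      c.rounds .bob + (if c.sender = .alice then 1 else 0) ≤ c.rounds .alice + c.corruptions := by
  have step : ∀ (c : Config β) (p : Party) (a : β) (k : ℕ),
      c.rounds .alice ≤ c.rounds .bob + c.corruptions + (if c.sender = .alice then 1 else 0) →
      c.rounds .bob + (if c.sender = .alice then 1 else 0) ≤ c.rounds .alice + c.corruptions →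
      (p = c.sender → k = 1) →
      (c.receive p a k).rounds .alice ≤ (c.receive p a k).rounds .bob + (c.corruptions + k) +
        (if p = .alice then 1 else 0) ∧
      (c.receive p a k).rounds .bob + (if p = .alice then 1 else 0) ≤
        (c.receive p a k).rounds .alice + (c.corruptions + k) := by
    intro c p a k h1 h2 h3
    have e1 := c.rounds_receive_self p a k
    have e2 := c.rounds_receive_other p a k
    cases p <;> simp only [Party.other] at e2 <;> rw [e1, e2]
    · by_cases hs : c.sender = .alice
      · have := h3 hs.symm
        simp only [hs, if_true] at h1 h2 ⊢
        omega
      · simp only [hs, if_true, if_false] at h1 h2 ⊢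
        omega
    · have hba : ¬ Party.bob = .alice := by decide
      by_cases hs : c.sender = .alice
      · simp only [hs, if_true, if_neg hba] at h1 h2 ⊢
        omega
      · have hs' : c.sender = .bob := by cases hc : c.sender <;> simp_all
        have := h3 hs'.symm
        simp only [hs, if_false, if_neg hba] at h1 h2 ⊢
        omega
  induction h with
  | start => exact ⟨le_rfl, le_rfl⟩
  | deliver c _ _ ih => exact step c _ _ 0 ih.1 ih.2 fun h => absurd h c.sender.other_ne
  | substitute c a _ _ ih => exact step c _ a 1 ih.1 ih.2 fun _ => rfl
  | spoof c a _ _ ih => exact step c _ a 1 ih.1 ih.2 fun _ => rfl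

theorem Reachable.le_rounds_add {c : Config β} (h : S.Reachable N inp c) (hc : c.Complete N)
    (p : Party) : N ≤ c.rounds p + c.corruptions := by
  obtain ⟨h1, h2⟩ := h.rounds_diff
  unfold Config.Complete at hc
  -- The addressee of the symbol in transit has all its `N` rounds, and the other party lags by at
  -- most the number of corruptions.
  cases hs : c.sender <;> rw [hs] at h1 h2 hc <;> cases p <;> simp [Party.other] at * <;> omega

/-- Every round of a party is the last one in some earlier state. -/
theorem Reachable.exists_rounds_eq {c : Config β} (h : S.Reachable N inp c) (p : Party) {m : ℕ}
    (hm : 1 ≤ m) (hmc : m ≤ c.rounds p) : ∃ c', S.Reachable N inp c' ∧ c'.rounds p = m ∧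
      c'.recv p = heard p (c.recv p) m ∧ c'.corruptions ≤ c.corruptions := by
  have step : ∀ (c : Config β) (q : Party) (a : β) (k : ℕ), S.Reachable N inp (c.receive q a k) →
      (m ≤ c.rounds p → ∃ c', S.Reachable N inp c' ∧ c'.rounds p = m ∧
        c'.recv p = heard p (c.recv p) m ∧ c'.corruptions ≤ c.corruptions) →
      m ≤ (c.receive q a k).rounds p →
      ∃ c', S.Reachable N inp c' ∧ c'.rounds p = m ∧
        c'.recv p = heard p ((c.receive q a k).recv p) m ∧ c'.corruptions ≤ c.corruptions + k := by
    intro c q a k hr ih hmc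
    rcases q.eq_or_eq_other p with rfl | rfl
    · rw [Config.rounds_receive_self] at hmc
      rw [Config.receive_recv_self]
      rcases Nat.lt_or_ge (c.rounds p) m with hlt | hle
      · obtain rfl : m = c.rounds p + 1 := by omega
        refine ⟨_, hr, Config.rounds_receive_self _ _ _ _, ?_, le_rfl⟩
        rw [Config.receive_recv_self, Config.rounds_eq, PiPrime.heard_full]
      · obtain ⟨c', h1, h2, h3, h4⟩ := ih hle
        refine ⟨c', h1, h2, ?_, by omega⟩
        obtain ⟨j, rfl⟩ : ∃ j, m = j + 1 := ⟨m - 1, by omega⟩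
        rw [h3, PiPrime.heard_append _ _ (by rw [← Config.rounds_eq]; omega)]
    · rw [Config.rounds_receive_other] at hmc
      rw [Config.receive_recv_other]
      obtain ⟨c', h1, h2, h3, h4⟩ := ih hmc
      exact ⟨c', h1, h2, h3, by omega⟩
  induction h with
  | start =>
    cases p
    · exact ⟨_, .start, le_antisymm hm hmc, by simp [heard], le_rfl⟩
    · exact absurd (hm.trans hmc) (by simp [Config.rounds])
  | deliver c hr hlt ih => exact step c _ _ 0 (.deliver c hr hlt) ih hmc
  | substitute c a hr hlt ih => exact step c _ a 1 (.substitute c a hr hlt) ih hmc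
  | spoof c a hr hlt ih => exact step c _ a 1 (.spoof c a hr hlt) ih hmc

end Scheme

/-! ### The potential pays for the bad rounds -/

namespace PiPrime

variable {K : ℕ} {β : Type v} {L T N : ℕ} {C : PrefixCode (Page K) β}
  {dec : Party → List β → List (Page K)} {inp : (p : Party) → PJPInput p} {z : List Bool}
  {c : Config β} {x₀ : ℝ}

theorem length_partyState_sent (p : Party) : (partyState L T dec inp c p).sent.length = c.rounds p
    :=
  length_sent _ _ _ _ _ _ _

variable (L T N C dec inp z x₀ c) in
/-- The invariant of the channel: `τ p` is the matching between what was sent to `p`, except for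
the symbol in transit, and what `p` received; `Bd p` counts the bad rounds of `p`. -/
structure ChannelInv (τ : Party → StringMatching β) (Bd : Party → ℕ) : Prop where
  rounds_le : ∀ p, c.rounds p ≤ N
  match_eq : ∀ p, (τ p).Matches
    (if c.sender = p.other then (C.encode (partyState L T dec inp c p.other).sent).dropLast
      else C.encode (partyState L T dec inp c p.other).sent) (c.recv p)
  potential_le : ∀ p, x₀ * (Bd p + Bd p.other) +
    ((τ p).potential x₀ + (τ p.other).potential x₀) ≤ 2 * c.corruptions
  charged : ∀ q, Charged L T dec inp z c Bd q 0
  pending : ∀ k, Pending L T dec inp z c k → ownerAt k = c.sender →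
    Charged L T dec inp z c Bd c.sender.other 1

/-- The part common to the three kinds of channel steps. The new matchings cover the symbol that was
in transit; the symbol that `p` sends now is the one excluded next. -/
theorem ChannelInv.receive (hK : 0 < K) (hz : IsPath T inp z) {τ τ' : Party → StringMatching β}
    {Bd Bd' : Party → ℕ} (h : ChannelInv L T N C dec inp z c x₀ τ Bd) {p : Party}
    (hp : c.rounds p < N) (a : β) (k : ℕ)
    (hmp : (τ' p).Matches (C.encode (partyState L T dec inp c p.other).sent) (c.recv p ++ [a]))
    (hmq : (τ' p.other).Matches (C.encode (partyState L T dec inp c p).sent) (c.recv p.other))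
    (hpot : x₀ * (Bd' p + Bd' p.other) + ((τ' p).potential x₀ + (τ' p.other).potential x₀) ≤
      2 * (c.corruptions + k))
    (hother : Bd' p.other = Bd p.other)
    (hgood : Bd' p = Bd p + 1 ∨ (Bd' p = Bd p ∧ c.sender = p.other ∧
      dec p (c.recv p ++ [a]) = (partyState L T dec inp c p.other).sent)) :
    ChannelInv L T N C dec inp z (c.receive p a k) x₀ τ' Bd' := by
  obtain ⟨h1, h2⟩ := Charged.receive hK hz k h.charged h.pending hother hgood
  have hs : (c.receive p a k).sender = p := rfl
  refine ⟨fun q => ?_, fun q => ?_, fun q => ?_, h1, h2⟩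
  · rcases p.eq_or_eq_other q with rfl | rfl
    · rw [Config.rounds_receive_self]; exact hp
    · rw [Config.rounds_receive_other]; exact h.rounds_le _
  · rw [hs]
    rcases p.eq_or_eq_other q with rfl | rfl
    · rw [if_neg q.other_ne.symm, partyState_receive_other, Config.receive_recv_self]
      exact hmp
    · obtain ⟨g, hg⟩ := exists_sent_receive (L := L) (T := T) (dec := dec) (inp := inp) (c := c) p
        a k
      rw [if_pos p.other_other.symm, Config.receive_recv_other, Party.other_other, hg,
        PrefixCode.encode_append_singleton, List.dropLast_concat]
      exact hmq
  · have e : ((c.receive p a k).corruptions : ℝ) = c.corruptions + k := by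
      simp [Config.receive]
    rw [e]
    rcases p.eq_or_eq_other q with rfl | rfl
    · exact hpot
    · rw [Party.other_other]; linarith

theorem send_piPrime (p : Party) : (piPrime K L T C dec).send p (inp p) (c.recv p) =
    C (partyState L T dec inp c p).sent := by
  rw [partyState, Config.rounds_eq]
  rfl

theorem encode_sent_eq {p : Party} (hp : 1 ≤ c.rounds p) :
    C.encode (partyState L T dec inp c p).sent =
      (C.encode (partyState L T dec inp c p).sent).dropLast ++
        [C (partyState L T dec inp c p).sent] := by
  have := length_partyState_sent (L := L) (T := T) (dec := dec) (inp := inp) (c := c) p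
  rcases List.eq_nil_or_concat (partyState L T dec inp c p).sent with h | ⟨m, g, h⟩
  · rw [h, List.length_nil] at this; omega
  · rw [h, List.concat_eq_append, PrefixCode.encode_append_singleton, List.dropLast_concat]

theorem one_le_rounds_sender {I : Party → Type u} {O : Type w} {S : Scheme I β O}
    {inp : (p : Party) → I p} (h : S.Reachable N inp c) : 1 ≤ c.rounds c.sender := by
  have step : ∀ (c : Config β) (p : Party) (a : β) (k : ℕ),
      1 ≤ (c.receive p a k).rounds (c.receive p a k).sender := by
    intro c p a k
    change 1 ≤ (c.receive p a k).rounds p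
    rw [Config.rounds_receive_self]
    omega
  cases h with
  | start => exact le_rfl
  | deliver c _ _ => exact step _ _ _ _
  | substitute c a _ _ => exact step _ _ _ _
  | spoof c a _ _ => exact step _ _ _ _

open StringMatching in
theorem exists_channelInv {ε : ℝ} (hK : 0 < K) (hz : IsPath T inp z) (hN : 1 ≤ N)
    (hε : 0 < ε) (hε' : ε < 1 / 2) (hx : 0 ≤ x₀) (hx1 : x₀ < 1 / 2 - ε)
    (hC : C.IsEditTreeCode (1 - ε) N) (hdec : ∀ p, C.IsDecoder N (dec p))
    (h : (piPrime K L T C dec).Reachable N inp c) :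
    ∃ τ Bd, ChannelInv L T N C dec inp z c x₀ τ Bd := by
  -- A second input symbol is needed for the artificial branch in `not_extending`.
  have hnontriv : Nontrivial (Page K) :=
    ⟨⟨true, fun _ => none⟩, ⟨false, fun _ => none⟩, by simp⟩
  induction h with
  | start =>
    refine ⟨fun _ => [], fun _ => 0, ?_, ?_, ?_, ?_, ?_⟩
    · rintro (_ | _)
      · exact hN
      · exact Nat.zero_le _
    · rintro (_ | _)
      · exact matches_nil
      · have : (C.encode (partyState L T dec inp
            ⟨fun _ => [], Party.alice, 0⟩ Party.alice).sent).dropLast = [] := by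
          apply List.length_eq_zero_iff.1
          rw [List.length_dropLast, PrefixCode.length_encode, length_partyState_sent]
          rfl
        change Matches [] (if Party.alice = Party.alice then _ else _) []
        rw [if_pos rfl]
        change Matches [] (C.encode (partyState L T dec inp
            ⟨fun _ => [], Party.alice, 0⟩ Party.alice).sent).dropLast []
        rw [this]
        exact matches_nil
    · intro p; simp [potential]
    · rintro (_ | _)
      · simp [Charged, Config.rounds]; omega
      · simp [Charged, Config.rounds]
    · intro k _ _
      simp [Charged, Config.rounds, Party.other]
      omega
  | deliver c hr hlt ih =>
    obtain ⟨τ, Bd, h⟩ := ih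
    obtain ⟨p, hp⟩ : ∃ p, c.sender.other = p := ⟨_, rfl⟩
    have hs : c.sender = p.other := by rw [← hp, Party.other_other]
    rw [hp] at hlt ⊢
    rw [send_piPrime]
    have hm := h.match_eq p
    rw [if_pos hs] at hm
    have hmq := h.match_eq p.other
    rw [Party.other_other, if_neg (by rw [hs]; exact p.other_ne)] at hmq
    have hone := one_le_rounds_sender hr
    rw [hs] at hone ⊢
    set a := C (partyState L T dec inp c p.other).sent with ha
    have hm' := hm.append (matches_pair a)
    rw [← encode_sent_eq hone] at hm'
    have hpot := potential_append x₀ (τ p) (some a, some a)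
    simp only [Option.isNone_some, Option.isSome_some, if_true, Bool.false_eq_true, if_false,
      add_zero, mul_one] at hpot
    have hold := h.potential_le p
    -- A matched symbol lowers a positive potential by `x₀`. If it stays positive, the round is
    -- counted as bad and costs just this `x₀`; if it reaches 0, the decoding is correct.
    by_cases hgood : potential x₀ (τ p ++ [(some a, some a)]) ≤ 0
    · refine ⟨Function.update (Function.update τ p (τ p ++ [(some a, some a)])) p.other
        (τ p.other), Bd, h.receive hK hz hlt a 0 ?_ ?_ ?_ rfl (Or.inr ⟨rfl, hs, ?_⟩)⟩
      · rw [(p.update_update_apply τ _ _).1]; exact hm'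
      · rw [(p.update_update_apply τ _ _).2]; exact hmq
      · rw [(p.update_update_apply τ _ _).1, (p.update_update_apply τ _ _).2]
        have := potential_nonneg x₀ (τ p)
        push_cast
        linarith
      · exact (hdec p).decode_eq hε hε' hC hx hx1
          (by rw [length_partyState_sent]; exact h.rounds_le _) hm' hgood
    · refine ⟨Function.update (Function.update τ p (τ p ++ [(some a, some a)])) p.other
        (τ p.other), Function.update (Function.update Bd p (Bd p + 1)) p.other (Bd p.other),
        h.receive hK hz hlt a 0 ?_ ?_ ?_ (p.update_update_apply Bd _ _).2 (Or.inl
            (p.update_update_apply Bd _ _).1)⟩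
      · rw [(p.update_update_apply τ _ _).1]; exact hm'
      · rw [(p.update_update_apply τ _ _).2]; exact hmq
      · rw [(p.update_update_apply τ _ _).1, (p.update_update_apply τ _ _).2,
          (p.update_update_apply Bd _ _).1, (p.update_update_apply Bd _ _).2]
        rw [hpot] at hgood ⊢
        rw [max_eq_right (le_of_lt (by
          by_contra hc
          exact hgood (max_le le_rfl (not_lt.1 hc))))]
        push_cast
        linarith
  | substitute c b hr hlt ih =>
    obtain ⟨τ, Bd, h⟩ := ih
    obtain ⟨p, hp⟩ : ∃ p, c.sender.other = p := ⟨_, rfl⟩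
    have hs : c.sender = p.other := by rw [← hp, Party.other_other]
    rw [hp] at hlt ⊢
    have hm := h.match_eq p
    rw [if_pos hs] at hm
    have hmq := h.match_eq p.other
    rw [Party.other_other, if_neg (by rw [hs]; exact p.other_ne)] at hmq
    have hone := one_le_rounds_sender hr
    rw [hs] at hone
    set a := C (partyState L T dec inp c p.other).sent with ha
    -- A substitution is an insertion and a deletion: the potential grows by `2 - x₀`, and the bad
    -- round costs `x₀`, in total 2 for the corruption.
    have hm' := (hm.append (matches_insert b)).append (matches_delete a)
    rw [List.append_nil, List.append_nil, ← encode_sent_eq hone] at hm'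
    have hpot1 := potential_append x₀ (τ p) (none, some b)
    have hpot2 := potential_append x₀ (τ p ++ [(none, some b)]) (some a, none)
    have h0 := potential_nonneg x₀ (τ p)
    simp only [Option.isNone_some, Option.isSome_some, Option.isNone_none, Option.isSome_none,
      if_true, Bool.false_eq_true, if_false, add_zero, zero_add, mul_one, mul_zero, sub_zero]
      at hpot1 hpot2
    rw [max_eq_right (by linarith)] at hpot1
    rw [hpot1, max_eq_right (by linarith)] at hpot2
    have hold := h.potential_le p
    refine ⟨Function.update (Function.update τ p (τ p ++ [(none, some b)] ++ [(some a, none)]))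
        p.other (τ p.other), Function.update (Function.update Bd p (Bd p + 1)) p.other (Bd p.other),
        h.receive hK hz hlt b 1 ?_ ?_ ?_ (p.update_update_apply Bd _ _).2 (Or.inl
            (p.update_update_apply Bd _ _).1)⟩
    · rw [(p.update_update_apply τ _ _).1]; exact hm'
    · rw [(p.update_update_apply τ _ _).2]; exact hmq
    · rw [(p.update_update_apply τ _ _).1, (p.update_update_apply τ _ _).2, (p.update_update_apply
        Bd _ _).1, (p.update_update_apply Bd _ _).2, hpot2]
      push_cast
      linarith
  | spoof c b hr hlt ih =>
    obtain ⟨τ, Bd, h⟩ := ih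
    obtain ⟨p, hp⟩ : ∃ p, c.sender = p := ⟨_, rfl⟩
    have hone := one_le_rounds_sender hr
    rw [hp] at hlt hone ⊢
    have hm := h.match_eq p
    rw [hp, if_neg p.other_ne.symm] at hm
    have hmq := h.match_eq p.other
    rw [Party.other_other, if_pos hp] at hmq
    set a := C (partyState L T dec inp c p).sent with ha
    -- A spoofed reply is an insertion for `p` and a deletion for the other party. The potentials
    -- grow by `1` and `1 - x₀`, and with the bad round of `p` the total is again 2.
    have hm' := hm.append (matches_insert b)
    have hmq' := hmq.append (matches_delete a)
    rw [List.append_nil] at hm' hmq'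
    rw [← encode_sent_eq hone] at hmq'
    have hpot1 := potential_append x₀ (τ p) (none, some b)
    have hpot2 := potential_append x₀ (τ p.other) (some a, none)
    have h0 := potential_nonneg x₀ (τ p)
    have h0' := potential_nonneg x₀ (τ p.other)
    simp only [Option.isNone_some, Option.isSome_some, Option.isNone_none, Option.isSome_none,
      if_true, Bool.false_eq_true, if_false, add_zero, zero_add, mul_one, mul_zero, sub_zero]
      at hpot1 hpot2
    rw [max_eq_right (by linarith)] at hpot1 hpot2
    have hold := h.potential_le p
    refine ⟨Function.update (Function.update τ p (τ p ++ [(none, some b)])) p.other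
        (τ p.other ++ [(some a, none)]),
        Function.update (Function.update Bd p (Bd p + 1)) p.other (Bd p.other),
        h.receive hK hz hlt b 1 ?_ ?_ ?_ (p.update_update_apply Bd _ _).2 (Or.inl
            (p.update_update_apply Bd _ _).1)⟩
    · rw [(p.update_update_apply τ _ _).1]; exact hm'
    · rw [(p.update_update_apply τ _ _).2]; exact hmq'
    · rw [(p.update_update_apply τ _ _).1, (p.update_update_apply τ _ _).2, (p.update_update_apply
        Bd _ _).1, (p.update_update_apply Bd _ _).2, hpot1, hpot2]
      push_cast
      linarith

theorem votes_add_votes_le {p : Party} {d : List β → List (Page K)} {x : List Bool → Bool}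
    {r : List β} {u v : List Bool} (h : u ≠ v) :
    votes p T d x r u + votes p T d x r v ≤ roundsOf p r.length := by
  have key : ∀ (f g : ℕ → Bool) (l : List ℕ), (∀ i, ¬ (f i = true ∧ g i = true)) →
      (l.filter f).length + (l.filter g).length ≤ l.length := by
    intro f g l hfg
    induction l with
    | nil => simp
    | cons i l ih =>
      have := hfg i
      cases hf : f i <;> cases hg : g i <;> simp [hf, hg] <;>
        simp [hf, hg] at this <;> omega
  unfold votes
  refine (key _ _ _ ?_).trans_eq List.length_range
  rintro i ⟨h1, h2⟩
  rw [Bool.and_eq_true, beq_iff_eq] at h1 h2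
  exact h (Option.some.inj (h1.2.symm.trans h2.2))

/-- The output is the leaf that has the majority of the votes. -/
theorem out_piPrime {p : Party} {r : List β} (hz : z.length = T)
    (h : roundsOf p r.length < 2 * votes p T (dec p) (inp p) r z) :
    (piPrime K L T C dec).out p (inp p) r = z := by
  set P : List Bool → Prop := fun v => v.length = T ∧
    ∀ u : List Bool, u.length = T → votes p T (dec p) (inp p) r u ≤ votes p T (dec p) (inp p) r v
  have hex : ∃ v, P v := by
    refine ⟨z, hz, fun u _ => ?_⟩
    by_cases huz : u = z
    · rw [huz]
    · have := votes_add_votes_le (p := p) (T := T) (d := dec p) (x := inp p) (r := r) huz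
      omega
  have hsp := Classical.epsilon_spec hex
  by_contra hne
  change Classical.epsilon P ≠ z at hne
  have h1 := hsp.2 z hz
  have h2 := votes_add_votes_le (p := p) (T := T) (d := dec p) (x := inp p) (r := r) hne
  omega

end PiPrime

/-! ### The final count -/

namespace PiPrime

/-- In units of `εN`: rounds without a new cycle contribute `19/18`, and the three terms of
`actives_le` contribute `1`, `1/2` and `1`. The sum `3.555...` is rounded up. -/
theorem excused_le {β : Type v} {K L T N : ℕ} {dec : Party → List β → List (Page K)}
    {inp : (p : Party) → PJPInput p} {z : List Bool} {c : Config β} {ε : ℝ} (hε : 0 < ε)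
    (hε' : ε ≤ 1 / 18) (hK : 1 / ε ^ 2 ≤ K) (hL : 1 / ε ≤ L) (hL' : L ≤ 1 / ε + 1)
    (hN : T / ε ^ 2 ≤ N) (hT : 1 ≤ T) (hz : z.length = T) {p : Party} (hp : c.rounds p ≤ N) :
    (excused L T dec inp z c p : ℝ) ≤ 3.556 * (ε * N) := by
  have hK0 : (0 : ℝ) < K := lt_of_lt_of_le (by positivity) hK
  have hL0 : (0 : ℝ) < L := lt_of_lt_of_le (by positivity) hL
  have hKn : 0 < K := by exact_mod_cast hK0
  have hLn : 0 < L := by exact_mod_cast hL0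
  have hi : (c.rounds p : ℝ) ≤ N := by exact_mod_cast hp
  have hN0 : (0 : ℝ) ≤ N := Nat.cast_nonneg N
  have h1 := nonstarts_le hKn hLn p T (dec p) (inp p) (c.recv p) (c.rounds p)
  have h1' : (K : ℝ) * nonstarts p L T (dec p) (inp p) (c.recv p) (c.rounds p) ≤
      L * c.rounds p := by exact_mod_cast h1
  have h2 := actives_le (p := p) (x := inp p) (L := L) hε hε' hKn hLn hT hz (dec p) (c.recv p)
    (c.rounds p)
  have hns : (nonstarts p L T (dec p) (inp p) (c.recv p) (c.rounds p) : ℝ) ≤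
      19 / 18 * (ε * N) := by
    set m : ℝ := (nonstarts p L T (dec p) (inp p) (c.recv p) (c.rounds p) : ℝ)
    have hm : 0 ≤ m := Nat.cast_nonneg _
    have e1 : 1 / ε ^ 2 * m ≤ (1 / ε + 1) * N :=
      calc 1 / ε ^ 2 * m ≤ K * m := mul_le_mul_of_nonneg_right hK hm
        _ ≤ L * c.rounds p := h1'
        _ ≤ L * N := mul_le_mul_of_nonneg_left hi hL0.le
        _ ≤ (1 / ε + 1) * N := mul_le_mul_of_nonneg_right hL' hN0
    have e2 : m = ε ^ 2 * (1 / ε ^ 2 * m) := by field_simp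
    have e3 : ε ^ 2 * ((1 / ε + 1) * N) = (1 + ε) * (ε * N) := by field_simp
    have e4 := mul_le_mul_of_nonneg_left e1 (by positivity : 0 ≤ ε ^ 2)
    rw [← e2, e3] at e4
    have : (1 + ε) * (ε * N) ≤ 19 / 18 * (ε * N) :=
      mul_le_mul_of_nonneg_right (by linarith) (by positivity)
    linarith
  have ha1 : (c.rounds p : ℝ) / L ≤ ε * N := by
    rw [div_le_iff₀ hL0]
    calc (c.rounds p : ℝ) ≤ N := hi
      _ = ε * N * (1 / ε) := by field_simp
      _ ≤ ε * N * L := mul_le_mul_of_nonneg_left hL (by positivity)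
  have ha2 : (T : ℝ) * (1 / (2 * ε)) ≤ ε * N / 2 := by
    have : (T : ℝ) * (1 / (2 * ε)) = ε / 2 * (T / ε ^ 2) := by field_simp
    rw [this]
    have := mul_le_mul_of_nonneg_left hN (by positivity : 0 ≤ ε / 2)
    linarith
  have ha3 : ε * c.rounds p ≤ ε * N := mul_le_mul_of_nonneg_left hi hε.le
  rw [excused]
  push_cast
  have : 0 ≤ ε * N := by positivity
  linarith

/-- The protocol with any edit-distance tree code is resilient. -/
theorem resilient_piPrime {β : Type v} {K L T N : ℕ} {C : PrefixCode (Page K) β}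
    {dec : Party → List β → List (Page K)} {ε ρ : ℝ} (hε : 0 < ε)
    (hK : 1 / ε ^ 2 ≤ K) (hL : 1 / ε ≤ L) (hL' : L ≤ 1 / ε + 1) (hN : T / ε ^ 2 ≤ N) (hT : 1 ≤ T)
    (hC : C.IsEditTreeCode (1 - ε) N) (hdec : ∀ p, C.IsDecoder N (dec p)) (hρ : 0 ≤ ρ)
    (hρ' : ρ ≤ 1 / 18 - ε) : (piPrime K L T C dec).Resilient N ρ (pjp T).transcript := by
  intro inp c hr hc hcor p
  -- For larger `ε` there is no admissible `ρ`, so smallness of `ε` is free.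
  have hε' : ε ≤ 1 / 18 := by linarith
  have hK0 : (0 : ℝ) < K := lt_of_lt_of_le (by positivity) hK
  have hKn : 0 < K := by exact_mod_cast hK0
  have hT' : (1 : ℝ) ≤ T := by exact_mod_cast hT
  -- This absorbs the rounding of `R` and the additive 1 in `Charged`.
  have hεN : 18 ≤ ε * N := by
    have h1 : (18 : ℝ) ≤ 1 / ε := by rw [le_div_iff₀ hε]; linarith
    have h2 : ε * (T / ε ^ 2) = T * (1 / ε) := by field_simp
    have h3 := mul_le_mul_of_nonneg_left hN hε.le
    rw [h2] at h3
    nlinarith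
  have hN0 : (0 : ℝ) ≤ N := Nat.cast_nonneg N
  have hN1 : 1 ≤ N := by
    have : (0 : ℝ) < N := by
      by_contra h
      have : (N : ℝ) = 0 := le_antisymm (not_lt.1 h) hN0
      rw [this] at hεN
      linarith
    exact_mod_cast this
  set R := ⌊(1 - 2 * ρ) * N⌋₊ with hR
  have hRle : (R : ℝ) ≤ (1 - 2 * ρ) * N := Nat.floor_le (mul_nonneg (by linarith) hN0)
  have hRge : (1 - 2 * ρ) * N < R + 1 := Nat.lt_floor_add_one _
  have hRc : R ≤ c.rounds p := by
    have h1 : (N : ℝ) ≤ c.rounds p + c.corruptions := by exact_mod_cast hr.le_rounds_add hc p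
    have : (R : ℝ) ≤ c.rounds p := by linarith
    exact_mod_cast this
  refine ⟨hRc, ?_⟩
  have hρN : 2 * ρ * N ≤ 2 * (1 / 18 - ε) * N := by nlinarith
  have hR1 : 1 ≤ R := by
    have : (0 : ℝ) < R := by nlinarith
    exact_mod_cast this
  -- The output of round `R` is judged in the state in which `p` has just performed that round.
  obtain ⟨c', hr', hround, hrecv, hcor'⟩ := hr.exists_rounds_eq p hR1 hRc
  have hz := isPath_transcript T inp
  -- The threshold must be strictly below `1/2 - ε`, but close enough to it for the constants below.
  obtain ⟨τ, Bd, h⟩ := exists_channelInv (x₀ := 1 / 2 - 11 / 10 * ε) hKn hz hN1 hε (by linarith)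
    (by linarith) (by linarith) hC hdec hr'
  rw [← hrecv]
  apply out_piPrime hz.length_eq
  rw [← Config.rounds_eq, hround]
  set z := (pjp T).transcript inp
  have hch := h.charged p
  rw [Charged, hround, add_zero] at hch
  have hch' : (R : ℝ) ≤ 1 + votes p T (dec p) (inp p) (c'.recv p) z + (Bd p + Bd p.other) +
    (excused L T dec inp z c' p + excused L T dec inp z c' p.other) := by exact_mod_cast hch
  have hex1 := excused_le (dec := dec) (inp := inp) (c := c') hε hε' hK hL hL' hN hT
    hz.length_eq (h.rounds_le p)
  have hex2 := excused_le (dec := dec) (inp := inp) (c := c') hε hε' hK hL hL' hN hT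
    hz.length_eq (h.rounds_le p.other)
  have hpot := h.potential_le p
  have hp1 := StringMatching.potential_nonneg (1 / 2 - 11 / 10 * ε) (τ p)
  have hp2 := StringMatching.potential_nonneg (1 / 2 - 11 / 10 * ε) (τ p.other)
  have hcor2 : (c'.corruptions : ℝ) ≤ c.corruptions := by exact_mod_cast hcor'
  -- Twice the corruptions are at most `(2/9 - 4ε)N`. Division by `x₀` gives `7.02`, since `7.02/2 +
  -- (11/10)(4/9) < 4`.
  have hBd : (Bd p + Bd p.other : ℝ) ≤ (4 / 9 - 7.02 * ε) * N := by
    have h1 : (1 / 2 - 11 / 10 * ε) * (Bd p + Bd p.other : ℝ) ≤ (2 / 9 - 4 * ε) * N := by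
      linarith
    have h2 : (2 / 9 - 4 * ε) * N ≤ (1 / 2 - 11 / 10 * ε) * ((4 / 9 - 7.02 * ε) * N) := by
      rw [← mul_assoc]
      refine mul_le_mul_of_nonneg_right ?_ hN0
      nlinarith
    exact le_of_mul_le_mul_left (h1.trans h2) (by linarith)
  -- Bad and excused rounds together are at most `(4/9 + 0.092ε)N`, while half of `R` exceeds `(4/9
  -- + ε)N - 1/2`; the difference exceeds 1 because `εN ≥ 18`.
  have : (R : ℝ) < 2 * votes p T (dec p) (inp p) (c'.recv p) z := by
    nlinarith
  exact_mod_cast this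

end PiPrime

/-! ### Existence of edit-distance tree codes -/

/-! ### A counting form of the local lemma -/

section Avoidance

variable {ι : Type u} [Fintype ι] [DecidableEq ι] {q : ℕ} [NeZero q]

/-- The labelling gives equal labels to the two members of each pair. -/
def Occurs (f : ι → Fin q) (P : Finset (ι × ι)) : Prop := ∀ a ∈ P, f a.1 = f a.2

open Classical in
/-- The labellings of `W` (extended by `0`) in which no event inside `W` occurs. -/
noncomputable def avoiding (q : ℕ) [NeZero q] (E : Set (Finset (ι × ι))) (W : Finset ι) :
    Finset (ι → Fin q) :=
  Finset.univ.filter fun f => (∀ v ∉ W, f v = 0) ∧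
    ∀ P ∈ E, (∀ a ∈ P, a.1 ∈ W ∧ a.2 ∈ W) → ¬ Occurs f P

theorem mem_avoiding {E : Set (Finset (ι × ι))} {W : Finset ι} {f : ι → Fin q} :
    f ∈ avoiding q E W ↔ (∀ v ∉ W, f v = 0) ∧
      ∀ P ∈ E, (∀ a ∈ P, a.1 ∈ W ∧ a.2 ∈ W) → ¬ Occurs f P := by
  simp [avoiding]

/-- The pairs of an event determine the labels of as many vertices. -/
structure IsEvent (P : Finset (ι × ι)) : Prop where
  nonempty : P.Nonempty
  injOn : Set.InjOn Prod.fst (P : Set (ι × ι))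
  ne : ∀ a ∈ P, ∀ b ∈ P, a.2 ≠ b.1

open Classical in
/-- The labellings of `insert v W` in which a given event at `v` occurs are determined by their
values on a smaller set. -/
theorem card_occurs_le {E : Set (Finset (ι × ι))} {W : Finset ι} {v : ι}
    {P : Finset (ι × ι)} (hP : IsEvent P) (hPW : ∀ a ∈ P, a.1 ∈ insert v W ∧ a.2 ∈ insert v W)
    (hvP : ∃ a ∈ P, a.1 = v ∨ a.2 = v) (X : Finset (ι → Fin q))
    (hX : ∀ g ∈ X, (∀ u ∉ insert v W, g u = 0) ∧ Occurs g P ∧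
      ∀ Q ∈ E, (∀ a ∈ Q, a.1 ∈ W ∧ a.2 ∈ W) → ¬ Occurs g Q) :
    ∃ U ⊆ W, U.card + 1 = P.card ∧ X.card ≤ (avoiding q E (W \ U)).card := by
  obtain ⟨a, ha, hav⟩ := hvP
  -- The pair `a` recovers the label of `v`; each other pair recovers the label of its first member
  -- from its second, which lies outside `U`. So the labels on `U` and at `v` carry no information.
  set U := (P.erase a).image Prod.fst with hU
  have hmemU : ∀ u, u ∈ U ↔ ∃ b ∈ P, b ≠ a ∧ b.1 = u := by
    intro u
    rw [hU, Finset.mem_image]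
    constructor
    · rintro ⟨b, hb, rfl⟩
      exact ⟨b, Finset.mem_of_mem_erase hb, Finset.ne_of_mem_erase hb, rfl⟩
    · rintro ⟨b, hb, hba, rfl⟩
      exact ⟨b, Finset.mem_erase.2 ⟨hba, hb⟩, rfl⟩
  have hvU : v ∉ U := by
    rw [hmemU]
    rintro ⟨b, hb, hba, hbv⟩
    rcases hav with h | h
    · exact hba (hP.injOn hb ha (hbv.trans h.symm))
    · exact hP.ne a ha b hb (h.trans hbv.symm)
  have hsnd : ∀ b ∈ P, b.2 ∉ U := by
    intro b hb hbU
    obtain ⟨c, hc, -, hcb⟩ := (hmemU _).1 hbU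
    exact hP.ne b hb c hc hcb.symm
  refine ⟨U, ?_, ?_, ?_⟩
  · intro u hu
    obtain ⟨b, hb, hba, rfl⟩ := (hmemU u).1 hu
    exact Finset.mem_of_mem_insert_of_ne (hPW b hb).1 fun h => hvU (h ▸ hu)
  · rw [hU, Finset.card_image_of_injOn (hP.injOn.mono (by simp)), Finset.card_erase_of_mem ha]
    have := Finset.card_pos.2 hP.nonempty
    omega
  · refine Finset.card_le_card_of_injOn (fun g u => if u ∈ W \ U then g u else 0) ?_ ?_
    · intro g hg
      obtain ⟨-, -, h3⟩ := hX g hg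
      rw [Finset.mem_coe, mem_avoiding]
      refine ⟨fun u hu => if_neg hu, fun Q hQ hQW hocc => ?_⟩
      refine h3 Q hQ (fun b hb => ⟨(Finset.mem_sdiff.1 (hQW b hb).1).1,
        (Finset.mem_sdiff.1 (hQW b hb).2).1⟩) fun b hb => ?_
      have := hocc b hb
      simpa only [if_pos (hQW b hb).1, if_pos (hQW b hb).2] using this
    · intro g hg g' hg' heq
      obtain ⟨h1, h2, -⟩ := hX g hg
      obtain ⟨h1', h2', -⟩ := hX g' hg'
      have hW : ∀ u ∈ W \ U, g u = g' u := by
        intro u hu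
        have := congrFun heq u
        simpa only [if_pos hu] using this
      have hne : a.2 ≠ a.1 := hP.ne a ha a ha
      have hv : g v = g' v := by
        rcases hav with h | h
        · have h4 : a.2 ∈ W \ U := Finset.mem_sdiff.2
            ⟨Finset.mem_of_mem_insert_of_ne (hPW a ha).2 (h ▸ hne), hsnd a ha⟩
          rw [← h, h2 a ha, h2' a ha, hW _ h4]
        · have h4 : a.1 ∈ W \ U := by
            refine Finset.mem_sdiff.2 ⟨Finset.mem_of_mem_insert_of_ne (hPW a ha).1
              fun h' => hne (h.trans h'.symm), fun hU' => ?_⟩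
            obtain ⟨b, hb, hba, hb'⟩ := (hmemU _).1 hU'
            exact hba (hP.injOn hb ha hb')
          rw [← h, ← h2 a ha, ← h2' a ha, hW _ h4]
      have hvW : ∀ u ∈ insert v W, u ∉ U → g u = g' u := by
        intro u hu huU
        rcases Finset.mem_insert.1 hu with rfl | hu
        · exact hv
        · exact hW u (Finset.mem_sdiff.2 ⟨hu, huU⟩)
      funext u
      by_cases hu : u ∈ insert v W
      · by_cases huU : u ∈ U
        · obtain ⟨b, hb, -, rfl⟩ := (hmemU u).1 huU
          rw [h2 b hb, h2' b hb]
          exact hvW _ (hPW b hb).2 (hsnd b hb)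
        · exact hvW u hu huU
      · rw [h1 u hu, h1' u hu]

/-- Put the vertices of `U` back one at a time; each step multiplies the count by at least `b`. -/
theorem pow_mul_card_avoiding_le {E : Set (Finset (ι × ι))} {b : ℝ} (hb : 0 ≤ b) {W : Finset ι}
    (h : ∀ W' ⊂ W, ∀ v ∉ W', b * (avoiding q E W').card ≤ (avoiding q E (insert v W')).card)
    (U : Finset ι) (hU : U ⊆ W) :
    b ^ U.card * (avoiding q E (W \ U)).card ≤ (avoiding q E W).card := by
  induction U using Finset.induction_on with
  | empty => simp
  | insert u U hu ih =>
    have huW : u ∈ W := hU (Finset.mem_insert_self u U)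
    have hU' : U ⊆ W := fun x hx => hU (Finset.mem_insert_of_mem hx)
    have h1 := h (W \ insert u U) (Finset.ssubset_iff_subset_ne.2 ⟨Finset.sdiff_subset, fun he => by
      rw [← he] at huW
      simp at huW⟩) u (by simp)
    have h2 : insert u (W \ insert u U) = W \ U := by
      ext x
      by_cases hx : x = u
      · subst hx; simp [huW, hu]
      · simp [hx]
    rw [h2] at h1
    rw [Finset.card_insert_of_notMem hu, pow_succ, mul_assoc]
    exact (mul_le_mul_of_nonneg_left h1 (pow_nonneg hb _)).trans (ih hU')

open Classical in
-- Each good labelling of `W` has `2b` extensions to `v`. Those spoiled by an event with `s` pairs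
-- are determined on `W` minus `s - 1` vertices, so by induction they number at most `b ^ (1 - s)`
-- times the good labellings of `W`. Summed over the events at `v` this loses at most half of the
-- extensions.
theorem mul_card_avoiding_le {E : Set (Finset (ι × ι))} (hE : ∀ P ∈ E, IsEvent P) {b : ℕ}
    (hb : 1 ≤ b) (hq : q = 2 * b) (F : ι → Finset (Finset (ι × ι)))
    (hF : ∀ v, ∀ P ∈ E, (∃ a ∈ P, a.1 = v ∨ a.2 = v) → P ∈ F v)
    (hsum : ∀ v, ∑ P ∈ F v, (1 / (b : ℝ)) ^ P.card ≤ 1) (W : Finset ι) :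
    ∀ v ∉ W, (b : ℝ) * (avoiding q E W).card ≤ (avoiding q E (insert v W)).card := by
  have hb0 : (0 : ℝ) < b := by exact_mod_cast hb
  induction W using Finset.strongInduction with
  | H W ih =>
    intro v hv
    have hpow := pow_mul_card_avoiding_le hb0.le ih
    set A := avoiding q E W with hA
    -- all extensions to `v` of the labellings of `W`
    set X : Finset (ι → Fin q) := (A ×ˢ (Finset.univ : Finset (Fin q))).image
      fun a => Function.update a.1 v a.2 with hXdef
    have hXcard : (X.card : ℝ) = 2 * b * A.card := by
      rw [hXdef, Finset.card_image_of_injOn, Finset.card_product, Finset.card_univ,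
        Fintype.card_fin]
      · have hq' : (q : ℝ) = 2 * b := by exact_mod_cast hq
        push_cast
        rw [hq']
        ring
      · rintro ⟨f, x⟩ hf ⟨f', x'⟩ hf' h
        have hf := (mem_avoiding.1 (Finset.mem_product.1 hf).1).1 v hv
        have hf' := (mem_avoiding.1 (Finset.mem_product.1 hf').1).1 v hv
        simp only at h hf hf'
        have hx : x = x' := by simpa using congrFun h v
        have hff : f = f' := by
          funext u
          by_cases hu : u = v
          · rw [hu, hf, hf']
          · simpa [hu] using congrFun h u
        rw [hx, hff]
    have hXmem : ∀ g ∈ X, (∀ u ∉ insert v W, g u = 0) ∧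
        ∀ Q ∈ E, (∀ a ∈ Q, a.1 ∈ W ∧ a.2 ∈ W) → ¬ Occurs g Q := by
      intro g hg
      obtain ⟨⟨f, x⟩, hf, rfl⟩ := Finset.mem_image.1 hg
      obtain ⟨h1, h2⟩ := mem_avoiding.1 (Finset.mem_product.1 hf).1
      have hne : ∀ u ∈ W, u ≠ v := fun u hu h => hv (h ▸ hu)
      refine ⟨fun u hu => ?_, fun Q hQ hQW hocc => h2 Q hQ hQW fun a ha => ?_⟩
      · rw [Finset.mem_insert, not_or] at hu
        simpa [hu.1] using h1 u hu.2
      · have := hocc a ha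
        simpa [hne _ (hQW a ha).1, hne _ (hQW a ha).2] using this
    set bad : Finset (ι × ι) → Finset (ι → Fin q) := fun P => X.filter fun g =>
      Occurs g P ∧ P ∈ E ∧ (∀ a ∈ P, a.1 ∈ insert v W ∧ a.2 ∈ insert v W) ∧
        ∃ a ∈ P, a.1 = v ∨ a.2 = v
    have hsub : X ⊆ avoiding q E (insert v W) ∪ (F v).biUnion bad := by
      intro g hg
      rw [Finset.mem_union]
      by_contra hc
      rw [not_or] at hc
      obtain ⟨h1, h2⟩ := hXmem g hg
      refine hc.1 (mem_avoiding.2 ⟨h1, fun P hP hPW hocc => ?_⟩)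
      by_cases hvP : ∃ a ∈ P, a.1 = v ∨ a.2 = v
      · exact hc.2 (Finset.mem_biUnion.2 ⟨P, hF v P hP hvP,
          Finset.mem_filter.2 ⟨hg, hocc, hP, hPW, hvP⟩⟩)
      · refine h2 P hP (fun a ha => ?_) hocc
        exact ⟨Finset.mem_of_mem_insert_of_ne (hPW a ha).1 fun h => hvP ⟨a, ha, Or.inl h⟩,
          Finset.mem_of_mem_insert_of_ne (hPW a ha).2 fun h => hvP ⟨a, ha, Or.inr h⟩⟩
    have hbad : ∀ P, ((bad P).card : ℝ) ≤ b * A.card * (1 / (b : ℝ)) ^ P.card := by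
      intro P
      rcases (bad P).eq_empty_or_nonempty with h0 | ⟨g, hg⟩
      · rw [h0, Finset.card_empty, Nat.cast_zero]; positivity
      · obtain ⟨-, -, hPE, hPW, hvP⟩ := Finset.mem_filter.1 hg
        obtain ⟨U, hUW, hUc, hle⟩ := card_occurs_le (E := E) (hE P hPE) hPW hvP (bad P)
          fun g hg => by
            obtain ⟨hgX, hocc, -⟩ := Finset.mem_filter.1 hg
            exact ⟨(hXmem g hgX).1, hocc, (hXmem g hgX).2⟩
        have h1 := hpow U hUW
        have h2 : ((bad P).card : ℝ) ≤ (avoiding q E (W \ U)).card := by exact_mod_cast hle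
        have h3 : (b : ℝ) ^ U.card * (bad P).card ≤ A.card :=
          (mul_le_mul_of_nonneg_left h2 (by positivity)).trans h1
        rw [← hUc, one_div, inv_pow, pow_succ, ← div_eq_mul_inv, le_div_iff₀ (by positivity)]
        nlinarith
    have h1 : (X.card : ℝ) ≤ (avoiding q E (insert v W)).card + ∑ P ∈ F v, ((bad P).card : ℝ) := by
      have h2 := (Finset.card_le_card hsub).trans (Finset.card_union_le _ _)
      have h3 : ((F v).biUnion bad).card ≤ ∑ P ∈ F v, (bad P).card := Finset.card_biUnion_le
      exact_mod_cast h2.trans (Nat.add_le_add_left h3 _)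
    have h2 : ∑ P ∈ F v, ((bad P).card : ℝ) ≤ b * A.card := by
      calc ∑ P ∈ F v, ((bad P).card : ℝ)
          ≤ ∑ P ∈ F v, b * A.card * (1 / (b : ℝ)) ^ P.card := Finset.sum_le_sum fun P _ => hbad P
        _ = b * A.card * ∑ P ∈ F v, (1 / (b : ℝ)) ^ P.card := by rw [Finset.mul_sum]
        _ ≤ b * A.card * 1 := mul_le_mul_of_nonneg_left (hsum v) (by positivity)
        _ = b * A.card := mul_one _
    linarith

/-- If few events concern each vertex, then some labelling avoids all of them. -/
theorem exists_avoiding {E : Set (Finset (ι × ι))} (hE : ∀ P ∈ E, IsEvent P) {b : ℕ}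
    (hb : 1 ≤ b) (hq : q = 2 * b) (F : ι → Finset (Finset (ι × ι)))
    (hF : ∀ v, ∀ P ∈ E, (∃ a ∈ P, a.1 = v ∨ a.2 = v) → P ∈ F v)
    (hsum : ∀ v, ∑ P ∈ F v, (1 / (b : ℝ)) ^ P.card ≤ 1) :
    ∃ f : ι → Fin q, ∀ P ∈ E, ¬ Occurs f P := by
  have h := pow_mul_card_avoiding_le (q := q) (E := E) (Nat.cast_nonneg b) (W := Finset.univ)
    (fun W _ => mul_card_avoiding_le hE hb hq F hF hsum W) Finset.univ (Finset.Subset.refl _)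
  have h0 : (fun _ => 0) ∈ avoiding q E (Finset.univ \ Finset.univ : Finset ι) := by
    refine mem_avoiding.2 ⟨fun _ _ => rfl, fun P hP hPW => ?_⟩
    obtain ⟨a, ha⟩ := (hE P hP).nonempty
    simpa using (hPW a ha).1
  have h1 : (0 : ℝ) < (avoiding q E (Finset.univ \ Finset.univ : Finset ι)).card := by
    exact_mod_cast Finset.card_pos.2 ⟨_, h0⟩
  have h2 : (0 : ℝ) < (avoiding q E Finset.univ).card := lt_of_lt_of_le (by positivity) h
  obtain ⟨f, hf⟩ := Finset.card_pos.1 (by exact_mod_cast h2)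
  exact ⟨f, fun P hP => (mem_avoiding.1 hf).2 P hP (by simp)⟩

end Avoidance

/-! ### Counting the pairs of paths near a node -/

section TreeNodes

variable {σ : Type u} [Fintype σ] [DecidableEq σ]

/-- The words of length at most `n`. -/
def words (σ : Type u) [Fintype σ] [DecidableEq σ] : ℕ → Finset (List σ)
  | 0 => {[]}
  | n + 1 => insert [] ((Finset.univ ×ˢ words σ n).image fun a => a.1 :: a.2)

theorem mem_words {n : ℕ} {m : List σ} : m ∈ words σ n ↔ m.length ≤ n := by
  induction n generalizing m with
  | zero => simp [words]
  | succ n ih =>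
    cases m with
    | nil => simp [words]
    | cons x m => simp [words, ih]

theorem card_words_le (n : ℕ) : (words σ n).card ≤ (Fintype.card σ + 1) ^ n := by
  induction n with
  | zero => simp [words]
  | succ n ih =>
    have h1 := Finset.card_insert_le ([] : List σ)
      ((Finset.univ ×ˢ words σ n).image fun a => a.1 :: a.2)
    have h2 : ((Finset.univ ×ˢ words σ n).image fun a : σ × List σ => a.1 :: a.2).card ≤ _ :=
      Finset.card_image_le
    rw [Finset.card_product, Finset.card_univ] at h2
    have h3 : 1 ≤ (Fintype.card σ + 1) ^ n := Nat.one_le_pow _ _ (Nat.succ_pos _)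
    have h4 := Nat.mul_le_mul_left (Fintype.card σ) ih
    rw [pow_succ, mul_add, mul_one, mul_comm _ (Fintype.card σ)]
    rw [words]
    omega

/-- The node `m` of the tree of depth `n`. -/
def treeNode (n : ℕ) (m : List σ) : words σ n := ⟨m.take n, mem_words.2 (by simp)⟩

theorem treeNode_val {n : ℕ} {m : List σ} (h : m.length ≤ n) : (treeNode n m).1 = m :=
  List.take_of_length_le h

/-- The nodes after `a` on the path that leaves `a` along the word `w`. -/
def pathNodes (n : ℕ) (a w : List σ) : List (words σ n) :=
  (List.range w.length).map fun k => treeNode n (a ++ w.take (k + 1))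

@[simp] theorem length_pathNodes (n : ℕ) (a w : List σ) : (pathNodes n a w).length = w.length := by
  simp [pathNodes]

theorem exists_of_mem_pathNodes {n : ℕ} {a w : List σ} (h : a.length + w.length ≤ n)
    {v : words σ n} (hv : v ∈ pathNodes n a w) :
    ∃ k < w.length, v.1 = a ++ w.take (k + 1) := by
  obtain ⟨k, hk, rfl⟩ := List.mem_map.1 hv
  rw [List.mem_range] at hk
  exact ⟨k, hk, treeNode_val (by simp; omega)⟩

theorem nodup_pathNodes {n : ℕ} {a w : List σ} (h : a.length + w.length ≤ n) :
    (pathNodes n a w).Nodup := by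
  refine List.Nodup.map_on (fun i hi j hj hij => ?_) List.nodup_range
  rw [List.mem_range] at hi hj
  have h1 := congrArg (fun v => v.1.length) hij
  simp only [treeNode_val (m := a ++ w.take (i + 1)) (n := n) (by simp; omega),
    treeNode_val (m := a ++ w.take (j + 1)) (n := n) (by simp; omega), List.length_append,
    List.length_take] at h1
  omega

theorem labels_treeNode {β : Type v} {n : ℕ} (f : words σ n → β) (a w : List σ) :
    PrefixCode.labels (fun m => f (treeNode n m)) a (a ++ w) = (pathNodes n a w).map f := by
  rw [PrefixCode.labels, PrefixCode.encode, List.length_append, List.range_add, List.map_append,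
    List.drop_left' (by simp), pathNodes, List.map_map, List.map_map]
  refine List.map_congr_left fun k _ => ?_
  simp only [Function.comp_apply, Nat.add_assoc, List.take_length_add_append]

/-- The ways to pair nodes on the path that leaves `b` along `w₂` with nodes on the path that leaves
`a` along `w₁`. -/
def pairings (n : ℕ) (a b w₁ w₂ : List σ) : Finset (Finset (words σ n × words σ n)) :=
  ((pathNodes n a w₁).sublists.toFinset ×ˢ (pathNodes n b w₂).sublists.toFinset).image
    fun p => (p.2.zip p.1).toFinset

theorem card_pairings_le (n : ℕ) (a b w₁ w₂ : List σ) :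
    (pairings n a b w₁ w₂).card ≤ 2 ^ w₁.length * 2 ^ w₂.length := by
  refine Finset.card_image_le.trans ?_
  rw [Finset.card_product]
  refine Nat.mul_le_mul ?_ ?_ <;>
  exact (List.toFinset_card_le _).trans_eq (by simp)

theorem mem_of_mem_pairings {n : ℕ} {a b w₁ w₂ : List σ} {P : Finset (words σ n × words σ n)}
    (hP : P ∈ pairings n a b w₁ w₂) {x : words σ n × words σ n} (hx : x ∈ P) :
    x.1 ∈ pathNodes n b w₂ ∧ x.2 ∈ pathNodes n a w₁ := by
  obtain ⟨⟨l₁, l₂⟩, hl, rfl⟩ := Finset.mem_image.1 hP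
  simp only [Finset.mem_product, List.mem_toFinset, List.mem_sublists] at hl
  have h := List.of_mem_zip (List.mem_toFinset.1 hx)
  exact ⟨hl.2.subset h.1, hl.1.subset h.2⟩

/-- The pairings near `v` of paths of lengths at most `l`. -/
def nearbyPairings {n : ℕ} (v : words σ n) (l : ℕ) : Finset (Finset (words σ n × words σ n)) :=
  ((words σ l ×ˢ words σ l) ×ˢ (Finset.range (l + 1) ×ˢ Finset.range (l + 1))).biUnion fun x =>
    let u := v.1.take (v.1.length - x.2.1)
    pairings n u (u ++ x.1.1.take x.2.2) x.1.1 x.1.2 ∪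
      pairings n (u.take (u.length - x.2.2)) u x.1.1 x.1.2

/-- Two words, two positions, two choices of subsequences, and the path on which `v` lies: the
polynomial factors are absorbed by `l + 1 ≤ 2 ^ l` and `2 ≤ 2 ^ l`. -/
theorem card_nearbyPairings_le {n : ℕ} (v : words σ n) {l : ℕ} (hl : 1 ≤ l) :
    (nearbyPairings v l).card ≤ (32 * (Fintype.card σ + 1) ^ 2) ^ l := by
  have h1 : (nearbyPairings v l).card ≤
      ((words σ l ×ˢ words σ l) ×ˢ (Finset.range (l + 1) ×ˢ Finset.range (l + 1))).card *
        (2 * 4 ^ l) := by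
    refine Finset.card_biUnion_le_card_mul _ _ _ fun x hx => ?_
    simp only [Finset.mem_product, mem_words] at hx
    have hw : 2 ^ x.1.1.length * 2 ^ x.1.2.length ≤ 4 ^ l := by
      have : 4 ^ l = 2 ^ l * 2 ^ l := by rw [← mul_pow]; norm_num
      rw [this]
      exact Nat.mul_le_mul (Nat.pow_le_pow_right (by norm_num) hx.1.1)
        (Nat.pow_le_pow_right (by norm_num) hx.1.2)
    refine (Finset.card_union_le _ _).trans ?_
    have := card_pairings_le n (v.1.take (v.1.length - x.2.1))
      (v.1.take (v.1.length - x.2.1) ++ x.1.1.take x.2.2) x.1.1 x.1.2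
    have := card_pairings_le n ((v.1.take (v.1.length - x.2.1)).take
      ((v.1.take (v.1.length - x.2.1)).length - x.2.2)) (v.1.take (v.1.length - x.2.1)) x.1.1 x.1.2
    omega
  refine h1.trans ?_
  rw [Finset.card_product, Finset.card_product, Finset.card_product, Finset.card_range]
  have h2 : l + 1 ≤ 2 ^ l := Nat.lt_two_pow_self
  have h3 : 2 ≤ 2 ^ l := Nat.le_self_pow (by omega) 2
  have h4 : (32 * (Fintype.card σ + 1) ^ 2) ^ l = ((Fintype.card σ + 1) ^ l *
      (Fintype.card σ + 1) ^ l) * (2 ^ l * 2 ^ l) * (2 ^ l * 4 ^ l) := by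
    simp only [← mul_pow]; congr 1; ring
  rw [h4]
  exact Nat.mul_le_mul (Nat.mul_le_mul (Nat.mul_le_mul (card_words_le l) (card_words_le l))
    (Nat.mul_le_mul h2 h2)) (Nat.mul_le_mul_right _ h3)

/-- Going back from `v` by its position on its path reaches the start of that path. The two words
and `j` then determine the start of the other one. -/
theorem mem_nearbyPairings {n : ℕ} {a w₁ w₂ : List σ} {j l : ℕ} (hj : j ≤ w₁.length)
    (h₁ : a.length + w₁.length ≤ n) (h₂ : (a ++ w₁.take j).length + w₂.length ≤ n)
    (hl₁ : w₁.length ≤ l) (hl₂ : w₂.length ≤ l) {P : Finset (words σ n × words σ n)}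
    (hP : P ∈ pairings n a (a ++ w₁.take j) w₁ w₂) {v : words σ n}
    (hv : ∃ x ∈ P, x.1 = v ∨ x.2 = v) : P ∈ nearbyPairings v l := by
  obtain ⟨x, hx, hxv⟩ := hv
  obtain ⟨hx₁, hx₂⟩ := mem_of_mem_pairings hP hx
  rw [nearbyPairings, Finset.mem_biUnion]
  rcases hxv with rfl | rfl
  · obtain ⟨k, hk, hkv⟩ := exists_of_mem_pathNodes h₂ hx₁
    refine ⟨((w₁, w₂), (k + 1, j)), ?_, ?_⟩
    · simp only [Finset.mem_product, mem_words, Finset.mem_range]; omega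
    · have hu : x.1.1.take (x.1.1.length - (k + 1)) = a ++ w₁.take j := by
        rw [hkv, List.length_append, List.length_take, min_eq_left (by omega),
          Nat.add_sub_cancel, List.take_left' rfl]
      refine Finset.mem_union_right _ ?_
      dsimp only
      rw [hu, List.length_append, List.length_take, min_eq_left hj, Nat.add_sub_cancel,
        List.take_left' rfl]
      exact hP
  · obtain ⟨k, hk, hkv⟩ := exists_of_mem_pathNodes h₁ hx₂
    refine ⟨((w₁, w₂), (k + 1, j)), ?_, ?_⟩
    · simp only [Finset.mem_product, mem_words, Finset.mem_range]; omega
    · have hu : x.2.1.take (x.2.1.length - (k + 1)) = a := by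
        rw [hkv, List.length_append, List.length_take, min_eq_left (by omega),
          Nat.add_sub_cancel, List.take_left' rfl]
      refine Finset.mem_union_left _ ?_
      dsimp only
      rw [hu]
      exact hP

end TreeNodes

/-! ### Bad lambdas as events -/

section TreeCodes

/-- A matching of two label strings pairs up two equally labelled subsequences. -/
theorem StringMatching.Matches.exists_sublists {ι : Type u} {β : Type v} {f : ι → β} :
    ∀ {τ : StringMatching β} {l₁ l₂ : List ι}, τ.Matches (l₁.map f) (l₂.map f) →
      ∃ L₁ L₂ : List ι, L₁.Sublist l₁ ∧ L₂.Sublist l₂ ∧ L₁.map f = L₂.map f ∧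
        l₁.length + l₂.length ≤ τ.stars + 2 * L₁.length
  | [], l₁, l₂, h => by
    obtain ⟨h1, h2, -⟩ := h
    have h1 : l₁ = [] := by simpa using h1.symm
    have h2 : l₂ = [] := by simpa using h2.symm
    subst h1 h2
    exact ⟨[], [], by simp, by simp, rfl, by simp⟩
  | (none, none) :: τ, l₁, l₂, h => by
    obtain ⟨h1, h2, h3⟩ := h
    obtain ⟨L₁, L₂, s₁, s₂, e, hl⟩ := exists_sublists (τ := τ) (l₁ := l₁) (l₂ := l₂)
      ⟨by simpa using h1, by simpa using h2, fun c hc => h3 c (List.mem_cons_of_mem _ hc)⟩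
    refine ⟨L₁, L₂, s₁, s₂, e, ?_⟩
    rw [stars_cons]; omega
  | (some a, none) :: τ, l₁, l₂, h => by
    obtain ⟨h1, h2, h3⟩ := h
    obtain ⟨u, l₁', rfl, -, hu⟩ := List.map_eq_cons_iff.1
      (show l₁.map f = a :: τ.filterMap Prod.fst by rw [← h1]; rfl)
    obtain ⟨L₁, L₂, s₁, s₂, e, hl⟩ := exists_sublists (τ := τ) (l₁ := l₁') (l₂ := l₂)
      ⟨hu.symm, by simpa using h2, fun c hc => h3 c (List.mem_cons_of_mem _ hc)⟩
    refine ⟨L₁, L₂, s₁.cons _, s₂, e, ?_⟩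
    rw [stars_cons]; simp; omega
  | (none, some a) :: τ, l₁, l₂, h => by
    obtain ⟨h1, h2, h3⟩ := h
    obtain ⟨u, l₂', rfl, -, hu⟩ := List.map_eq_cons_iff.1
      (show l₂.map f = a :: τ.filterMap Prod.snd by rw [← h2]; rfl)
    obtain ⟨L₁, L₂, s₁, s₂, e, hl⟩ := exists_sublists (τ := τ) (l₁ := l₁) (l₂ := l₂')
      ⟨by simpa using h1, hu.symm, fun c hc => h3 c (List.mem_cons_of_mem _ hc)⟩
    refine ⟨L₁, L₂, s₁, s₂.cons _, e, ?_⟩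
    rw [stars_cons]; simp; omega
  | (some a, some b) :: τ, l₁, l₂, h => by
    obtain ⟨h1, h2, h3⟩ := h
    have hab : a = b := by simpa using h3 (some a, some b) List.mem_cons_self
    obtain ⟨u, l₁', rfl, hua, hu⟩ := List.map_eq_cons_iff.1
      (show l₁.map f = a :: τ.filterMap Prod.fst by rw [← h1]; rfl)
    obtain ⟨u', l₂', rfl, hub, hu'⟩ := List.map_eq_cons_iff.1
      (show l₂.map f = b :: τ.filterMap Prod.snd by rw [← h2]; rfl)
    obtain ⟨L₁, L₂, s₁, s₂, e, hl⟩ := exists_sublists (τ := τ) (l₁ := l₁') (l₂ := l₂')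
      ⟨hu.symm, hu'.symm, fun c hc => h3 c (List.mem_cons_of_mem _ hc)⟩
    refine ⟨u :: L₁, u' :: L₂, s₁.cons_cons _, s₂.cons_cons _, by simp [e, hua, hub, hab], ?_⟩
    rw [stars_cons]; simp; omega

open Classical in
-- At most `M ^ l` pairings belong to size `l`, and each has weight at most `(2M) ^ (-l)`, as `l ≤ k
-- * P.card`. The geometric series of ratio `1/2` stays below 1.
theorem sum_nearbyPairings_le {σ : Type u} [Fintype σ] [DecidableEq σ] {n k : ℕ} (v : words σ n) :
    ∑ P ∈ (Finset.Icc 1 n).biUnion fun l => (nearbyPairings v l).filter fun P => l ≤ k * P.card,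
      (1 / (((2 * (32 * (Fintype.card σ + 1) ^ 2)) ^ k : ℕ) : ℝ)) ^ P.card ≤ 1 := by
  set M := 32 * (Fintype.card σ + 1) ^ 2 with hM
  have hM1 : 1 ≤ M := by
    have := Nat.one_le_pow 2 (Fintype.card σ + 1) (Nat.succ_pos _)
    omega
  have hM0 : (0 : ℝ) < M := by exact_mod_cast hM1
  have hM2 : (1 : ℝ) ≤ 2 * M := by
    have : (1 : ℝ) ≤ M := by exact_mod_cast hM1
    linarith
  have hterm : ∀ l ∈ Finset.Icc 1 n,
      ∑ P ∈ (nearbyPairings v l).filter (fun P => l ≤ k * P.card),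
        (1 / (((2 * M) ^ k : ℕ) : ℝ)) ^ P.card ≤ (1 / 2 : ℝ) ^ l := by
    intro l hl
    rw [Finset.mem_Icc] at hl
    have h1 : ∀ P ∈ (nearbyPairings v l).filter (fun P => l ≤ k * P.card),
        (1 / (((2 * M) ^ k : ℕ) : ℝ)) ^ P.card ≤ (1 / (2 * M : ℝ)) ^ l := by
      intro P hP
      have hle := (Finset.mem_filter.1 hP).2
      push_cast
      rw [one_div, ← inv_pow, ← pow_mul, one_div]
      exact pow_le_pow_of_le_one (by positivity) (inv_le_one_of_one_le₀ hM2) hle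
    have h2 : (((nearbyPairings v l).filter (fun P => l ≤ k * P.card)).card : ℝ) ≤ (M : ℝ) ^ l := by
      exact_mod_cast (Finset.card_filter_le _ _).trans (card_nearbyPairings_le v hl.1)
    calc _ ≤ ∑ P ∈ (nearbyPairings v l).filter (fun P => l ≤ k * P.card), (1 / (2 * M : ℝ)) ^ l :=
          Finset.sum_le_sum h1
      _ ≤ (M : ℝ) ^ l * (1 / (2 * M : ℝ)) ^ l := by
          rw [Finset.sum_const, nsmul_eq_mul]
          exact mul_le_mul_of_nonneg_right h2 (by positivity)
      _ = (1 / 2 : ℝ) ^ l := by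
          rw [← mul_pow]; congr 1; field_simp
  have hgeom : ∀ n : ℕ, ∑ l ∈ Finset.Icc 1 n, (1 / 2 : ℝ) ^ l = 1 - (1 / 2) ^ n := by
    intro n
    induction n with
    | zero => simp
    | succ n ih => rw [Finset.sum_Icc_succ_top (by omega), ih, pow_succ]; ring
  have hunion : ∀ s : Finset ℕ, ∀ F : ℕ → Finset (Finset (words σ n × words σ n)),
      ∀ g : Finset (words σ n × words σ n) → ℝ, (∀ P, 0 ≤ g P) →
      ∑ P ∈ s.biUnion F, g P ≤ ∑ l ∈ s, ∑ P ∈ F l, g P := by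
    intro s F g hg
    induction s using Finset.induction_on with
    | empty => simp
    | insert a s ha ih =>
      rw [Finset.biUnion_insert, Finset.sum_insert ha]
      have h1 := Finset.sum_union_inter (s₁ := F a) (s₂ := s.biUnion F) (f := g)
      have h2 : 0 ≤ ∑ P ∈ F a ∩ s.biUnion F, g P := Finset.sum_nonneg fun P _ => hg P
      linarith
  refine (hunion _ _ _ fun P => by positivity).trans ((Finset.sum_le_sum hterm).trans ?_)
  rw [hgeom]
  have : (0 : ℝ) ≤ (1 / 2) ^ n := by positivity
  linarith

open Classical in
/-- Edit-distance tree codes of every depth exist over an alphabet of constant size. -/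
theorem exists_isEditTreeCode (σ : Type u) [Finite σ] {ε : ℝ} (hε : 0 < ε) :
    ∃ q : ℕ, 1 ≤ q ∧ ∀ n : ℕ, ∃ C : PrefixCode σ (Fin q), C.IsEditTreeCode (1 - ε) n := by
  have := Fintype.ofFinite σ
  set k := ⌈2 / ε⌉₊ with hk
  set b := (2 * (32 * (Fintype.card σ + 1) ^ 2)) ^ k with hb
  have hb1 : 1 ≤ b := Nat.one_le_pow _ _ (by positivity)
  have : NeZero (2 * b) := ⟨by omega⟩
  refine ⟨2 * b, by omega, fun n => ?_⟩
  set E : Set (Finset (words σ n × words σ n)) := {P | IsEvent P ∧ ∃ (a w₁ w₂ : List σ) (j : ℕ),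
    j ≤ w₁.length ∧ a.length + w₁.length ≤ n ∧ (a ++ w₁.take j).length + w₂.length ≤ n ∧
    1 ≤ w₂.length ∧ P ∈ pairings n a (a ++ w₁.take j) w₁ w₂ ∧
    max w₁.length w₂.length ≤ k * P.card} with hE
  obtain ⟨f, hf⟩ := exists_avoiding (q := 2 * b) (E := E) (fun P hP => hP.1) hb1 rfl
    (fun v => (Finset.Icc 1 n).biUnion fun l =>
      (nearbyPairings v l).filter fun P => l ≤ k * P.card)
    (by
      rintro v P ⟨-, a, w₁, w₂, j, hj, h₁, h₂, h₃, hP, hc⟩ hv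
      refine Finset.mem_biUnion.2 ⟨max w₁.length w₂.length, ?_, Finset.mem_filter.2
        ⟨mem_nearbyPairings hj h₁ h₂ (le_max_left _ _) (le_max_right _ _) hP hv, hc⟩⟩
      rw [Finset.mem_Icc]
      omega)
    (fun v => sum_nearbyPairings_le v)
  refine ⟨fun m => f (treeNode n m), ?_⟩
  rintro ⟨A, B, D, F, ⟨w, rfl⟩, ⟨x, y, d, e, hxy, rfl, rfl⟩, hD, hF, hED⟩
  have hAD : A ++ w ++ x :: d = A ++ (w ++ x :: d) := by simp
  rw [hAD] at hED hD
  rw [labels_treeNode, labels_treeNode] at hED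
  set w₁ := w ++ x :: d with hw₁
  set w₂ := y :: e with hw₂
  have hB : A ++ w = A ++ w₁.take w.length := by rw [hw₁, List.take_left' rfl]
  have h₁ : A.length + w₁.length ≤ n := by simpa using hD
  have h₂ : (A ++ w).length + w₂.length ≤ n := by
    rwa [List.length_append] at hF
  obtain ⟨τ, hτ, hτs⟩ := exists_matches_editDist ((pathNodes n A w₁).map f)
    ((pathNodes n (A ++ w) w₂).map f)
  obtain ⟨L₁, L₂, s₁, s₂, hL, hlen⟩ := hτ.exists_sublists
  rw [hτs, length_pathNodes, length_pathNodes] at hlen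
  have hLlen : L₁.length = L₂.length := by simpa using congrArg List.length hL
  have hnodup : L₂.Nodup := (nodup_pathNodes h₂).sublist s₂
  have hfst : (L₂.zip L₁).map Prod.fst = L₂ := List.map_fst_zip hLlen.ge
  have hzip : (L₂.zip L₁).Nodup := List.Nodup.of_map Prod.fst (hfst.symm ▸ hnodup)
  set P := (L₂.zip L₁).toFinset with hP
  have hPc : P.card = L₁.length := by
    rw [hP, List.toFinset_card_of_nodup hzip, List.length_zip, hLlen, min_self]
  have hl1 : 1 ≤ w₂.length := by simp [hw₂]
  have hmax : max w₁.length w₂.length ≤ k * P.card := by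
    have e1 : (A ++ w₁).length - A.length = w₁.length := by simp
    have e2 : (A ++ w ++ w₂).length - (A ++ w).length = w₂.length := by
      rw [List.length_append, Nat.add_sub_cancel_left]
    rw [e1, e2] at hED
    set l := max w₁.length w₂.length
    have h3 : (l : ℝ) ≤ w₁.length + w₂.length := by
      exact_mod_cast max_le (Nat.le_add_right _ _) (Nat.le_add_left _ _)
    have h4 : ((w₁.length : ℝ) + w₂.length) ≤ editDist ((pathNodes n A w₁).map f)
        ((pathNodes n (A ++ w) w₂).map f) + 2 * L₁.length := by exact_mod_cast hlen
    -- All but `(1 - ε) l` of at least `l` symbols are matched, in pairs; hence the choice `k =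
    -- ⌈2/ε⌉`.
    have h5 : ε * l ≤ 2 * L₁.length := by linarith
    have h6 : 2 / ε ≤ k := Nat.le_ceil _
    have h7 : (l : ℝ) ≤ 2 / ε * L₁.length := by
      rw [div_mul_eq_mul_div, le_div_iff₀ hε]; linarith
    have h8 := h7.trans (mul_le_mul_of_nonneg_right h6 (Nat.cast_nonneg _))
    rw [hPc]
    exact_mod_cast h8
  have hPmem : P ∈ pairings n A (A ++ w₁.take w.length) w₁ w₂ := by
    rw [← hB]
    exact Finset.mem_image.2 ⟨(L₁, L₂), by simpa using ⟨s₁, s₂⟩, rfl⟩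
  refine hf P ⟨⟨?_, ?_, ?_⟩, A, w₁, w₂, w.length, by simp [hw₁], h₁, hB ▸ h₂, hl1, hPmem, hmax⟩ ?_
  · rw [← Finset.card_pos]
    by_contra h0
    rw [not_lt, Nat.le_zero] at h0
    rw [h0, mul_zero] at hmax
    omega
  · intro a ha a' ha' h
    have ha := List.mem_toFinset.1 (Finset.mem_coe.1 ha)
    have ha' := List.mem_toFinset.1 (Finset.mem_coe.1 ha')
    exact List.inj_on_of_nodup_map (hfst.symm ▸ hnodup) ha ha' h
  -- The two paths share no node: after `B` one continues with `x`, the other with `y`.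
  · intro a ha a' ha' h
    obtain ⟨i, hi, hi'⟩ := exists_of_mem_pathNodes h₁ (mem_of_mem_pairings hPmem ha).2
    obtain ⟨j, hj, hj'⟩ := exists_of_mem_pathNodes (hB ▸ h₂) (mem_of_mem_pairings hPmem ha').1
    rw [← hB] at hj'
    have h3 : A ++ w₁.take (i + 1) = A ++ w ++ w₂.take (j + 1) := by rw [← hi', h, hj']
    rw [List.append_assoc, List.append_cancel_left_eq] at h3
    have h4 : w ++ w₂.take (j + 1) <+: w ++ x :: d := h3 ▸ List.take_prefix _ _
    rw [List.prefix_append_right_inj, hw₂, List.take_succ_cons] at h4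
    exact hxy (List.cons_prefix_cons.1 h4).1.symm
  · intro a ha
    have ha := List.mem_toFinset.1 ha
    obtain ⟨i, hi, rfl⟩ := List.mem_iff_getElem.1 ha
    have h3 := congrArg (fun l => l[i]?) hL
    simp only [List.length_zip, lt_min_iff] at hi
    simp only [List.getElem?_map, List.getElem?_eq_getElem hi.1, List.getElem?_eq_getElem hi.2,
      Option.map_some, Option.some.injEq] at h3
    simpa using h3.symm

end TreeCodes

/-! ### Simulation of binary protocols -/

/-- Minimum suffix-distance decoders exist. -/
theorem PrefixCode.exists_isDecoder {σ : Type u} [Finite σ] {β : Type v} (n : ℕ)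
    (C : PrefixCode σ β) : ∃ dec : List β → List σ, C.IsDecoder n dec := by
  have h : ∀ r : List β, ∃ d : List σ, d.length ≤ n ∧
      ∀ m : List σ, m.length ≤ n → suffixDist (C.encode d) r ≤ suffixDist (C.encode m) r := fun r =>
    Set.exists_min_image {m : List σ | m.length ≤ n} (fun m => suffixDist (C.encode m) r)
      (List.finite_length_le σ n) ⟨[], Nat.zero_le n⟩
  choose dec hdec using h
  exact ⟨dec, hdec⟩

namespace Scheme

variable {I : Party → Type u} {J : Party → Type w} {β : Type v} {O O' : Type*}

/-- The scheme that translates its inputs and outputs by `g` and `h`. -/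
def translate (S : Scheme I β O) (g : (p : Party) → J p → I p) (h : O → O') : Scheme J β O' where
  send p x r := S.send p (g p x) r
  out p x r := h (S.out p (g p x) r)

theorem Reachable.of_translate {S : Scheme I β O} {g : (p : Party) → J p → I p} {h : O → O'}
    {N : ℕ} {inp : (p : Party) → J p} {c : Config β} (hc : (S.translate g h).Reachable N inp c) :
    S.Reachable N (fun p => g p (inp p)) c := by
  induction hc with
  | start => exact .start
  | deliver c _ hlt ih => exact .deliver c ih hlt
  | substitute c a _ hlt ih => exact .substitute c a ih hlt
  | spoof c a _ hlt ih => exact .spoof c a ih hlt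

theorem Resilient.translate {S : Scheme I β O} {N : ℕ} {ρ : ℝ} {f : ((p : Party) → I p) → O}
    (hS : S.Resilient N ρ f) (g : (p : Party) → J p → I p) (h : O → O')
    {f' : ((p : Party) → J p) → O'} (hf : ∀ inp, h (f fun p => g p (inp p)) = f' inp) :
    (S.translate g h).Resilient N ρ f' := fun inp c hc hN hρ p => by
  obtain ⟨h1, h2⟩ := hS _ c hc.of_translate hN hρ p
  exact ⟨h1, (congrArg h h2).trans (hf inp)⟩

end Scheme

namespace BinaryProtocol

variable {I : Party → Type u} (P : BinaryProtocol I)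

@[simp] theorem length_run (inp : (p : Party) → I p) (k : ℕ) : (P.run inp k).length = k := by
  induction k with
  | zero => rfl
  | succ k ih => simp [run, ih]

theorem getD_run (inp : (p : Party) → I p) {i k : ℕ} (h : i < k) :
    (P.run inp k).getD i false =
      P.bit (P.speaker (P.run inp i)) (inp (P.speaker (P.run inp i))) (P.run inp i) := by
  induction k with
  | zero => omega
  | succ k ih =>
    rw [run]
    rcases Nat.lt_succ_iff_lt_or_eq.1 h with h | rfl
    · rw [← ih h, List.getD_append _ _ _ _ (by simpa using h)]
    · rw [List.getD_append_right _ _ _ _ (by simp)]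
      simp

/-- The first bits of the transcript that a path of twice the length represents: of every two turns,
the first one counts if Alice speaks and the second one if Bob speaks. -/
def ofPath (v : List Bool) : ℕ → List Bool
  | 0 => []
  | j + 1 =>
    let t := ofPath v j
    t ++ [v.getD (match P.speaker t with | .alice => 2 * j | .bob => 2 * j + 1) false]

/-- The pointer jumping input that represents an input of the protocol. -/
def pointers (p : Party) (x : I p) : PJPInput p := fun v => P.bit p x (P.ofPath v (v.length / 2))

/-- Bit `j` of the protocol is simulated by turns `2j` (Alice) and `2j + 1` (Bob). At both of them
half the depth is `j`, so either party evaluates its bit on the transcript read so far, and the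
reader keeps the turn of the speaker. -/
theorem ofPath_run (T : ℕ) (inp : (p : Party) → I p) (j : ℕ) : ∀ k, 2 * j ≤ k →
    P.ofPath ((pjp T).run (fun p => P.pointers p (inp p)) k) j = P.run inp j := by
  induction j with
  | zero => intro k _; rfl
  | succ j ih =>
    intro k hk
    set x : (p : Party) → PJPInput p := fun p => P.pointers p (inp p) with hx
    have hturn : ∀ p i, i < k → ownerAt i = p → i / 2 = j → 2 * j ≤ i →
        ((pjp T).run x k).getD i false = P.bit p (inp p) (P.run inp j) := by
      rintro _ i hik rfl hij hji
      rw [getD_run _ _ hik]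
      change x (ownerAt ((pjp T).run x i).length) ((pjp T).run x i) = _
      rw [length_run, hx]
      change P.bit (ownerAt i) (inp (ownerAt i))
        (P.ofPath ((pjp T).run x i) (((pjp T).run x i).length / 2)) = _
      rw [length_run, hij, ih i hji]
    rw [ofPath, run, ih k (by omega)]
    cases hs : P.speaker (P.run inp j) with
    | alice =>
      exact congrArg (P.run inp j ++ [·]) (hturn .alice (2 * j) (by omega) (by simp [ownerAt])
        (by omega) (by omega))
    | bob =>
      exact congrArg (P.run inp j ++ [·]) (hturn .bob (2 * j + 1) (by omega) (by simp [ownerAt])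
        (by omega) (by omega))

end BinaryProtocol

theorem two_mul_ceil_mul_logb_le {ε : ℝ} {q T : ℕ} (hq : 1 ≤ q) (hT : 1 ≤ T) :
    2 * (⌈(T : ℝ) / ε ^ 2⌉₊ : ℝ) * Real.logb 2 q ≤ 2 * (1 / ε ^ 2 + 1) * Real.logb 2 q * T := by
  have hlog : 0 ≤ Real.logb 2 q := Real.logb_nonneg (by norm_num) (by exact_mod_cast hq)
  have hT' : (1 : ℝ) ≤ T := by exact_mod_cast hT
  have h1 : (⌈(T : ℝ) / ε ^ 2⌉₊ : ℝ) ≤ T * (1 / ε ^ 2 + 1) := by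
    have := (Nat.ceil_lt_add_one (a := (T : ℝ) / ε ^ 2) (by positivity)).le
    rw [mul_add, mul_one_div, mul_one]
    linarith
  calc _ ≤ 2 * (T * (1 / ε ^ 2 + 1)) * Real.logb 2 q := by gcongr
    _ = _ := by ring

theorem mainTheorem1 (ε : ℝ) (hε : 0 < ε) :
    -- the protocol, with any tree code, solves pointer jumping and is resilient
    (∀ (T : ℕ) (_ : 1 ≤ T) (β : Type v) (C : PrefixCode (PiPrime.Page ⌈1 / ε ^ 2⌉₊) β)
        (dec : Party → List β → List (PiPrime.Page ⌈1 / ε ^ 2⌉₊)),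
        C.IsEditTreeCode (1 - ε) ⌈(T : ℝ) / ε ^ 2⌉₊ →
        (∀ p, C.IsDecoder ⌈(T : ℝ) / ε ^ 2⌉₊ (dec p)) →
        ∀ ρ : ℝ, 0 ≤ ρ → ρ ≤ 1 / 18 - ε →
          (piPrime ⌈1 / ε ^ 2⌉₊ ⌈1 / ε⌉₊ T C dec).Resilient ⌈(T : ℝ) / ε ^ 2⌉₊ ρ
            (pjp T).transcript) ∧
    -- tree codes over an alphabet of constant size exist, and the protocol has constant rate
    (∃ (q : ℕ) (c : ℝ), ∀ T : ℕ, 1 ≤ T →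
        (∃ C : PrefixCode (PiPrime.Page ⌈1 / ε ^ 2⌉₊) (Fin q),
          C.IsEditTreeCode (1 - ε) ⌈(T : ℝ) / ε ^ 2⌉₊) ∧
        2 * (⌈(T : ℝ) / ε ^ 2⌉₊ : ℝ) * Real.logb 2 q ≤ c * T) ∧
    -- every binary protocol is simulated with a constant overhead
    (∃ (q : ℕ) (c : ℝ), ∀ (I : Party → Type u) (P : BinaryProtocol I), 1 ≤ P.length →
        ∃ (N : ℕ) (S : Scheme I (Fin q) (List Bool)),
          2 * (N : ℝ) * Real.logb 2 q ≤ c * P.length ∧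
          ∀ ρ : ℝ, 0 ≤ ρ → ρ ≤ 1 / 18 - ε → S.Resilient N ρ P.transcript) := by
  have hL := (Nat.ceil_lt_add_one (a := 1 / ε) (by positivity)).le
  obtain ⟨q, hq, hcode⟩ := exists_isEditTreeCode (PiPrime.Page ⌈1 / ε ^ 2⌉₊) hε
  refine ⟨fun T hT β C dec hC hdec ρ hρ hρ' => ?_, ?_, ?_⟩
  · exact PiPrime.resilient_piPrime hε (Nat.le_ceil _) (Nat.le_ceil _) hL (Nat.le_ceil _) hT hC
      hdec hρ hρ'
  · exact ⟨q, _, fun T hT => ⟨hcode _, two_mul_ceil_mul_logb_le hq hT⟩⟩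
  · refine ⟨q, 2 * (1 / ε ^ 2 + 1) * Real.logb 2 q * 2, fun I P hP => ?_⟩
    obtain ⟨C, hC⟩ := hcode ⌈((2 * P.length : ℕ) : ℝ) / ε ^ 2⌉₊
    obtain ⟨dec, hdec⟩ := C.exists_isDecoder ⌈((2 * P.length : ℕ) : ℝ) / ε ^ 2⌉₊
    refine ⟨⌈((2 * P.length : ℕ) : ℝ) / ε ^ 2⌉₊,
      (piPrime ⌈1 / ε ^ 2⌉₊ ⌈1 / ε⌉₊ (2 * P.length) C fun _ => dec).translate P.pointers
        fun v => P.ofPath v P.length, ?_, fun ρ hρ hρ' => ?_⟩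
    · refine (two_mul_ceil_mul_logb_le hq (by omega)).trans_eq ?_
      push_cast
      ring
    · exact (PiPrime.resilient_piPrime hε (Nat.le_ceil _) (Nat.le_ceil _) hL (Nat.le_ceil _)
        (by omega) hC (fun _ => hdec) hρ hρ').translate _ _ fun inp =>
          P.ofPath_run _ inp _ _ le_rfl
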